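/- **Setting.** All spaces are real. For $k\in\mathbb N_0$, $0\le i<2^k$ let $I=[i2^{-k},(i+1)2^{-k})$; $\mathcal D_k$ is the set of these intervals of level $k$, $\mathcal D=\bigcup_k\mathcal D_k$, $\mathcal D_{\le n}=\bigcup_{k\le n}\mathcal D_k$, and $\iota(I)=2^k+i$. Let $I^+,I^-$ be the left and right halves of $I$, $h_I=\chi_{I^+}-\chi_{I^-}$, $h_\varnothing=\chi_{[0,1)}$, $\iota(\varnothing)=0$, $\mathcal D^+=\mathcal D\cup\{\varnothing\}$, $r_n=\sum_{I\in\mathcal D_n}h_I$, $H=\operatorname{span}\{h_I\}_{I\in\mathcal D^+}$ and $\langle f,g\rangle=\int_0^1 fg$ for $f,g\in H$. Let $\mathcal D_\omega=\{(n,I):n\in\mathbb N_0,\ I\in\mathcal D_{\le n}\}$, ordered by $(n,I)\prec(m,J)$ iff $n<m$, or $n=m$ and $\iota(I)<\iota(J)$; series over $\mathcal D_\omega$ are summed in this order. *Haar system Hardy space.* Let $\|\cdot\|_X$ be a norm on $H$ such that $\|f\|_X=\|g\|_X$ whenever $|f|,|g|$ have the same distribution, and $\|\chi_{[0,1)}\|_X=1$.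 Let $\mathbf r=(r_I)_{I\in\mathcal D^+}$ be either $(r_{\iota(I)})_I$ or constantly $r_0$. Let $X(\mathbf r)$ be the completion of $H$ under $$\Bigl\|\sum_I a_Ih_I\Bigr\|_{X(\mathbf r)}=\Bigl\|s\mapsto\int_0^1\Bigl|\sum_I r_I(u)a_Ih_I(s)\Bigr|\,du\Bigr\|_X ,$$ and let $Y$ be the closed linear span of $\{h_I\}_{I\in\mathcal D}$ in $X(\mathbf r)$. Put $Y_n=\operatorname{span}\{h_I\}_{I\in\mathcal D_{\le n}}$. *Faithful Haar systems.* A finite faithful Haar system is a family $\hat h_I=\sum_{K\in\mathcal B_I}\theta_Kh_K$, $I\in\mathcal D_{\le n}$, where $\theta_K=\pm1$, every $\mathcal B_I$ is a non-empty finite set of pairwise disjoint intervals in $\mathcal D$, $\mathcal B_I\cap\mathcal B_J=\emptyset$ for $I\neq J$, $\bigcup\mathcal B_{[0,1)}=[0,1)$, and $\bigcup\mathcal B_{I^\pm}=\{\hat h_I=\pm1\}$ for every $I$ of level less than $n$. *The space $Y_\omega$.* Let $\tau_n\subset\mathbb N_0$, $n\in\mathbb N_0$, be pairwise disjoint with $|\tau_n|=n+1$,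 say $\tau_n=\{k_0<\dots<k_n\}$. Put $h^n_{[0,1)}=r_{k_0}$ and $h^n_{I^\pm}=r_{k_{j+1}}\chi_{\{h^n_I=\pm1\}}$ for $I\in\mathcal D_j$, $0\le j<n$. Let $H_\omega=\operatorname{span}\{h_I^n\}_{(n,I)\in\mathcal D_\omega}$, let $Y_\omega$ be the closure of $H_\omega$ in $Y$, and let $J_n\colon Y_n\to H_\omega$ be linear with $J_nh_I=h_I^n$. A faithful Haar system in $Y_\omega$ is a family $b_I^n=J_{N(n)}\hat h_I^n$, $(n,I)\in\mathcal D_\omega$, where $N\colon\mathbb N_0\to\mathbb N_0$ is strictly increasing and, for every $n$, $(\hat h^n_I)_{I\in\mathcal D_{\le n}}$ is a finite faithful Haar system contained in $Y_{N(n)}$. **Theorem.** Let $(b_I^n)_{(n,I)\in\mathcal D_\omega}$ be a faithful Haar system in $Y_\omega$. Then $b_I^n\in H_\omega$, the functionals $x\mapsto\langle h_I^n,x\rangle$ and $x\mapsto\langle b_I^n,x\rangle$ on $H_\omega$ extend to bounded linear functionals on $Y_\omega$ (denoted in the same way), and for every $x\in Y_\omega$ the series $$\hat Bx=\sum_{(n,I)\in\mathcal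 D_\omega}\frac{\langle h_I^n,x\rangle}{|I|}\,b_I^n,\qquad \hat Ax=\sum_{(n,I)\in\mathcal D_\omega}\frac{\langle b_I^n,x\rangle}{|I|}\,h_I^n$$ converge in norm. They define bounded linear operators $\hat A,\hat B\colon Y_\omega\to Y_\omega$ with $\hat Bh_I^n=b_I^n$, $\hat A\hat B=I_{Y_\omega}$ and $\|\hat A\|=\|\hat B\|=1$, and $\hat B$ is an isometry. -/

import Mathlib

open Set Filter Topology MeasureTheory

noncomputable section

namespace HaarHardy

/-! ### Dyadic intervals and the Haar system -/

/-- The dyadic interval `[i / 2 ^ k, (i + 1) / 2 ^ k)`, `0 ≤ i < 2 ^ k`, is encoded as `⟨k, i⟩`.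
Its level is `k`, and its length is `2 ^ (-k)`. -/
abbrev DyadicInterval : Type := Σ k : ℕ, Fin (2 ^ k)

namespace DyadicInterval

/-- The level of a dyadic interval: `I` has length `2 ^ (-level I)`. -/
def level (I : DyadicInterval) : ℕ := I.1

/-- The set of points of a dyadic interval. -/
def toSet (I : DyadicInterval) : Set ℝ :=
  Ico ((I.2 : ℕ) / 2 ^ I.1 : ℝ) (((I.2 : ℕ) + 1) / 2 ^ I.1 : ℝ)

/-- The length `|I|`. -/
def length (I : DyadicInterval) : ℝ := 1 / 2 ^ I.1

/-- The whole interval `[0, 1)`. -/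
def root : DyadicInterval := ⟨0, 0⟩

/-- The left half `I⁺`. -/
def left (I : DyadicInterval) : DyadicInterval :=
  ⟨I.1 + 1, ⟨2 * (I.2 : ℕ), by have := I.2.2; rw [pow_succ]; omega⟩⟩

/-- The right half `I⁻`. -/
def right (I : DyadicInterval) : DyadicInterval :=
  ⟨I.1 + 1, ⟨2 * (I.2 : ℕ) + 1, by have := I.2.2; rw [pow_succ]; omega⟩⟩

/-- The enumeration `ι(I) = 2 ^ k + i` of the dyadic intervals by the positive integers. -/
def iota (I : DyadicInterval) : ℕ := 2 ^ I.1 + (I.2 : ℕ)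

/-- The finite collection of all dyadic intervals of level `k`. -/
def ofLevel (k : ℕ) : Finset DyadicInterval :=
  Finset.univ.map ⟨fun i : Fin (2 ^ k) => (⟨k, i⟩ : DyadicInterval),
    fun _ _ h => eq_of_heq (Sigma.mk.inj h).2⟩

end DyadicInterval

open DyadicInterval

/-- The Haar function `h_I = χ_{I⁺} - χ_{I⁻}`. -/
def haar (I : DyadicInterval) (s : ℝ) : ℝ :=
  indicator I.left.toSet 1 s - indicator I.right.toSet 1 s

/-- The Haar system indexed by the dyadic intervals together with the empty set (which is encoded
as `none`); `h_∅ = χ_{[0,1)}`. -/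
def haarPlus : Option DyadicInterval → ℝ → ℝ
  | none => indicator (Ico 0 1) 1
  | some I => haar I

/-- The enumeration `ι`, extended by `ι(∅) = 0`. -/
def iotaPlus : Option DyadicInterval → ℕ
  | none => 0
  | some I => I.iota

/-- The standard Rademacher function `r_n`, the sum of the Haar functions of level `n`. -/
def rademacher (n : ℕ) (s : ℝ) : ℝ := ∑ I ∈ ofLevel n, haar I s

/-- The two admissible families `(r_I)` of Rademacher functions: the independent one, `r_{ι(I)}`,
and the constant one, `r_0`. -/
def rademacherFamilies : Set (Option DyadicInterval → ℝ → ℝ) :=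
  {fun I => rademacher (iotaPlus I), fun _ => rademacher 0}

/-- `H`, the linear span of the Haar system (including `h_∅`), as a space of functions. The
functions are defined on `ℝ` and vanish outside `[0, 1)`. -/
def H : Submodule ℝ (ℝ → ℝ) := Submodule.span ℝ (range haarPlus)

/-! ### Elementary facts: the Haar functions are linearly independent, and `H` is the space of
dyadic step functions -/

lemma mem_toSet_iff (I : DyadicInterval) (x : ℝ) :
    x ∈ I.toSet ↔ ⌊x * 2 ^ I.1⌋ = ((I.2 : ℕ) : ℤ) := by
  have h : (0 : ℝ) < 2 ^ I.1 := by positivity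
  rw [Int.floor_eq_iff, toSet, mem_Ico, div_le_iff₀ h, lt_div_iff₀ h]
  push_cast
  rfl

lemma floor_level {k M : ℕ} (h : k ≤ M) (x : ℝ) :
    ⌊x * 2 ^ k⌋ = ⌊x * 2 ^ M⌋ / (2 ^ (M - k) : ℕ) := by
  rw [← Int.floor_div_natCast]
  congr 1
  have : (2 : ℝ) ^ M = 2 ^ k * 2 ^ (M - k) := by rw [← pow_add]; congr 1; omega
  rw [this]
  push_cast
  field_simp

lemma mem_unit_iff (x : ℝ) : x ∈ Ico (0 : ℝ) 1 ↔ ⌊x * 2 ^ 0⌋ = 0 := by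
  rw [Int.floor_eq_iff]; simp

lemma haarPlus_step (J : Option DyadicInterval) : ∃ N : ℕ, ∀ M ≥ N, ∀ x y : ℝ,
    ⌊x * 2 ^ M⌋ = ⌊y * 2 ^ M⌋ → haarPlus J x = haarPlus J y := by
  cases J with
  | none =>
    refine ⟨0, fun M _ x y h => ?_⟩
    simp only [haarPlus, indicator, mem_unit_iff, floor_level (Nat.zero_le M), h, Pi.one_apply]
  | some J =>
    refine ⟨J.1 + 1, fun M hM x y h => ?_⟩
    have hl : J.left.1 ≤ M := hM
    have hr : J.right.1 ≤ M := hM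
    simp only [haarPlus, haar, indicator, mem_toSet_iff, floor_level hl, floor_level hr, h,
      Pi.one_apply]

lemma toSet_subset_unit (I : DyadicInterval) : I.toSet ⊆ Ico (0 : ℝ) 1 := by
  intro x hx
  rw [mem_toSet_iff] at hx
  rw [mem_unit_iff, floor_level (Nat.zero_le I.1), hx, Nat.sub_zero]
  exact_mod_cast Nat.div_eq_of_lt I.2.2

lemma haar_eq_zero_of_notMem (J : DyadicInterval) {x : ℝ} (hx : x ∉ Ico (0 : ℝ) 1) :
    haar J x = 0 := by
  have h1 : x ∉ J.left.toSet := fun h => hx (toSet_subset_unit _ h)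
  have h2 : x ∉ J.right.toSet := fun h => hx (toSet_subset_unit _ h)
  simp [haar, h1, h2]

lemma haarPlus_eq_zero_of_notMem (J : Option DyadicInterval) {x : ℝ} (hx : x ∉ Ico (0 : ℝ) 1) :
    haarPlus J x = 0 := by
  cases J with
  | none => simp only [haarPlus]; exact indicator_of_notMem hx _
  | some J => exact haar_eq_zero_of_notMem J hx

lemma haarPlus_linearIndependent : LinearIndependent ℝ haarPlus := by
  classical
  rw [linearIndependent_iff']
  intro s g hg
  by_contra hcon
  push Not at hcon
  obtain ⟨i₀, hi₀, hgi₀⟩ := hcon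
  let key : Option DyadicInterval → ℕ := fun J => J.elim 0 (fun J => J.1 + 1)
  obtain ⟨I, hI, hmax⟩ := Finset.exists_max_image (s.filter (fun i => g i ≠ 0)) key
    ⟨i₀, by simp [hi₀, hgi₀]⟩
  rw [Finset.mem_filter] at hI
  have hval : ∀ x, ∑ J ∈ s, g J * haarPlus J x = 0 := by
    intro x
    have := congrFun hg x
    simpa [Finset.sum_apply] using this
  cases I with
  | none =>
    have h := hval 0
    rw [Finset.sum_eq_single none] at h
    · simp only [haarPlus, indicator] at h
      simp at h
      exact hI.2 h
    · intro J hJ hne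
      by_cases hgJ : g J = 0
      · simp [hgJ]
      · have := hmax J (by simp [hJ, hgJ])
        cases J with
        | none => exact absurd rfl hne
        | some J => simp [key] at this
    · intro h; exact absurd hI.1 h
  | some I =>
    obtain ⟨k, i⟩ := I
    let x : ℝ := (2 * (i : ℕ) : ℕ) / 2 ^ (k + 1)
    let y : ℝ := (2 * (i : ℕ) + 1 : ℕ) / 2 ^ (k + 1)
    have hx : ⌊x * 2 ^ (k + 1)⌋ = ((2 * (i : ℕ) : ℕ) : ℤ) := by
      have : x * 2 ^ (k + 1) = ((2 * (i : ℕ) : ℕ) : ℝ) := by simp only [x]; field_simp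
      rw [this]; exact Int.floor_natCast _
    have hy : ⌊y * 2 ^ (k + 1)⌋ = ((2 * (i : ℕ) + 1 : ℕ) : ℤ) := by
      have : y * 2 ^ (k + 1) = ((2 * (i : ℕ) + 1 : ℕ) : ℝ) := by simp only [y]; field_simp
      rw [this]; exact Int.floor_natCast _
    have hlow : ∀ l ≤ k, ⌊x * 2 ^ l⌋ = ⌊y * 2 ^ l⌋ := by
      intro l hl
      rw [floor_level (show l ≤ k + 1 by omega), hx, floor_level (show l ≤ k + 1 by omega), hy]
      have : 2 ^ (k + 1 - l) = 2 * 2 ^ (k - l) := by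
        rw [← pow_succ']; congr 1; omega
      rw [this]
      norm_cast
      rw [← Nat.div_div_eq_div_mul, ← Nat.div_div_eq_div_mul]
      congr 1
      omega
    have hdiff : ∑ J ∈ s, g J * (haarPlus J x - haarPlus J y) = 0 := by
      simp only [mul_sub, Finset.sum_sub_distrib, hval, sub_zero]
    rw [Finset.sum_eq_single (some ⟨k, i⟩)] at hdiff
    · have h1 : haarPlus (some ⟨k, i⟩) x = 1 := by
        simp only [haarPlus, haar, indicator, mem_toSet_iff, left, right, hx]
        simp
      have h2 : haarPlus (some ⟨k, i⟩) y = -1 := by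
        simp only [haarPlus, haar, indicator, mem_toSet_iff, left, right, hy]
        simp
      rw [h1, h2] at hdiff
      have : g (some ⟨k, i⟩) = 0 := by linarith
      exact hI.2 this
    · intro J hJ hne
      by_cases hgJ : g J = 0
      · simp [hgJ]
      have hk := hmax J (by simp [hJ, hgJ])
      rw [mul_eq_zero]; right
      rw [sub_eq_zero]
      cases J with
      | none =>
        simp only [haarPlus, indicator, mem_unit_iff, hlow 0 (Nat.zero_le k), Pi.one_apply]
      | some J =>
        obtain ⟨l, j⟩ := J
        have hlk : l ≤ k := by simpa [key] using hk
        rcases Nat.lt_or_ge l k with hlt | hge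
        · simp only [haarPlus, haar, indicator, mem_toSet_iff, left, right, hlow (l + 1) hlt,
            Pi.one_apply]
        · obtain rfl : l = k := le_antisymm hlk hge
          have hij : (i : ℕ) ≠ (j : ℕ) := by
            intro h
            apply hne
            rw [Fin.ext h]
          simp only [haarPlus, haar, indicator, mem_toSet_iff, left, right, hx, hy]
          rw [if_neg (by omega), if_neg (by omega), if_neg (by omega), if_neg (by omega)]
    · intro h; exact absurd hI.1 h

/-- The Haar system as a (Hamel) basis of `H`. -/
def haarBasis : Module.Basis (Option DyadicInterval) ℝ H :=
  Module.Basis.span haarPlus_linearIndependent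

lemma haarBasis_apply (I : Option DyadicInterval) :
    ((haarBasis I : H) : ℝ → ℝ) = haarPlus I :=
  congrArg Subtype.val (Module.Basis.span_apply haarPlus_linearIndependent I)

lemma indicator_toSet_mem_H (k : ℕ) (i : Fin (2 ^ k)) :
    (indicator (toSet ⟨k, i⟩) 1 : ℝ → ℝ) ∈ H := by
  induction k with
  | zero =>
    have h0 : (indicator (toSet ⟨0, i⟩) 1 : ℝ → ℝ) = haarPlus none := by
      simp [haarPlus, toSet]
    rw [h0]
    exact Submodule.subset_span (mem_range_self _)
  | succ k ih =>
    have hlt : (i : ℕ) / 2 < 2 ^ k := by have := i.2; have := pow_succ 2 k; omega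
    let P : DyadicInterval := ⟨k, ⟨(i : ℕ) / 2, hlt⟩⟩
    have hP := ih ⟨(i : ℕ) / 2, hlt⟩
    have hh : haarPlus (some P) ∈ H := Submodule.subset_span (mem_range_self _)
    have hfl : ∀ x : ℝ, ⌊x * 2 ^ k⌋ = ⌊x * 2 ^ (k + 1)⌋ / 2 := by
      intro x
      rw [floor_level (Nat.le_succ k)]
      simp
    rcases Nat.mod_two_eq_zero_or_one (i : ℕ) with hi | hi
    · have : (indicator (toSet ⟨k + 1, i⟩) 1 : ℝ → ℝ)
          = (1 / 2 : ℝ) • (indicator (toSet P) 1 : ℝ → ℝ) + (1 / 2 : ℝ) • haarPlus (some P) := by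
        funext x
        simp only [haarPlus, haar, indicator, mem_toSet_iff, left, right, P, Pi.add_apply,
          Pi.smul_apply, smul_eq_mul, Pi.one_apply, hfl]
        push_cast
        split_ifs <;> first | (exfalso; omega) | norm_num
      rw [this]
      exact H.add_mem (H.smul_mem _ hP) (H.smul_mem _ hh)
    · have : (indicator (toSet ⟨k + 1, i⟩) 1 : ℝ → ℝ)
          = (1 / 2 : ℝ) • (indicator (toSet P) 1 : ℝ → ℝ) - (1 / 2 : ℝ) • haarPlus (some P) := by
        funext x
        simp only [haarPlus, haar, indicator, mem_toSet_iff, left, right, P, Pi.sub_apply,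
          Pi.smul_apply, smul_eq_mul, Pi.one_apply, hfl]
        push_cast
        split_ifs <;> first | (exfalso; omega) | norm_num
      rw [this]
      exact H.sub_mem (H.smul_mem _ hP) (H.smul_mem _ hh)

lemma step_eq_sum {f : ℝ → ℝ} {N : ℕ}
    (hstep : ∀ x y : ℝ, ⌊x * 2 ^ N⌋ = ⌊y * 2 ^ N⌋ → f x = f y)
    (hzero : ∀ x, x ∉ Ico (0 : ℝ) 1 → f x = 0) :
    f = ∑ i : Fin (2 ^ N),
      f (((i : ℕ) : ℝ) / 2 ^ N) • (indicator (toSet ⟨N, i⟩) 1 : ℝ → ℝ) := by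
  funext x
  simp only [Finset.sum_apply, Pi.smul_apply, smul_eq_mul]
  by_cases hx : x ∈ Ico (0 : ℝ) 1
  · have hnn : 0 ≤ ⌊x * 2 ^ N⌋ := Int.floor_nonneg.2 (mul_nonneg hx.1 (by positivity))
    obtain ⟨m, hm⟩ := Int.eq_ofNat_of_zero_le hnn
    have hmlt : m < 2 ^ N := by
      have h1 : ⌊x * 2 ^ N⌋ < (2 ^ N : ℤ) := by
        rw [Int.floor_lt]
        push_cast
        have : (0 : ℝ) < 2 ^ N := by positivity
        nlinarith [hx.2]
      rw [hm] at h1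
      exact_mod_cast h1
    rw [Finset.sum_eq_single ⟨m, hmlt⟩]
    · have hmem : x ∈ toSet ⟨N, ⟨m, hmlt⟩⟩ := by rw [mem_toSet_iff]; exact hm
      rw [indicator_of_mem hmem]
      simp only [Pi.one_apply, mul_one]
      apply hstep
      rw [hm]
      have : ((m : ℝ) / 2 ^ N) * 2 ^ N = m := by field_simp
      rw [this]
      exact (Int.floor_natCast m).symm
    · intro j _ hj
      have hnm : x ∉ toSet ⟨N, j⟩ := by
        rw [mem_toSet_iff, hm]
        intro h
        apply hj
        apply Fin.ext
        exact_mod_cast h.symm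
      rw [indicator_of_notMem hnm, mul_zero]
    · intro h; exact absurd (Finset.mem_univ _) h
  · rw [hzero x hx, Finset.sum_eq_zero]
    intro j _
    rw [indicator_of_notMem (fun h => hx (toSet_subset_unit _ h)), mul_zero]

lemma mem_H_of_step {f : ℝ → ℝ} {N : ℕ}
    (hstep : ∀ x y : ℝ, ⌊x * 2 ^ N⌋ = ⌊y * 2 ^ N⌋ → f x = f y)
    (hzero : ∀ x, x ∉ Ico (0 : ℝ) 1 → f x = 0) : f ∈ H := by
  rw [step_eq_sum hstep hzero]
  exact H.sum_mem fun i _ => H.smul_mem _ (indicator_toSet_mem_H N i)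

lemma step_of_mem_H {f : ℝ → ℝ} (hf : f ∈ H) : ∃ N : ℕ, ∀ M ≥ N, ∀ x y : ℝ,
    ⌊x * 2 ^ M⌋ = ⌊y * 2 ^ M⌋ → f x = f y := by
  induction hf using Submodule.span_induction with
  | mem f hf =>
    obtain ⟨J, rfl⟩ := hf
    exact haarPlus_step J
  | zero => exact ⟨0, fun _ _ _ _ _ => rfl⟩
  | add f g _ _ hf hg =>
    obtain ⟨N₁, h₁⟩ := hf
    obtain ⟨N₂, h₂⟩ := hg
    refine ⟨max N₁ N₂, fun M hM x y h => ?_⟩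
    simp only [Pi.add_apply]
    rw [h₁ M (le_trans (le_max_left _ _) hM) x y h, h₂ M (le_trans (le_max_right _ _) hM) x y h]
  | smul c f _ hf =>
    obtain ⟨N, h₁⟩ := hf
    refine ⟨N, fun M hM x y h => ?_⟩
    simp only [Pi.smul_apply]
    rw [h₁ M hM x y h]

lemma eq_zero_of_mem_H {f : ℝ → ℝ} (hf : f ∈ H) {x : ℝ} (hx : x ∉ Ico (0 : ℝ) 1) : f x = 0 := by
  induction hf using Submodule.span_induction with
  | mem f hf =>
    obtain ⟨J, rfl⟩ := hf
    exact haarPlus_eq_zero_of_notMem J hx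
  | zero => rfl
  | add f g _ _ hf hg => simp [hf, hg]
  | smul c f _ hf => simp [hf]

/-! ### Haar system spaces -/

/-- The distribution of `|f|` with respect to Lebesgue measure on `[0, 1)`. -/
def absDistribution (f : ℝ → ℝ) : Measure ℝ :=
  Measure.map (fun s => |f s|) (volume.restrict (Ico (0 : ℝ) 1))

/-- The norm of a Haar system space: a norm on `H` such that `‖f‖` depends only on the
distribution of `|f|` and such that `‖χ_{[0,1)}‖ = 1`. The Haar system space itself is the completion
of `H` under this norm. -/
structure HaarSystemNorm where
  /-- the norm, as a seminorm on `H` -/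
  toSeminorm : Seminorm ℝ H
  /-- the seminorm is a norm -/
  definite : ∀ f : H, toSeminorm f = 0 → f = 0
  /-- the norm depends only on the distribution of the absolute value -/
  rearrangement_invariant : ∀ f g : H,
    absDistribution f = absDistribution g → toSeminorm f = toSeminorm g
  /-- normalization -/
  normalized : toSeminorm (haarBasis none) = 1

lemma HaarSystemNorm.eq_of_abs_eq (X : HaarSystemNorm) {f g : H}
    (h : ∀ s, |(f : ℝ → ℝ) s| = |(g : ℝ → ℝ) s|) : X.toSeminorm f = X.toSeminorm g := by
  apply X.rearrangement_invariant
  simp only [absDistribution, h]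

/-- The norm of a Haar system space is monotone. -/
lemma HaarSystemNorm.mono (X : HaarSystemNorm) {f g : H}
    (h : ∀ s, |(f : ℝ → ℝ) s| ≤ |(g : ℝ → ℝ) s|) : X.toSeminorm f ≤ X.toSeminorm g := by
  classical
  obtain ⟨N₁, h₁⟩ := step_of_mem_H f.2
  obtain ⟨N₂, h₂⟩ := step_of_mem_H g.2
  let N := max N₁ N₂
  let e : Fin (2 ^ N) → H := fun i => ⟨indicator (toSet ⟨N, i⟩) 1, indicator_toSet_mem_H N i⟩
  let c : (Fin (2 ^ N) → ℝ) → H := fun a => ∑ i, a i • e i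
  have hcval : ∀ a s, ((c a : H) : ℝ → ℝ) s = ∑ i, a i * indicator (toSet ⟨N, i⟩) 1 s := by
    intro a s
    simp [c, e, Finset.sum_apply]
  have habs : ∀ a s, |((c a : H) : ℝ → ℝ) s| = ∑ i, |a i| * indicator (toSet ⟨N, i⟩) 1 s := by
    intro a s
    rw [hcval]
    by_cases hs : ∃ i, s ∈ toSet ⟨N, i⟩
    · obtain ⟨i, hi⟩ := hs
      have hne : ∀ j, j ≠ i → s ∉ toSet ⟨N, j⟩ := by
        intro j hj hsj
        rw [mem_toSet_iff] at hi hsj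
        apply hj
        apply Fin.ext
        have := hsj.symm.trans hi
        exact_mod_cast this
      rw [Finset.sum_eq_single i, Finset.sum_eq_single i]
      · simp [hi]
      · intro j _ hj; simp [hne j hj]
      · simp
      · intro j _ hj; simp [hne j hj]
      · simp
    · push Not at hs
      simp [hs]
  have hsign : ∀ a b : Fin (2 ^ N) → ℝ, (∀ i, |a i| = |b i|) →
      X.toSeminorm (c a) = X.toSeminorm (c b) := by
    intro a b hab
    apply X.eq_of_abs_eq
    intro s
    rw [habs, habs]
    simp only [hab]
  have key : ∀ a b : Fin (2 ^ N) → ℝ, (∀ i, |a i| ≤ |b i|) →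
      ∀ S : Finset (Fin (2 ^ N)),
        X.toSeminorm (c fun i => if i ∈ S then a i else b i) ≤ X.toSeminorm (c b) := by
    intro a b hab S
    induction S using Finset.induction_on with
    | empty => simp
    | insert j S hj ih =>
      let u : Fin (2 ^ N) → ℝ := fun i => if i ∈ S then a i else b i
      let v : Fin (2 ^ N) → ℝ := fun i => if i = j then - u i else u i
      have huv : X.toSeminorm (c v) = X.toSeminorm (c u) := by
        apply hsign
        intro i
        simp only [v]
        split_ifs <;> simp
      have huj : u j = b j := by simp [u, hj]
      obtain ⟨t, ht1, ht2, ht⟩ : ∃ t : ℝ, -1 ≤ t ∧ t ≤ 1 ∧ a j = t * b j := by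
        by_cases hb : b j = 0
        · refine ⟨0, by norm_num, by norm_num, ?_⟩
          have := hab j
          rw [hb, abs_zero] at this
          simpa using abs_nonpos_iff.1 this
        · have hle : |a j / b j| ≤ 1 := by
            rw [abs_div]
            exact div_le_one_of_le₀ (hab j) (abs_nonneg _)
          refine ⟨a j / b j, (abs_le.1 hle).1, (abs_le.1 hle).2, ?_⟩
          field_simp
      have hcomb : (c fun i => if i ∈ insert j S then a i else b i)
          = ((1 + t) / 2) • c u + ((1 - t) / 2) • c v := by
        simp only [c, Finset.smul_sum, ← Finset.sum_add_distrib, smul_smul, ← add_smul]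
        apply Finset.sum_congr rfl
        intro i _
        congr 1
        by_cases hij : i = j
        · subst hij
          simp only [Finset.mem_insert_self, if_true, v, huj, ht]
          ring
        · simp only [Finset.mem_insert, hij, false_or, v, if_false, u]
          ring
      rw [hcomb]
      refine (map_add_le_add X.toSeminorm _ _).trans ?_
      rw [map_smul_eq_mul, map_smul_eq_mul, huv, Real.norm_of_nonneg (by linarith),
        Real.norm_of_nonneg (by linarith)]
      have : X.toSeminorm (c u) ≤ X.toSeminorm (c b) := ih
      linarith
  let a : Fin (2 ^ N) → ℝ := fun i => (f : ℝ → ℝ) (((i : ℕ) : ℝ) / 2 ^ N)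
  let b : Fin (2 ^ N) → ℝ := fun i => (g : ℝ → ℝ) (((i : ℕ) : ℝ) / 2 ^ N)
  have hf : f = c a := by
    apply Subtype.ext
    have := step_eq_sum (h₁ N (le_max_left _ _)) (fun x hx => eq_zero_of_mem_H f.2 hx)
    rw [this]
    simp [c, e, a]
  have hg : g = c b := by
    apply Subtype.ext
    have := step_eq_sum (h₂ N (le_max_right _ _)) (fun x hx => eq_zero_of_mem_H g.2 hx)
    rw [this]
    simp [c, e, b]
  have := key a b (fun i => h _) Finset.univ
  simp only [Finset.mem_univ, if_true] at this
  rw [hf, hg]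
  exact this

/-! ### Haar system Hardy spaces -/

/-- For `f = ∑ a_I h_I ∈ H`, the function `∑ r_I(u) a_I h_I(s)` of `u` and `s`. -/
def randomized (r : rademacherFamilies) (f : H) (u s : ℝ) : ℝ :=
  (haarBasis.repr f).sum fun I a => r.1 I u * a * haarPlus I s

/-- For `f = ∑ a_I h_I ∈ H`, the function `s ↦ ∫_0^1 |∑ r_I(u) a_I h_I(s)| du`. -/
def hardyFun (r : rademacherFamilies) (f : H) (s : ℝ) : ℝ :=
  ∫ u in (0 : ℝ)..1, |randomized r f u s|

lemma hardyFun_mem_H (r : rademacherFamilies) (f : H) : hardyFun r f ∈ H := by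
  classical
  choose n hn using haarPlus_step
  let N := (haarBasis.repr f).support.sup n
  apply mem_H_of_step (N := N)
  · intro x y hxy
    have : ∀ u, randomized r f u x = randomized r f u y := by
      intro u
      apply Finset.sum_congr rfl
      intro I hI
      simp only [hn I N (Finset.le_sup hI) x y hxy]
    simp only [hardyFun, this]
  · intro x hx
    have : ∀ u, randomized r f u x = 0 := by
      intro u
      apply Finset.sum_eq_zero
      intro I _
      simp only [haarPlus_eq_zero_of_notMem I hx, mul_zero]
    simp [hardyFun, this]

/-- The function `s ↦ ∫_0^1 |∑ r_I(u) a_I h_I(s)| du` as an element of `H`. -/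
def hardyMap (r : rademacherFamilies) (f : H) : H := ⟨hardyFun r f, hardyFun_mem_H r f⟩

lemma haar_measurable (I : DyadicInterval) : Measurable (haar I) :=
  (measurable_one.indicator measurableSet_Ico).sub (measurable_one.indicator measurableSet_Ico)

lemma haar_abs_le (I : DyadicInterval) (s : ℝ) : |haar I s| ≤ 1 := by
  have h1 : ∀ A : Set ℝ, 0 ≤ (indicator A 1 s : ℝ) ∧ (indicator A 1 s : ℝ) ≤ 1 := by
    intro A
    by_cases h : s ∈ A <;> simp [h]
  have := h1 I.left.toSet
  have := h1 I.right.toSet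
  rw [haar, abs_le]
  constructor <;> linarith

lemma rademacher_integrable (n : ℕ) : IntervalIntegrable (rademacher n) volume 0 1 := by
  have : rademacher n = ∑ I ∈ ofLevel n, haar I := by
    funext s; simp [rademacher, Finset.sum_apply]
  rw [this]
  apply IntervalIntegrable.sum
  intro I _
  rw [intervalIntegrable_iff]
  refine Measure.integrableOn_of_bounded (M := 1) (by simp)
    (haar_measurable I).aestronglyMeasurable ?_
  exact Eventually.of_forall fun s => by rw [Real.norm_eq_abs]; exact haar_abs_le I s

lemma family_integrable (r : rademacherFamilies) (I : Option DyadicInterval) :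
    IntervalIntegrable (r.1 I) volume 0 1 := by
  rcases r.2 with h | h
  · rw [h]; exact rademacher_integrable _
  · rw [mem_singleton_iff] at h
    rw [h]; exact rademacher_integrable _

lemma randomized_integrable (r : rademacherFamilies) (f : H) (s : ℝ) :
    IntervalIntegrable (fun u => randomized r f u s) volume 0 1 := by
  have : (fun u => randomized r f u s) = ∑ I ∈ (haarBasis.repr f).support,
      fun u => r.1 I u * (haarBasis.repr f) I * haarPlus I s := by
    funext u; simp [randomized, Finsupp.sum, Finset.sum_apply]
  rw [this]
  apply IntervalIntegrable.sum
  intro I _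
  exact ((family_integrable r I).mul_const _).mul_const _

lemma randomized_add (r : rademacherFamilies) (f g : H) (u s : ℝ) :
    randomized r (f + g) u s = randomized r f u s + randomized r g u s := by
  simp only [randomized, map_add]
  exact Finsupp.sum_add_index' (by simp) (by intros; ring)

lemma randomized_smul (r : rademacherFamilies) (c : ℝ) (f : H) (u s : ℝ) :
    randomized r (c • f) u s = c * randomized r f u s := by
  simp only [randomized, map_smul]
  rw [Finsupp.sum_smul_index' (by simp), Finsupp.mul_sum]
  apply Finsupp.sum_congr
  intro I _
  simp only [smul_eq_mul]
  ring

lemma hardyFun_nonneg (r : rademacherFamilies) (f : H) (s : ℝ) : 0 ≤ hardyFun r f s :=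
  intervalIntegral.integral_nonneg zero_le_one fun _ _ => abs_nonneg _

/-- The norm of the Haar system Hardy space `X(r)` on `H`:
`‖∑ a_I h_I‖_{X(r)} = ‖ s ↦ ∫_0^1 |∑ r_I(u) a_I h_I(s)| du ‖_X`. -/
def hardySeminorm (X : HaarSystemNorm) (r : rademacherFamilies) : Seminorm ℝ H :=
  Seminorm.of (fun f => X.toSeminorm (hardyMap r f))
    (by
      intro f g
      refine le_trans ?_ (map_add_le_add X.toSeminorm (hardyMap r f) (hardyMap r g))
      apply X.mono
      intro s
      change |hardyFun r (f + g) s| ≤ |hardyFun r f s + hardyFun r g s|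
      rw [abs_of_nonneg (hardyFun_nonneg _ _ _),
        abs_of_nonneg (add_nonneg (hardyFun_nonneg _ _ _) (hardyFun_nonneg _ _ _))]
      unfold hardyFun
      rw [← intervalIntegral.integral_add (randomized_integrable r f s).abs
        (randomized_integrable r g s).abs]
      apply intervalIntegral.integral_mono_on zero_le_one (randomized_integrable r (f + g) s).abs
        ((randomized_integrable r f s).abs.add (randomized_integrable r g s).abs)
      intro u _
      rw [randomized_add]
      exact abs_add_le _ _)
    (by
      intro c f
      rw [← map_smul_eq_mul X.toSeminorm c (hardyMap r f)]
      apply X.eq_of_abs_eq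
      intro s
      change |hardyFun r (c • f) s| = |c * hardyFun r f s|
      have : hardyFun r (c • f) s = |c| * hardyFun r f s := by
        simp only [hardyFun, randomized_smul, abs_mul, intervalIntegral.integral_const_mul]
      rw [this, abs_mul, abs_mul, abs_abs])

/-- A copy of `H`, equipped with the norm of `X(r)`. -/
def HardyPre (_X : HaarSystemNorm) (_r : rademacherFamilies) : Type := H

instance (X : HaarSystemNorm) (r : rademacherFamilies) : SeminormedAddCommGroup (HardyPre X r) :=
  (hardySeminorm X r).toAddGroupSeminorm.toSeminormedAddCommGroup

instance (X : HaarSystemNorm) (r : rademacherFamilies) : Module ℝ (HardyPre X r) :=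
  inferInstanceAs (Module ℝ H)

instance (X : HaarSystemNorm) (r : rademacherFamilies) : NormedSpace ℝ (HardyPre X r) where
  norm_smul_le c f := (map_smul_eq_mul (hardySeminorm X r) c f).le

/-- The Haar system Hardy space `X(r)`, the completion of `H` under `‖·‖_{X(r)}`. -/
def HardySpace (X : HaarSystemNorm) (r : rademacherFamilies) : Type :=
  UniformSpace.Completion (HardyPre X r)

instance (X : HaarSystemNorm) (r : rademacherFamilies) : NormedAddCommGroup (HardySpace X r) :=
  inferInstanceAs (NormedAddCommGroup (UniformSpace.Completion (HardyPre X r)))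

instance (X : HaarSystemNorm) (r : rademacherFamilies) : NormedSpace ℝ (HardySpace X r) :=
  inferInstanceAs (NormedSpace ℝ (UniformSpace.Completion (HardyPre X r)))

instance (X : HaarSystemNorm) (r : rademacherFamilies) : CompleteSpace (HardySpace X r) :=
  inferInstanceAs (CompleteSpace (UniformSpace.Completion (HardyPre X r)))

/-- The canonical embedding of `H` into `X(r)`. -/
def toHardy (X : HaarSystemNorm) (r : rademacherFamilies) : H →ₗ[ℝ] HardySpace X r :=
  (UniformSpace.Completion.toComplₗᵢ (𝕜 := ℝ) (E := HardyPre X r)).toLinearMap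

lemma norm_toHardy (X : HaarSystemNorm) (r : rademacherFamilies) (f : H) :
    ‖toHardy X r f‖ = X.toSeminorm (hardyMap r f) :=
  (UniformSpace.Completion.toComplₗᵢ (𝕜 := ℝ) (E := HardyPre X r)).norm_map f

/-- The subspace `Y = X_0(r)` of `X(r)`, the closed linear span of the Haar functions `h_I`, where
`I` is a dyadic interval (so `h_∅` is left out). -/
def HardySpace₀ (X : HaarSystemNorm) (r : rademacherFamilies) : Submodule ℝ (HardySpace X r) :=
  (Submodule.span ℝ (range fun I : DyadicInterval =>
    toHardy X r (haarBasis (some I)))).topologicalClosure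

/-! ### The space `Y_ω` -/

/-- The index set `{(n, I) : n ∈ ℕ₀, I a dyadic interval of level at most n}`. -/
@[ext] structure DyadicOmega where
  /-- the first component -/
  n : ℕ
  /-- the second component -/
  I : DyadicInterval
  /-- the level constraint -/
  le : I.level ≤ n

lemma iota_injective : Function.Injective iota := by
  rintro ⟨k, i⟩ ⟨l, j⟩ h
  simp only [iota] at h
  have hi := i.2
  have hj := j.2
  have hkl : k = l := by
    rcases lt_trichotomy k l with hlt | heq | hgt
    · have : 2 ^ (k + 1) ≤ 2 ^ l := Nat.pow_le_pow_right (by norm_num) hlt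
      rw [pow_succ] at this
      omega
    · exact heq
    · have : 2 ^ (l + 1) ≤ 2 ^ k := Nat.pow_le_pow_right (by norm_num) hgt
      rw [pow_succ] at this
      omega
  subst hkl
  have : i = j := Fin.ext (by omega)
  rw [this]

/-- The sorting key `(n, ι(I))` of a pair `(n, I)`. -/
def DyadicOmega.key (p : DyadicOmega) : ℕ ×ₗ ℕ := toLex (p.n, p.I.iota)

lemma DyadicOmega.key_injective : Function.Injective DyadicOmega.key := by
  intro p q h
  have h' : (p.n, p.I.iota) = (q.n, q.I.iota) := toLex.injective h
  rw [Prod.mk.injEq] at h'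
  exact DyadicOmega.ext h'.1 (iota_injective h'.2)

/-- The linear order `≺`: `(n, I) ≺ (m, J)` if and only if `n < m`, or `n = m` and
`ι(I) < ι(J)`. -/
instance : LinearOrder DyadicOmega := LinearOrder.lift' DyadicOmega.key DyadicOmega.key_injective

lemma DyadicOmega.lt_iff (p q : DyadicOmega) :
    p < q ↔ p.n < q.n ∨ (p.n = q.n ∧ p.I.iota < q.I.iota) := by
  change p.key < q.key ↔ _
  rw [Prod.Lex.lt_iff]
  rfl

lemma DyadicOmega.finite_Iic (p : DyadicOmega) : (Iic p).Finite := by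
  apply Set.Finite.of_injOn (f := fun q : DyadicOmega => (q.n, q.I.iota))
    (t := Iic p.n ×ˢ Iic (2 ^ (p.n + 1)))
  · intro q hq
    have hq' : q ≤ p := hq
    have hn : q.n ≤ p.n := by
      rcases hq'.lt_or_eq with h | h
      · rcases (DyadicOmega.lt_iff q p).1 h with h | h
        · exact h.le
        · exact h.1.le
      · rw [h]
    refine ⟨hn, ?_⟩
    have h1 : 2 ^ q.I.1 ≤ 2 ^ p.n := Nat.pow_le_pow_right (by norm_num) (q.le.trans hn)
    have h2 := q.I.2.2
    change 2 ^ q.I.1 + (q.I.2 : ℕ) ≤ 2 ^ (p.n + 1)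
    rw [pow_succ]
    omega
  · intro q _ q' _ h
    exact DyadicOmega.key_injective (congrArg toLex h)
  · exact (Set.finite_Iic _).prod (Set.finite_Iic _)

instance : LocallyFiniteOrderBot DyadicOmega :=
  LocallyFiniteOrderBot.ofIic DyadicOmega (fun p => p.finite_Iic.toFinset) (fun p q => by simp)

/-- `x` is the norm limit of the series `∑_{(n, I)} f (n, I)`, summed in the order `≺`. -/
def HasOrderedSum {E : Type*} [NormedAddCommGroup E] (f : DyadicOmega → E) (x : E) : Prop :=
  Tendsto (fun p => ∑ q ∈ Finset.Iic p, f q) atTop (𝓝 x)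

/-- The collections of dyadic intervals that define the faithful Haar system with frequencies
`k 0 < k 1 < ⋯`: one starts with all intervals of level `k 0` for `[0, 1)`, and for the halves
`I⁺`, `I⁻` of an interval `I` of level `j` one takes the intervals of level `k (j + 1)` that are
contained in `[ĥ_I = 1]` and `[ĥ_I = -1]`, respectively, where `ĥ_I` is the sum of the `h_L` over
the collection of `I`. The interval `⟨j + 1, i⟩` is the left half of `⟨j, i / 2⟩` if `i` is
even and its right half if `i` is odd. -/
def rademacherCollection (k : ℕ → ℕ) : (j : ℕ) → ℕ → Finset DyadicInterval
  | 0, _ => ofLevel (k 0)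
  | j + 1, i => by
      classical
      exact (ofLevel (k (j + 1))).filter fun K =>
        K.toSet ⊆ {s | ∑ L ∈ rademacherCollection k j (i / 2), haar L s
          = if i % 2 = 0 then 1 else -1}

/-- The function `h_I^n` as an element of `H`: the frequencies are the elements of `τ n` in
increasing order. -/
def hOmega (τ : ℕ → Finset ℕ) (n : ℕ) (I : DyadicInterval) : H :=
  ∑ K ∈ rademacherCollection (Nat.nth fun m => m ∈ τ n) I.1 I.2, haarBasis (some K)

/-- `H_ω`, the linear span of the functions `h_I^n`. -/
def HOmega (τ : ℕ → Finset ℕ) : Submodule ℝ H :=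
  Submodule.span ℝ (range fun p : DyadicOmega => hOmega τ p.n p.I)

/-- The independent sum `Y_ω`, the closure of `H_ω` in `Y = X_0(r)`; since `Y` is closed in
`X(r)` and contains `H_ω`, this is the closure of `H_ω` in `X(r)`. -/
def YOmega (X : HaarSystemNorm) (r : rademacherFamilies) (τ : ℕ → Finset ℕ) :
    Submodule ℝ (HardySpace X r) :=
  ((HOmega τ).map (toHardy X r)).topologicalClosure

lemma toHardy_mem_YOmega (X : HaarSystemNorm) (r : rademacherFamilies) (τ : ℕ → Finset ℕ) {x : H}
    (hx : x ∈ HOmega τ) : toHardy X r x ∈ YOmega X r τ :=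
  Submodule.le_topologicalClosure _ (Submodule.mem_map_of_mem hx)

lemma hOmega_mem (τ : ℕ → Finset ℕ) (p : DyadicOmega) : hOmega τ p.n p.I ∈ HOmega τ :=
  Submodule.subset_span (mem_range_self p)

/-- The function `h_I^n`, `(n, I) ∈ D_ω`, as an element of `H_ω`. -/
def hBasis (τ : ℕ → Finset ℕ) (p : DyadicOmega) : HOmega τ := ⟨hOmega τ p.n p.I, hOmega_mem τ p⟩

lemma YOmega_le_HardySpace₀ (X : HaarSystemNorm) (r : rademacherFamilies) (τ : ℕ → Finset ℕ) :
    YOmega X r τ ≤ HardySpace₀ X r := by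
  apply Submodule.topologicalClosure_mono
  rw [Submodule.map_le_iff_le_comap, HOmega, Submodule.span_le]
  rintro _ ⟨p, rfl⟩
  rw [SetLike.mem_coe, Submodule.mem_comap]
  dsimp only
  rw [hOmega, map_sum]
  exact Submodule.sum_mem _ fun K _ => Submodule.subset_span (mem_range_self K)

/-- The canonical embedding of `H_ω` into `Y_ω`. -/
def toYOmega (X : HaarSystemNorm) (r : rademacherFamilies) (τ : ℕ → Finset ℕ) :
    HOmega τ →ₗ[ℝ] YOmega X r τ :=
  (toHardy X r).restrict (fun _ hx => toHardy_mem_YOmega X r τ hx)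

/-! ### Faithful Haar systems -/

/-- The finite-dimensional space `Y_n`, the span of the Haar functions `h_I` with `I` of level at
most `n`. -/
def YFin (n : ℕ) : Submodule ℝ H :=
  Submodule.span ℝ {f | ∃ I : DyadicInterval, I.level ≤ n ∧ f = haarBasis (some I)}

/-- `(h I)`, where `I` ranges over the dyadic intervals of level at most `n`, is a finite faithful
Haar system. The values `h I` for `I` of level greater than `n` are irrelevant. -/
def IsFaithfulHaarSystem (n : ℕ) (h : DyadicInterval → H) : Prop :=
  ∃ (B : DyadicInterval → Finset DyadicInterval) (θ : DyadicInterval → ℝ),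
    (∀ K, θ K = 1 ∨ θ K = -1) ∧
    (∀ I, I.level ≤ n → (B I).Nonempty) ∧
    (∀ I, I.level ≤ n → h I = ∑ K ∈ B I, θ K • haarBasis (some K)) ∧
    (∀ I, I.level ≤ n → (B I : Set DyadicInterval).PairwiseDisjoint toSet) ∧
    (∀ I J, I.level ≤ n → J.level ≤ n → I ≠ J → Disjoint (B I) (B J)) ∧
    (⋃ K ∈ B root, K.toSet) = Ico (0 : ℝ) 1 ∧
    ∀ I, I.level < n →
      (⋃ K ∈ B I.left, K.toSet) = {s | (h I : ℝ → ℝ) s = 1} ∧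
      (⋃ K ∈ B I.right, K.toSet) = {s | (h I : ℝ → ℝ) s = -1}

/-- The linear map `J_n` with `J_n h_I = h_I^n` for `I` of level at most `n`, which is only used on
`Y_n` (it is extended by zero on the remaining elements of the Haar basis). -/
def J (τ : ℕ → Finset ℕ) (n : ℕ) : H →ₗ[ℝ] H :=
  haarBasis.constr ℝ fun o => o.elim 0 fun I => if I.level ≤ n then hOmega τ n I else 0

/-- `(b_I^n)` is a faithful Haar system in `Y_ω`: there are a strictly increasing function `N` and,
for every `n`, a finite faithful Haar system `(ĥ_I^n)` in `Y_{N(n)}` such that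
`b_I^n = J_{N(n)} ĥ_I^n`. -/
def IsFaithfulHaarSystemInYOmega (τ : ℕ → Finset ℕ) (b : DyadicOmega → H) : Prop :=
  ∃ (N : ℕ → ℕ) (h : ℕ → DyadicInterval → H), StrictMono N ∧
    (∀ n, IsFaithfulHaarSystem n (h n)) ∧
    (∀ n I, I.level ≤ n → h n I ∈ YFin (N n)) ∧
    ∀ p : DyadicOmega, b p = J τ (N p.n) (h p.n p.I)

/-- The pairing `⟨f, g⟩ = ∫_0^1 f g` of elements of `H`. -/
def pairing (f g : H) : ℝ := ∫ s in Ico (0 : ℝ) 1, (f : ℝ → ℝ) s * (g : ℝ → ℝ) s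

end HaarHardy

end

open HaarHardy

/-!
The proof reduces every norm to the joint distribution of finitely many functions on `[0, 1)`.

*Coordinates.* A point `s` of `[0, 1)` is described by its binary digits, which are independent and
uniform under Lebesgue measure (`map_bits`). The function `h_I^n` depends only on the digits with
positions in `τ n`, and in terms of these `n + 1` digits it is simply the Haar function `h_I`
(`hOmega_eq_pull`). Since the sets `τ n` are disjoint, the blocks of digits are independent
(`map_blockBits`); functions of the block `n` are written as `pull τ n Φ`.

*Norms and distributions.* Let each `f i` be a combination of Haar functions of pairwise disjoint
intervals, with disjoint collections for different `i`. At each point only one interval of the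
collection of `f i` matters, so `∫ |∑ r_I(u) a_I h_I(s)| du` is a fixed function of the values
`f i (s)`, and the norm of `∑ f i` in `X(r)` depends only on the joint law of the family `f`
(`norm_sum_eq_of_jointLaw_eq`). Moreover, if `g i` is the average of copies of `f i` that all have
the joint law of `f`, then `‖∑ g i‖ ≤ ‖∑ f i‖` (`norm_sum_le_of_average`). Three applications carry
the theorem.

* The values at a point of the functions `ĥ_I`, `I` of level at most `n`, of a finite faithful Haar
  system are those of the functions `h_I` at some other point (`exists_seqHaar_eq`). This gives a
  measure preserving map from the block `N n` to the block `n` that carries `h_I^n` to `b_I^n`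
  (`FaithfulBlocks.jointLaw_eq`); hence `h_I^n ↦ b_I^n` preserves norms
  (`FaithfulBlocks.norm_sum_b`).
* Exchanging the two halves of the last interval is measure preserving and changes the sign of the
  last term only. Averaging shows that the `h_I^n` form a monotone basic sequence
  (`norm_sum_filter_le`), which makes the coordinate functionals bounded and the expansions of the
  elements of `Y_ω` convergent.
* The orthogonal projection onto the span of the `b_I^n` acts on each group of terms `h_J^m` that
  make up one `b_I^n` as a conditional expectation, namely as the average over all permutations of
  the values of the digit block that preserve the values of the `b_I^n`. It is therefore a
  contraction (`FaithfulBlocks.norm_projection_le`).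

The operator `B` is the extension of `h_I^n ↦ b_I^n`, and `A` is the extension of the map that takes
the coefficients of the projection; both series follow from the expansion with respect to `h_I^n`.
-/


noncomputable section

namespace HaarHardy

open DyadicInterval
open scoped ENNReal

/-! ### Binary digits -/

/-- The binary digits of `s`, the digit of weight `2 ^ (-(k + 1))` having the index `k`. -/
def bits (s : ℝ) (k : ℕ) : Bool := decide (⌊s * 2 ^ (k + 1)⌋ % 2 = 1)

/-- The sign of a digit: `0` stands for a left half, where a Haar function is `1`, and `1` for a
right half, where it is `-1`. -/
def sgn (b : Bool) : ℝ := if b then -1 else 1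

/-- The integer whose binary digits, the most significant one first, are the first `k` entries
of `x`. For the digits of `s`, this is the position of the dyadic interval of level `k` that
contains `s`. -/
def prefixIndex (x : ℕ → Bool) : ℕ → ℕ
  | 0 => 0
  | k + 1 => 2 * prefixIndex x k + (x k).toNat

/-- The Haar function `h_I` as a function of the sequence of binary digits. -/
def seqHaar (I : DyadicInterval) (x : ℕ → Bool) : ℝ :=
  if prefixIndex x I.1 = (I.2 : ℕ) then sgn (x I.1) else 0

lemma sgn_not (b : Bool) : sgn (!b) = -sgn b := by cases b <;> simp [sgn]

lemma sgn_ne_zero (b : Bool) : sgn b ≠ 0 := by cases b <;> simp [sgn]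

lemma abs_sgn (b : Bool) : |sgn b| = 1 := by cases b <;> simp [sgn]

lemma prefixIndex_lt (x : ℕ → Bool) (k : ℕ) : prefixIndex x k < 2 ^ k := by
  induction k with
  | zero => simp [prefixIndex]
  | succ k ih =>
    have := Bool.toNat_le (x k)
    rw [prefixIndex, pow_succ]
    omega

lemma prefixIndex_succ_eq_iff {x y : ℕ → Bool} {k : ℕ} :
    prefixIndex x (k + 1) = prefixIndex y (k + 1) ↔
      prefixIndex x k = prefixIndex y k ∧ x k = y k := by
  simp only [prefixIndex]
  cases x k <;> cases y k <;> simp <;> omega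

lemma prefixIndex_eq_iff {x y : ℕ → Bool} {k : ℕ} :
    prefixIndex x k = prefixIndex y k ↔ ∀ j < k, x j = y j := by
  induction k with
  | zero => simp [prefixIndex]
  | succ k ih =>
    rw [prefixIndex_succ_eq_iff, ih]
    constructor
    · rintro ⟨h1, h2⟩ j hj
      rcases Nat.lt_succ_iff_lt_or_eq.1 hj with h | rfl
      · exact h1 j h
      · exact h2
    · exact fun h => ⟨fun j hj => h j (by omega), h k (by omega)⟩

lemma seqHaar_congr {I : DyadicInterval} {x y : ℕ → Bool} (h : ∀ j ≤ I.1, x j = y j) :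
    seqHaar I x = seqHaar I y := by
  rw [seqHaar, seqHaar, prefixIndex_eq_iff.2 fun j hj => h j hj.le, h _ le_rfl]

lemma seqHaar_ne_zero_iff {I : DyadicInterval} {x : ℕ → Bool} :
    seqHaar I x ≠ 0 ↔ prefixIndex x I.1 = I.2 := by
  rw [seqHaar]
  split_ifs with h <;> simp [h, sgn_ne_zero]

lemma floor_eq_prefixIndex {s : ℝ} (hs : s ∈ Ico (0 : ℝ) 1) (k : ℕ) :
    ⌊s * 2 ^ k⌋ = prefixIndex (bits s) k := by
  induction k with
  | zero => simpa [prefixIndex] using (mem_unit_iff s).1 hs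
  | succ k ih =>
    have h := floor_level (Nat.le_succ k) s
    rw [ih, Nat.succ_eq_add_one, Nat.add_sub_cancel_left, pow_one] at h
    rw [prefixIndex, bits]
    by_cases hb : ⌊s * 2 ^ (k + 1)⌋ % 2 = 1
    · simp only [hb, decide_true, Bool.toNat_true]
      push_cast at h ⊢
      omega
    · simp only [hb, decide_false, Bool.toNat_false]
      push_cast at h ⊢
      omega

lemma mem_toSet_iff_prefixIndex {s : ℝ} (hs : s ∈ Ico (0 : ℝ) 1) (I : DyadicInterval) :
    s ∈ I.toSet ↔ prefixIndex (bits s) I.1 = I.2 := by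
  rw [mem_toSet_iff, floor_eq_prefixIndex hs]
  norm_cast

lemma prefixIndex_left_iff {I : DyadicInterval} {x : ℕ → Bool} :
    prefixIndex x I.left.1 = I.left.2 ↔ seqHaar I x = 1 := by
  simp only [left, prefixIndex, seqHaar, sgn]
  cases x I.1 <;> (simp; try split_ifs) <;> norm_num <;> omega

lemma prefixIndex_right_iff {I : DyadicInterval} {x : ℕ → Bool} :
    prefixIndex x I.right.1 = I.right.2 ↔ seqHaar I x = -1 := by
  simp only [right, prefixIndex, seqHaar, sgn]
  cases x I.1 <;> (simp; try split_ifs) <;> norm_num <;> omega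

lemma seqHaar_eq_or (I : DyadicInterval) (x : ℕ → Bool) :
    seqHaar I x = 0 ∨ seqHaar I x = 1 ∨ seqHaar I x = -1 := by
  rw [seqHaar]
  cases x I.1 <;> split_ifs <;> simp [sgn]

lemma haar_eq_seqHaar {s : ℝ} (hs : s ∈ Ico (0 : ℝ) 1) (I : DyadicInterval) :
    haar I s = seqHaar I (bits s) := by
  simp only [haar, indicator, mem_toSet_iff_prefixIndex hs, prefixIndex_left_iff,
    prefixIndex_right_iff, Pi.one_apply]
  rcases seqHaar_eq_or I (bits s) with h | h | h <;> rw [h] <;> norm_num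

lemma sum_ofLevel {M : Type*} [AddCommMonoid M] (k : ℕ) (f : DyadicInterval → M) :
    ∑ I ∈ ofLevel k, f I = ∑ i : Fin (2 ^ k), f ⟨k, i⟩ := by
  rw [ofLevel, Finset.sum_map]
  rfl

lemma mem_ofLevel {k : ℕ} {I : DyadicInterval} : I ∈ ofLevel k ↔ I.1 = k := by
  obtain ⟨l, i⟩ := I
  simp only [ofLevel, Finset.mem_map, Finset.mem_univ, true_and]
  constructor
  · rintro ⟨a, ha⟩
    exact (Sigma.mk.inj ha).1.symm
  · rintro rfl
    exact ⟨i, rfl⟩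

/-- The position of the dyadic interval of level `k` that a digit sequence describes. -/
def prefixInterval (x : ℕ → Bool) (k : ℕ) : DyadicInterval := ⟨k, prefixIndex x k, prefixIndex_lt x k⟩

lemma eq_prefixInterval {I : DyadicInterval} {x : ℕ → Bool} (h : prefixIndex x I.1 = I.2) :
    I = prefixInterval x I.1 := by
  obtain ⟨k, i⟩ := I
  simp only [prefixInterval]
  congr
  exact Fin.ext h.symm

lemma seqHaar_prefixInterval (x : ℕ → Bool) (k : ℕ) :
    seqHaar (prefixInterval x k) x = sgn (x k) := by
  simp [seqHaar, prefixInterval]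

/-- Of all Haar functions of one level, only one does not vanish at a given point. -/
lemma sum_ofLevel_mul_seqHaar (k : ℕ) (x : ℕ → Bool) (c : DyadicInterval → ℝ) :
    ∑ I ∈ ofLevel k, c I * seqHaar I x = c (prefixInterval x k) * sgn (x k) := by
  rw [Finset.sum_eq_single (prefixInterval x k)]
  · rw [seqHaar_prefixInterval]
  · intro I hI hne
    rw [mem_ofLevel] at hI
    have : seqHaar I x = 0 := by
      by_contra h
      refine hne ?_
      rw [eq_prefixInterval (seqHaar_ne_zero_iff.1 h), hI]
    rw [this, mul_zero]
  · intro h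
    exact absurd (mem_ofLevel.2 rfl) h

lemma rademacher_eq_sgn {s : ℝ} (hs : s ∈ Ico (0 : ℝ) 1) (k : ℕ) :
    rademacher k s = sgn (bits s k) := by
  have := sum_ofLevel_mul_seqHaar k (bits s) 1
  simp only [Pi.one_apply, one_mul] at this
  rw [rademacher, ← this]
  exact Finset.sum_congr rfl fun I _ => haar_eq_seqHaar hs I

/-- The reproducing kernel of the space of functions of the first `n` digits, expanded in the
Haar system. -/
lemma haar_kernel (x y : ℕ → Bool) (n : ℕ) :
    1 + ∑ k ∈ Finset.range n, 2 ^ k * ∑ I ∈ ofLevel k, seqHaar I x * seqHaar I y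
      = if prefixIndex x n = prefixIndex y n then (2 : ℝ) ^ n else 0 := by
  induction n with
  | zero => simp [prefixIndex]
  | succ n ih =>
    rw [Finset.sum_range_succ, ← add_assoc, ih, sum_ofLevel_mul_seqHaar]
    by_cases h : prefixIndex x n = prefixIndex y n
    · have : prefixInterval y n = prefixInterval x n := by simp [prefixInterval, h]
      rw [this, seqHaar_prefixInterval]
      simp only [prefixIndex_succ_eq_iff, h, true_and, if_true]
      cases x n <;> cases y n <;> simp [sgn] <;> ring
    · have : seqHaar (prefixInterval y n) x = 0 := by
        by_contra h'
        exact h (seqHaar_ne_zero_iff.1 h')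
      rw [this, if_neg h, if_neg]
      · simp
      · rw [prefixIndex_succ_eq_iff]; tauto

/-! ### Finite sequences of digits -/

/-- The possible values of the digits of a block of `n + 1` Rademacher functions. -/
abbrev Block (n : ℕ) : Type := Fin (n + 1) → Bool

/-- Extension of a finite digit sequence by zeros. -/
def pad {n : ℕ} (v : Block n) (j : ℕ) : Bool := if h : j < n + 1 then v ⟨j, h⟩ else false

lemma pad_injective {n : ℕ} {v w : Block n} (h : ∀ j ≤ n, pad v j = pad w j) : v = w := by
  funext ⟨j, hj⟩
  simpa [pad, hj] using h j (by omega)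

/-- Every finite digit sequence is the digit sequence of a point of `[0, 1)`. -/
lemma exists_bits_eq_pad {n : ℕ} (v : Block n) : ∃ s ∈ Ico (0 : ℝ) 1, bits s = pad v := by
  have hpow : (0 : ℝ) < 2 ^ (n + 1) := by positivity
  have hlt := prefixIndex_lt (pad v) (n + 1)
  let s : ℝ := prefixIndex (pad v) (n + 1) / 2 ^ (n + 1)
  have hs : s ∈ Ico (0 : ℝ) 1 := by
    refine ⟨by positivity, ?_⟩
    rw [div_lt_one hpow]
    exact_mod_cast hlt
  have hfl : ∀ m ≥ n + 1, s * 2 ^ m = (prefixIndex (pad v) (n + 1) * 2 ^ (m - (n + 1)) : ℕ) := by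
    intro m hm
    have : (2 : ℝ) ^ m = 2 ^ (n + 1) * 2 ^ (m - (n + 1)) := by rw [← pow_add]; congr 1; omega
    rw [this]
    push_cast
    simp only [s]
    field_simp
  have key : ∀ j ≤ n, bits s j = pad v j := by
    have h := floor_eq_prefixIndex hs (n + 1)
    rw [hfl _ le_rfl, Int.floor_natCast] at h
    have h' : prefixIndex (bits s) (n + 1) = prefixIndex (pad v) (n + 1) := by
      have h2 : prefixIndex (pad v) (n + 1) * 2 ^ (n + 1 - (n + 1))
        = prefixIndex (bits s) (n + 1) := by exact_mod_cast h
      simpa using h2.symm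
    exact fun j hj => prefixIndex_eq_iff.1 h' j (by omega)
  refine ⟨s, hs, funext fun j => ?_⟩
  rcases Nat.lt_or_ge j (n + 1) with hj | hj
  · exact key j (by omega)
  · rw [bits, hfl (j + 1) (by omega), Int.floor_natCast, pad, dif_neg (by omega)]
    have : j + 1 - (n + 1) = (j - (n + 1)) + 1 := by omega
    rw [this, pow_succ]
    simp only [decide_eq_false_iff_not]
    push_cast
    rw [← mul_assoc]
    omega

lemma prefixIndex_pad_eq_iff {n : ℕ} {v w : Block n} :
    prefixIndex (pad v) (n + 1) = prefixIndex (pad w) (n + 1) ↔ v = w := by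
  rw [prefixIndex_eq_iff]
  exact ⟨fun h => pad_injective fun j hj => h j (by omega), fun h => by simp [h]⟩

/-- The measure-preserving involution that exchanges the two halves of the interval `I`. -/
def flipSeq (I : DyadicInterval) (x : ℕ → Bool) : ℕ → Bool :=
  if prefixIndex x I.1 = I.2 then Function.update x I.1 (!x I.1) else x

lemma flipSeq_of_ne (I : DyadicInterval) (x : ℕ → Bool) {j : ℕ} (hj : j ≠ I.1) :
    flipSeq I x j = x j := by
  rw [flipSeq]
  split_ifs
  · exact Function.update_of_ne hj _ _
  · rfl

lemma prefixIndex_flipSeq {I : DyadicInterval} (x : ℕ → Bool) {k : ℕ} (hk : k ≤ I.1) :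
    prefixIndex (flipSeq I x) k = prefixIndex x k :=
  prefixIndex_eq_iff.2 fun _ hj => flipSeq_of_ne I x (by omega)

lemma flipSeq_flipSeq (I : DyadicInterval) (x : ℕ → Bool) : flipSeq I (flipSeq I x) = x := by
  have h := prefixIndex_flipSeq (I := I) x le_rfl
  by_cases hx : prefixIndex x I.1 = I.2
  · rw [flipSeq, if_pos (h.trans hx)]
    funext j
    by_cases hj : j = I.1
    · subst hj; simp [flipSeq, hx]
    · rw [Function.update_of_ne hj, flipSeq_of_ne _ _ hj]
  · rw [flipSeq, if_neg (by rwa [h]), flipSeq, if_neg hx]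

lemma seqHaar_flipSeq_self (I : DyadicInterval) (x : ℕ → Bool) :
    seqHaar I (flipSeq I x) = -seqHaar I x := by
  rw [seqHaar, prefixIndex_flipSeq x le_rfl, seqHaar]
  split_ifs with h
  · rw [flipSeq, if_pos h, Function.update_self, sgn_not]
  · simp

lemma level_le_of_iota_le {I K : DyadicInterval} (h : K.iota ≤ I.iota) : K.1 ≤ I.1 := by
  by_contra hlt
  push Not at hlt
  have h1 : 2 ^ (I.1 + 1) ≤ 2 ^ K.1 := Nat.pow_le_pow_right (by norm_num) hlt
  have h2 := I.2.2
  simp only [iota] at h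
  rw [pow_succ] at h1
  omega

lemma seqHaar_flipSeq_of_iota_lt {I K : DyadicInterval} (h : K.iota < I.iota) (x : ℕ → Bool) :
    seqHaar K (flipSeq I x) = seqHaar K x := by
  have hle := level_le_of_iota_le h.le
  rw [seqHaar, prefixIndex_flipSeq x hle, seqHaar]
  split_ifs with hK
  · rcases hle.lt_or_eq with hlt | heq
    · rw [flipSeq_of_ne _ _ hlt.ne]
    · rw [flipSeq, if_neg]
      intro hI
      have hne : K ≠ I := fun hKI => by subst hKI; exact lt_irrefl _ h
      apply hne
      rw [eq_prefixInterval hK, eq_prefixInterval hI, heq]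
  · rfl

/-- The exchange of the two halves of `I`, as a permutation of the finite digit sequences. -/
def flipBlock (n : ℕ) (I : DyadicInterval) : Equiv.Perm (Block n) :=
  Function.Involutive.toPerm (fun v j => flipSeq I (pad v) j) <| by
    intro v
    have : ∀ j ≤ n, pad (fun j : Fin (n + 1) => flipSeq I (pad v) j) j = flipSeq I (pad v) j :=
      fun j hj => by simp [pad, show j < n + 1 by omega]
    by_cases hI : I.1 ≤ n
    · have h2 : pad (fun j : Fin (n + 1) => flipSeq I (pad v) j) = flipSeq I (pad v) := by
        funext j
        by_cases hj : j ≤ n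
        · exact this j hj
        · rw [flipSeq_of_ne _ _ (by omega), pad, dif_neg (by omega), pad, dif_neg (by omega)]
      funext ⟨j, hj⟩
      simp only [h2, flipSeq_flipSeq]
      simp [pad, hj]
    · have h2 : (fun j : Fin (n + 1) => flipSeq I (pad v) j) = v := by
        funext ⟨j, hj⟩
        simp only
        rw [flipSeq_of_ne _ _ (by omega), pad, dif_pos hj]
      change (fun j : Fin (n + 1) => flipSeq I (pad (fun i : Fin (n + 1) => flipSeq I (pad v) i)) j) = v
      rw [h2, h2]

lemma pad_flipBlock {n : ℕ} {I : DyadicInterval} (hI : I.1 ≤ n) (v : Block n) :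
    pad (flipBlock n I v) = flipSeq I (pad v) := by
  funext j
  by_cases hj : j < n + 1
  · rw [pad, dif_pos hj]
    rfl
  · rw [flipSeq_of_ne _ _ (by omega), pad, dif_neg hj, pad, dif_neg hj]

lemma sum_seqHaar_pad {n : ℕ} {I : DyadicInterval} (hI : I.1 ≤ n) :
    ∑ v : Block n, seqHaar I (pad v) = 0 := by
  have h := Equiv.sum_comp (flipBlock n I) fun v => seqHaar I (pad v)
  simp only [pad_flipBlock hI, seqHaar_flipSeq_self, Finset.sum_neg_distrib] at h
  linarith

lemma sum_seqHaar_mul_seqHaar_pad {n : ℕ} {I K : DyadicInterval} (hI : I.1 ≤ n) (hK : K.1 ≤ n)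
    (hne : I ≠ K) : ∑ v : Block n, seqHaar I (pad v) * seqHaar K (pad v) = 0 := by
  rcases lt_or_gt_of_ne (fun h => hne (iota_injective h)) with hlt | hlt
  · have h := Equiv.sum_comp (flipBlock n K) fun v => seqHaar I (pad v) * seqHaar K (pad v)
    simp only [pad_flipBlock hK, seqHaar_flipSeq_self, seqHaar_flipSeq_of_iota_lt hlt, mul_neg,
      Finset.sum_neg_distrib] at h
    linarith
  · have h := Equiv.sum_comp (flipBlock n I) fun v => seqHaar I (pad v) * seqHaar K (pad v)
    simp only [pad_flipBlock hI, seqHaar_flipSeq_self, seqHaar_flipSeq_of_iota_lt hlt, neg_mul,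
      Finset.sum_neg_distrib] at h
    linarith

/-- The finite collection of all dyadic intervals of level less than `n`. -/
def intervalsBelow (n : ℕ) : Finset DyadicInterval :=
  (Finset.range n).sigma fun _ => Finset.univ

lemma mem_intervalsBelow {n : ℕ} {I : DyadicInterval} : I ∈ intervalsBelow n ↔ I.1 < n := by
  simp [intervalsBelow]

lemma haar_kernel_intervalsBelow (x y : ℕ → Bool) (n : ℕ) :
    1 + ∑ I ∈ intervalsBelow n, 2 ^ I.1 * seqHaar I x * seqHaar I y
      = if prefixIndex x n = prefixIndex y n then (2 : ℝ) ^ n else 0 := by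
  rw [← haar_kernel, intervalsBelow, Finset.sum_sigma]
  congr 1
  refine Finset.sum_congr rfl fun k _ => ?_
  rw [sum_ofLevel, Finset.mul_sum]
  exact Finset.sum_congr rfl fun i _ => by ring

lemma card_block (n : ℕ) : (Fintype.card (Block n) : ℝ) = 2 ^ (n + 1) := by
  simp [Block]

/-- The square of the `L²` norm of a Haar function, read off from the reproducing kernel and the
orthogonality of the Haar system. -/
lemma sum_seqHaar_sq_pad {n : ℕ} {I : DyadicInterval} (hI : I.1 ≤ n) :
    ∑ v : Block n, seqHaar I (pad v) * seqHaar I (pad v) = 2 ^ (n + 1) * I.length := by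
  classical
  -- a point at which `h_I` does not vanish
  obtain ⟨w, hw⟩ : ∃ w : Block n, seqHaar I (pad w) ≠ 0 := by
    let s : ℝ := (I.2 : ℕ) / 2 ^ I.1
    have hsI : s ∈ I.toSet := by
      refine ⟨le_rfl, ?_⟩
      exact (div_lt_div_iff_of_pos_right (by positivity)).2 (by linarith)
    have hs := toSet_subset_unit I hsI
    refine ⟨fun j => bits s j, ?_⟩
    rw [seqHaar_congr (y := bits s), seqHaar_ne_zero_iff, ← mem_toSet_iff_prefixIndex hs]
    · exact hsI
    · intro j hj
      simp [pad, show j < n + 1 by omega]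
  have h1 : ∑ v : Block n, seqHaar I (pad v) *
      (if prefixIndex (pad w) (n + 1) = prefixIndex (pad v) (n + 1) then (2 : ℝ) ^ (n + 1) else 0)
      = seqHaar I (pad w) * 2 ^ (n + 1) := by
    simp only [prefixIndex_pad_eq_iff]
    simp
  simp only [← haar_kernel_intervalsBelow, mul_add, mul_one, Finset.sum_add_distrib, Finset.mul_sum,
    sum_seqHaar_pad hI, zero_add] at h1
  rw [Finset.sum_comm, Finset.sum_eq_single I] at h1
  · have h2 : 2 ^ I.1 * ∑ v : Block n, seqHaar I (pad v) * seqHaar I (pad v) = 2 ^ (n + 1) := by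
      apply mul_left_cancel₀ hw
      rw [← h1, Finset.mul_sum, Finset.mul_sum]
      exact Finset.sum_congr rfl fun v _ => by ring
    rw [length, ← h2]
    field_simp
  · intro K hK hne
    have hK' : K.1 ≤ n := by have := mem_intervalsBelow.1 hK; omega
    have := sum_seqHaar_mul_seqHaar_pad hI hK' hne.symm
    calc _ = (2 ^ K.1 * seqHaar K (pad w)) *
          ∑ v : Block n, seqHaar I (pad v) * seqHaar K (pad v) := by
          rw [Finset.mul_sum]; exact Finset.sum_congr rfl fun v _ => by ring
      _ = 0 := by rw [this, mul_zero]
  · intro h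
    exact absurd (mem_intervalsBelow.2 (by omega)) h


/-! ### The joint law of the blocks of Rademacher functions -/

/-- Lebesgue measure on `[0, 1)`. -/
def unitMeasure : Measure ℝ := volume.restrict (Ico (0 : ℝ) 1)

instance : IsProbabilityMeasure unitMeasure := ⟨by simp [unitMeasure]⟩

/-- The law of a fair coin. -/
def coin : Measure Bool := (2 : ℝ≥0∞)⁻¹ • Measure.count

lemma coin_singleton (b : Bool) : coin {b} = 2⁻¹ := by simp [coin]

instance : IsProbabilityMeasure coin := ⟨by
  have : (Measure.count : Measure Bool) univ = 2 := by
    rw [Measure.count_univ, ENat.card_eq_coe_fintype_card]; simp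
  rw [coin, Measure.smul_apply, this, smul_eq_mul]
  exact ENNReal.inv_mul_cancel (by simp) (by simp)⟩

lemma ae_mem_unit : ∀ᵐ s ∂unitMeasure, s ∈ Ico (0 : ℝ) 1 :=
  ae_restrict_mem measurableSet_Ico

lemma measurable_bits (k : ℕ) : Measurable fun s => bits s k := by
  have h : Measurable fun s : ℝ => ⌊s * 2 ^ (k + 1)⌋ := (measurable_id.mul_const _).floor
  exact (Measurable.of_discrete (f := fun z : ℤ => decide (z % 2 = 1))).comp h

lemma unitMeasure_bits_eq (x : ℕ → Bool) (L : ℕ) :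
    unitMeasure {s | ∀ j < L, bits s j = x j} = 2⁻¹ ^ L := by
  have h : {s | ∀ j < L, bits s j = x j} ∩ Ico (0 : ℝ) 1 = (prefixInterval x L).toSet := by
    ext s
    constructor
    · rintro ⟨h1, hs⟩
      exact (mem_toSet_iff_prefixIndex hs _).2 (prefixIndex_eq_iff.2 h1)
    · intro hs
      have hs' := toSet_subset_unit _ hs
      exact ⟨prefixIndex_eq_iff.1 ((mem_toSet_iff_prefixIndex hs' _).1 hs), hs'⟩
  rw [unitMeasure, Measure.restrict_apply' measurableSet_Ico, h, toSet, Real.volume_Ico]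
  have : (((prefixInterval x L).2 : ℕ) + 1 : ℝ) / 2 ^ (prefixInterval x L).1 -
      ((prefixInterval x L).2 : ℕ) / 2 ^ (prefixInterval x L).1 = (2⁻¹) ^ L := by
    rw [← sub_div, add_sub_cancel_left, one_div, inv_pow]
    rfl
  rw [this, ENNReal.ofReal_pow (by norm_num), ENNReal.ofReal_inv_of_pos (by norm_num)]
  simp

/-- The binary digits of a uniformly distributed number are independent fair coin tosses. -/
lemma map_bits : unitMeasure.map bits = Measure.infinitePi fun _ : ℕ => coin := by
  have hmeas : Measurable bits := measurable_pi_lambda _ measurable_bits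
  have hmeasL : ∀ L : ℕ, Measurable fun s (j : Fin L) => bits s j := fun L =>
    measurable_pi_lambda _ fun j => measurable_bits j
  have hfin : ∀ L : ℕ, unitMeasure.map (fun s (j : Fin L) => bits s j)
      = Measure.infinitePi fun _ : Fin L => coin := by
    intro L
    refine Measure.ext_of_singleton fun v => ?_
    rw [Measure.infinitePi_singleton_of_fintype, Measure.map_apply (hmeasL L)
      (measurableSet_singleton v)]
    have := unitMeasure_bits_eq (fun j => if h : j < L then v ⟨j, h⟩ else false) L
    simp only [coin_singleton, Finset.prod_const, Finset.card_univ, Fintype.card_fin]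
    rw [← this]
    congr 1
    ext s
    simp only [mem_preimage, mem_singleton_iff, mem_ofPred_eq, funext_iff]
    constructor
    · intro h j hj
      simpa [hj] using h ⟨j, hj⟩
    · rintro h ⟨j, hj⟩
      simpa [hj] using h j hj
  refine Measure.eq_infinitePi _ fun s t ht => ?_
  obtain ⟨L, hL⟩ : ∃ L, ∀ j ∈ s, j < L :=
    ⟨s.sup id + 1, fun j hj => Nat.lt_succ_of_le (Finset.le_sup (f := id) hj)⟩
  let s' : Finset (Fin L) := Finset.univ.filter fun j => (j : ℕ) ∈ s
  have hset : bits ⁻¹' (Set.pi s t)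
      = (fun s (j : Fin L) => bits s j) ⁻¹' (Set.pi s' fun j => t j) := by
    ext x
    simp only [mem_preimage, Set.mem_pi, Finset.mem_coe, s', Finset.mem_filter, Finset.mem_univ,
      true_and]
    exact ⟨fun h j hj => h j hj, fun h j hj => h ⟨j, hL j hj⟩ hj⟩
  rw [Measure.map_apply hmeas (.pi s.countable_toSet fun j _ => ht j), hset,
    ← Measure.map_apply (hmeasL L)
      (.pi s'.countable_toSet fun j _ => ht j), hfin,
    Measure.infinitePi_pi (s := s') (t := fun j : Fin L => t j) (fun _ => coin) fun j _ => ht j]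
  refine Finset.prod_bij (fun j _ => (j : ℕ)) ?_ ?_ ?_ ?_
  · intro j hj; simpa [s'] using hj
  · intro j _ j' _ h; exact Fin.ext h
  · intro j hj; exact ⟨⟨j, hL j hj⟩, by simpa [s'] using hj, rfl⟩
  · intros; rfl

/-- The uniform distribution on the values of a block. -/
def blockMeasure (n : ℕ) : Measure (Block n) := Measure.infinitePi fun _ : Fin (n + 1) => coin

instance (n : ℕ) : IsProbabilityMeasure (blockMeasure n) := by
  unfold blockMeasure; infer_instance

lemma blockMeasure_singleton {n : ℕ} (v : Block n) : blockMeasure n {v} = 2⁻¹ ^ (n + 1) := by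
  simp [blockMeasure, coin_singleton]

lemma integral_blockMeasure {n : ℕ} (Φ : Block n → ℝ) :
    ∫ v, Φ v ∂blockMeasure n = (∑ v, Φ v) / 2 ^ (n + 1) := by
  rw [integral_fintype (.of_finite)]
  simp only [Measure.real, blockMeasure_singleton, smul_eq_mul, ENNReal.toReal_pow,
    ENNReal.toReal_inv, ENNReal.toReal_ofNat]
  rw [← Finset.mul_sum, inv_pow]
  field_simp

/-- A map between blocks all of whose fibres have the right cardinality preserves the uniform
distribution. -/
lemma map_blockMeasure {m n : ℕ} (D : Block m → Block n)
    (h : ∀ w, (2 : ℝ) ^ (n + 1) * (Finset.univ.filter fun v => D v = w).card = 2 ^ (m + 1)) :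
    (blockMeasure m).map D = blockMeasure n := by
  refine Measure.ext_of_singleton fun w => ?_
  rw [Measure.map_apply .of_discrete (measurableSet_singleton w), blockMeasure_singleton]
  have hset : D ⁻¹' {w} = ((Finset.univ.filter fun v => D v = w : Finset (Block m)) : Set (Block m)) := by
    ext v; simp
  rw [hset, ← sum_measure_singleton]
  simp only [blockMeasure_singleton, Finset.sum_const, nsmul_eq_mul]
  have h' : (2 : ℝ≥0∞) ^ (n + 1) * (Finset.univ.filter fun v => D v = w).card = 2 ^ (m + 1) := by
    have : 2 ^ (n + 1) * (Finset.univ.filter fun v => D v = w).card = 2 ^ (m + 1) := by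
      exact_mod_cast h w
    exact_mod_cast this
  rw [← ENNReal.inv_pow, ← ENNReal.inv_pow, ← div_eq_mul_inv, ENNReal.div_eq_inv_mul,
    ← h', ENNReal.mul_inv (by simp) (by simp), mul_comm, ← mul_assoc, mul_comm _ (_)⁻¹, ← mul_assoc,
    ENNReal.inv_mul_cancel]
  · simp
  · intro h0
    rw [h0, mul_zero] at h'
    exact (pow_ne_zero _ two_ne_zero) h'.symm
  · simp

lemma map_perm_blockMeasure {n : ℕ} (π : Equiv.Perm (Block n)) :
    (blockMeasure n).map π = blockMeasure n := by
  refine map_blockMeasure _ fun w => ?_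
  have : (Finset.univ.filter fun v => π v = w) = {π.symm w} := by
    ext v; simp [Equiv.eq_symm_apply]
  rw [this]
  simp

/-- A family of pairwise disjoint finite sets `τ n` with `n + 1` elements. -/
structure IsFrequencies (τ : ℕ → Finset ℕ) : Prop where
  card : ∀ n, (τ n).card = n + 1
  disj : ∀ m n, m ≠ n → Disjoint (τ m) (τ n)

/-- The `j`-th smallest element of `τ n`. -/
def freq (τ : ℕ → Finset ℕ) (n j : ℕ) : ℕ := Nat.nth (fun m => m ∈ τ n) j

section Frequencies

variable {τ : ℕ → Finset ℕ}

lemma IsFrequencies.toFinset_card (hτ : IsFrequencies τ) (n : ℕ)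
    (hf : (Set.ofPred fun m => m ∈ τ n).Finite) : hf.toFinset.card = n + 1 := by
  rw [← hτ.card n]
  congr 1
  ext m
  simp

lemma IsFrequencies.freq_lt_freq (hτ : IsFrequencies τ) {n i j : ℕ} (hij : i < j) (hj : j ≤ n) :
    freq τ n i < freq τ n j :=
  Nat.nth_lt_nth' hij fun hf => by rw [hτ.toFinset_card]; omega

lemma IsFrequencies.freq_mem (hτ : IsFrequencies τ) {n j : ℕ} (hj : j ≤ n) : freq τ n j ∈ τ n :=
  Nat.nth_mem (p := fun m => m ∈ τ n) j fun hf => by rw [hτ.toFinset_card]; omega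

lemma IsFrequencies.freq_inj (hτ : IsFrequencies τ) {m n i j : ℕ} (hi : i ≤ m) (hj : j ≤ n)
    (h : freq τ m i = freq τ n j) : m = n ∧ i = j := by
  have hmn : m = n := by
    by_contra hne
    exact Finset.disjoint_left.1 (hτ.disj m n hne) (hτ.freq_mem hi) (h ▸ hτ.freq_mem hj)
  subst hmn
  refine ⟨rfl, ?_⟩
  rcases lt_trichotomy i j with hlt | heq | hgt
  · exact absurd h (hτ.freq_lt_freq hlt hj).ne
  · exact heq
  · exact absurd h (hτ.freq_lt_freq hgt hi).ne'

end Frequencies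

/-- The values of the Rademacher functions with frequencies in `τ n`, as digits. -/
def blockBits (τ : ℕ → Finset ℕ) (n : ℕ) (s : ℝ) : Block n := fun j => bits s (freq τ n j)

lemma measurable_blockBits (τ : ℕ → Finset ℕ) (n : ℕ) : Measurable (blockBits τ n) :=
  measurable_pi_lambda _ fun _ => measurable_bits _

/-- The blocks are independent and uniformly distributed. -/
lemma map_blockBits {τ : ℕ → Finset ℕ} (hτ : IsFrequencies τ) :
    unitMeasure.map (fun s n => blockBits τ n s) = Measure.infinitePi blockMeasure := by
  have hinj : Function.Injective fun p : (n : ℕ) × Fin (n + 1) => freq τ p.1 p.2 := by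
    rintro ⟨m, i⟩ ⟨n, j⟩ h
    obtain ⟨rfl, hij⟩ := hτ.freq_inj (Nat.lt_succ_iff.1 i.2) (Nat.lt_succ_iff.1 j.2) h
    rw [Fin.ext hij]
  have h1 := Measure.map_infinitePi_infinitePi_of_inj (P := fun _ : ℕ => coin) hinj
  have h2 := Measure.infinitePi_map_piCurry (X := fun (n : ℕ) (_ : Fin (n + 1)) => Bool)
    fun _ _ => coin
  have hbits : Measurable bits := measurable_pi_lambda _ measurable_bits
  rw [← h1, ← map_bits, Measure.map_map (by fun_prop) hbits,
    Measure.map_map (MeasurableEquiv.measurable _) (by fun_prop)] at h2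
  exact h2

/-- Images of distinct blocks under maps that preserve the uniform distribution are again
independent and uniformly distributed. -/
lemma map_comp_blockBits {τ : ℕ → Finset ℕ} (hτ : IsFrequencies τ) {N : ℕ → ℕ}
    (hN : Function.Injective N) (D : ∀ n, Block (N n) → Block n)
    (hD : ∀ n, (blockMeasure (N n)).map (D n) = blockMeasure n) :
    unitMeasure.map (fun s n => D n (blockBits τ (N n) s)) = Measure.infinitePi blockMeasure := by
  have h1 := Measure.map_infinitePi_infinitePi_of_inj (P := blockMeasure) hN
  have h2 := Measure.infinitePi_map_pi (fun n => blockMeasure (N n)) (f := D)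
    fun n => .of_discrete
  have hb : Measurable fun s n => blockBits τ n s :=
    measurable_pi_lambda _ fun n => measurable_blockBits τ n
  have hD' : Measurable fun (x : ∀ n, Block (N n)) n => D n (x n) :=
    measurable_pi_lambda _ fun n => Measurable.of_discrete.comp (measurable_pi_apply n)
  have hr : Measurable fun (ω : ∀ n, Block n) n => ω (N n) :=
    measurable_pi_lambda _ fun n => measurable_pi_apply (N n)
  simp only [hD] at h2
  rw [← h1, ← map_blockBits hτ, Measure.map_map hr hb, Measure.map_map hD'
    (hr.comp hb)] at h2
  exact h2.trans (map_blockBits hτ)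

/-! ### Functions of a block -/

lemma H_ext {f g : H} (h : ∀ s ∈ Ico (0 : ℝ) 1, (f : ℝ → ℝ) s = (g : ℝ → ℝ) s) : f = g := by
  refine Subtype.ext (funext fun s => ?_)
  by_cases hs : s ∈ Ico (0 : ℝ) 1
  · exact h s hs
  · rw [eq_zero_of_mem_H f.2 hs, eq_zero_of_mem_H g.2 hs]

lemma H_measurable (f : H) : Measurable (f : ℝ → ℝ) := by
  obtain ⟨f, hf⟩ := f
  induction hf using Submodule.span_induction with
  | mem f hf =>
    obtain ⟨J, rfl⟩ := hf
    cases J with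
    | none => exact measurable_one.indicator measurableSet_Ico
    | some J => exact haar_measurable J
  | zero => exact measurable_zero
  | add f g _ _ hf hg => exact hf.add hg
  | smul c f _ hf => exact hf.const_smul c

/-- The function `s ↦ Φ(t_n(s))` on `[0, 1)`, where `t_n(s)` lists the digits of `s` in the
`n`-th block. -/
def pull (τ : ℕ → Finset ℕ) (n : ℕ) : (Block n → ℝ) →ₗ[ℝ] H where
  toFun Φ := ⟨indicator (Ico 0 1) fun s => Φ (blockBits τ n s), by
    refine mem_H_of_step (N := (Finset.univ.sup fun j : Fin (n + 1) => freq τ n j) + 1) ?_ ?_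
    · intro x y h
      have hb : blockBits τ n x = blockBits τ n y := by
        funext j
        have hj : freq τ n j ≤ Finset.univ.sup fun j : Fin (n + 1) => freq τ n j :=
          Finset.le_sup (f := fun j : Fin (n + 1) => freq τ n j) (Finset.mem_univ j)
        simp only [blockBits, bits, floor_level (Nat.succ_le_succ hj), h]
      have h0 : ⌊x * 2 ^ 0⌋ = ⌊y * 2 ^ 0⌋ := by
        rw [floor_level (Nat.zero_le _) x, floor_level (Nat.zero_le _) y, h]
      simp only [indicator, mem_unit_iff, h0, hb]
    · intro x hx
      exact indicator_of_notMem hx _⟩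
  map_add' Φ Ψ := by
    refine Subtype.ext ?_
    exact indicator_add _ _ _
  map_smul' c Φ := by
    refine Subtype.ext ?_
    exact indicator_const_smul _ c _

lemma pull_apply (τ : ℕ → Finset ℕ) {n : ℕ} (Φ : Block n → ℝ) {s : ℝ} (hs : s ∈ Ico (0 : ℝ) 1) :
    (pull τ n Φ : ℝ → ℝ) s = Φ (blockBits τ n s) :=
  indicator_of_mem hs fun s => Φ (blockBits τ n s)

/-- Only one Haar function of a given level does not vanish at `s`. -/
lemma sum_haar_of_level {C : Finset DyadicInterval} {k : ℕ} (hC : ∀ K ∈ C, K.1 = k) {s : ℝ}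
    (hs : s ∈ Ico (0 : ℝ) 1) [Decidable (prefixInterval (bits s) k ∈ C)] :
    ∑ K ∈ C, haar K s = if prefixInterval (bits s) k ∈ C then sgn (bits s k) else 0 := by
  classical
  have h := sum_ofLevel_mul_seqHaar k (bits s) fun K => if K ∈ C then 1 else 0
  have hsub : C = (ofLevel k).filter fun K => K ∈ C := by
    ext K
    simp only [Finset.mem_filter, mem_ofLevel]
    exact ⟨fun h => ⟨hC K h, h⟩, fun h => h.2⟩
  calc ∑ K ∈ C, haar K s = ∑ K ∈ (ofLevel k).filter (fun K => K ∈ C), haar K s := by rw [← hsub]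
    _ = _ := by
      rw [Finset.sum_filter]
      simp only [haar_eq_seqHaar hs]
      simp only [ite_mul, one_mul, zero_mul] at h
      convert h

lemma level_of_mem_rademacherCollection {k : ℕ → ℕ} {j i : ℕ} {K : DyadicInterval}
    (hK : K ∈ rademacherCollection k j i) : K.1 = k j := by
  classical
  cases j with
  | zero => exact mem_ofLevel.1 hK
  | succ j =>
    rw [rademacherCollection] at hK
    exact mem_ofLevel.1 (Finset.mem_filter.1 hK).1

/-- The functions `h_I^n` arise from the Haar functions by selecting the digits of the block. -/
lemma sum_rademacherCollection {k : ℕ → ℕ} {n : ℕ} (hk : ∀ i j, i < j → j ≤ n → k i < k j)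
    (I : DyadicInterval) (hI : I.1 ≤ n) {s : ℝ} (hs : s ∈ Ico (0 : ℝ) 1) :
    ∑ K ∈ rademacherCollection k I.1 I.2, haar K s = seqHaar I fun l => bits s (k l) := by
  classical
  obtain ⟨j, i, hi⟩ := I
  simp only at hI ⊢
  induction j generalizing i s with
  | zero =>
    have h0 : i = 0 := by simpa using hi
    subst h0
    simp only [rademacherCollection]
    rw [sum_haar_of_level (fun K hK => mem_ofLevel.1 hK) hs,
      if_pos (show prefixInterval (bits s) (k 0) ∈ ofLevel (k 0) from mem_ofLevel.2 rfl)]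
    simp [seqHaar, prefixIndex]
  | succ j ih =>
    have hi2 : i / 2 < 2 ^ j := by rw [pow_succ] at hi; omega
    rw [sum_haar_of_level (fun K hK => level_of_mem_rademacherCollection hK) hs]
    have hmem : prefixInterval (bits s) (k (j + 1)) ∈ rademacherCollection k (j + 1) i ↔
        prefixIndex (fun l => bits s (k l)) (j + 1) = i := by
      rw [rademacherCollection]
      simp only [Finset.mem_filter, mem_ofLevel]
      -- membership of a point in the prescribed set, in terms of its digits
      have hset : ∀ t ∈ Ico (0 : ℝ) 1,
          (∑ L ∈ rademacherCollection k j (i / 2), haar L t = if i % 2 = 0 then 1 else -1) ↔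
            prefixIndex (fun l => bits t (k l)) (j + 1) = i := by
        intro t ht
        rw [ih ht (i / 2) hi2 (by omega)]
        rcases Nat.mod_two_eq_zero_or_one i with h2 | h2
        · rw [if_pos h2, ← prefixIndex_left_iff]
          simp only [left]
          rw [show 2 * (i / 2) = i by omega]
        · rw [if_neg (by omega), ← prefixIndex_right_iff]
          simp only [right]
          rw [show 2 * (i / 2) + 1 = i by omega]
      constructor
      · rintro ⟨-, h⟩
        exact (hset s hs).1 (h ((mem_toSet_iff_prefixIndex hs _).2 rfl))
      · intro h
        refine ⟨rfl, fun t ht => ?_⟩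
        have ht1 := toSet_subset_unit _ ht
        refine (hset t ht1).2 ?_
        rw [← h]
        refine prefixIndex_eq_iff.2 fun l hl => ?_
        exact prefixIndex_eq_iff.1 ((mem_toSet_iff_prefixIndex ht1 _).1 ht) _ (hk l (j + 1) hl hI)
    simp only [hmem, seqHaar]

lemma H_sum_apply {ι : Type*} (S : Finset ι) (f : ι → H) (s : ℝ) :
    ((∑ i ∈ S, f i : H) : ℝ → ℝ) s = ∑ i ∈ S, (f i : ℝ → ℝ) s := by
  simp [Finset.sum_apply]

/-- The function on the values of the block `n` that corresponds to `h_I^n`. -/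
def blockHaar (n : ℕ) (I : DyadicInterval) : Block n → ℝ := fun v => seqHaar I (pad v)

section Frequencies

variable {τ : ℕ → Finset ℕ}

lemma hOmega_apply (hτ : IsFrequencies τ) {n : ℕ} {I : DyadicInterval} (hI : I.1 ≤ n) {s : ℝ}
    (hs : s ∈ Ico (0 : ℝ) 1) :
    (hOmega τ n I : ℝ → ℝ) s = seqHaar I (fun l => bits s (freq τ n l)) := by
  rw [hOmega, H_sum_apply]
  simp only [haarBasis_apply]
  exact sum_rademacherCollection (fun i j hij hj => hτ.freq_lt_freq hij hj) I hI hs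

lemma hOmega_eq_pull (hτ : IsFrequencies τ) {n : ℕ} {I : DyadicInterval} (hI : I.1 ≤ n) :
    hOmega τ n I = pull τ n (blockHaar n I) := by
  refine H_ext fun s hs => ?_
  rw [hOmega_apply hτ hI hs, pull_apply τ _ hs]
  refine seqHaar_congr fun j hj => ?_
  rw [pad, dif_pos (by omega)]
  rfl

/-- On an interval of the collection that defines `h_I^n` this function does not vanish. -/
lemma hOmega_ne_zero_of_mem (hτ : IsFrequencies τ) {n : ℕ} {I : DyadicInterval} (hI : I.1 ≤ n)
    {K : DyadicInterval} (hK : K ∈ rademacherCollection (freq τ n) I.1 I.2) {s : ℝ}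
    (hs : s ∈ K.toSet) : (hOmega τ n I : ℝ → ℝ) s ≠ 0 := by
  classical
  have hs' := toSet_subset_unit _ hs
  have h := sum_haar_of_level (C := rademacherCollection (freq τ n) I.1 I.2)
    (fun K hK => level_of_mem_rademacherCollection hK) hs'
  rw [sum_rademacherCollection (fun i j hij hj => hτ.freq_lt_freq hij hj) I hI hs',
    ← hOmega_apply hτ hI hs', if_pos] at h
  · rw [h]; exact sgn_ne_zero _
  · have hK2 := eq_prefixInterval ((mem_toSet_iff_prefixIndex hs' _).1 hs)
    rw [level_of_mem_rademacherCollection hK] at hK2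
    rwa [← hK2]

end Frequencies

/-! ### Joint laws and the pairing -/

/-- The joint law of a family of elements of `H`, with respect to Lebesgue measure on `[0, 1)`. -/
def jointLaw {ι : Type*} (f : ι → H) : Measure (ι → ℝ) :=
  unitMeasure.map fun s i => (f i : ℝ → ℝ) s

lemma measurable_family {ι : Type*} (f : ι → H) : Measurable fun s i => (f i : ℝ → ℝ) s :=
  measurable_pi_lambda _ fun i => H_measurable (f i)

lemma jointLaw_pull_comp {τ : ℕ → Finset ℕ} (hτ : IsFrequencies τ) {N : ℕ → ℕ}
    (hN : Function.Injective N) (D : ∀ n, Block (N n) → Block n)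
    (hD : ∀ n, (blockMeasure (N n)).map (D n) = blockMeasure n) {ι : Type*} (n : ι → ℕ)
    (Φ : ∀ i, Block (n i) → ℝ) :
    jointLaw (fun i => pull τ (N (n i)) (Φ i ∘ D (n i))) = jointLaw fun i => pull τ (n i) (Φ i) := by
  have hΦ : Measurable fun (w : ∀ n, Block n) i => Φ i (w (n i)) :=
    measurable_pi_lambda _ fun i => Measurable.of_discrete.comp (measurable_pi_apply (n i))
  have h1 : jointLaw (fun i => pull τ (N (n i)) (Φ i ∘ D (n i)))
      = (unitMeasure.map fun s n => D n (blockBits τ (N n) s)).map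
        fun (w : ∀ n, Block n) i => Φ i (w (n i)) := by
    have hT : Measurable fun s n => D n (blockBits τ (N n) s) := measurable_pi_lambda _ fun n =>
      (Measurable.of_discrete (f := D n)).comp (measurable_blockBits τ (N n))
    rw [Measure.map_map hΦ hT]
    refine Measure.map_congr (ae_mem_unit.mono fun s hs => funext fun i => ?_)
    exact pull_apply τ _ hs
  have h2 : jointLaw (fun i => pull τ (n i) (Φ i))
      = (unitMeasure.map fun s n => blockBits τ n s).map
        fun (w : ∀ n, Block n) i => Φ i (w (n i)) := by
    rw [Measure.map_map hΦ (measurable_pi_lambda _ fun n => measurable_blockBits τ n)]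
    refine Measure.map_congr (ae_mem_unit.mono fun s hs => funext fun i => ?_)
    exact pull_apply τ _ hs
  rw [h1, h2, map_comp_blockBits hτ hN D hD, map_blockBits hτ]

lemma integrable_mul (f g : H) :
    Integrable (fun s => (f : ℝ → ℝ) s * (g : ℝ → ℝ) s) unitMeasure := by
  have hb : ∀ f : H, ∃ C, ∀ s, ‖(f : ℝ → ℝ) s‖ ≤ C := by
    rintro ⟨f, hf⟩
    induction hf using Submodule.span_induction with
    | mem f hf =>
      obtain ⟨J, rfl⟩ := hf
      refine ⟨1, fun s => ?_⟩
      cases J with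
      | none => simp only [haarPlus, indicator]; split_ifs <;> simp
      | some J => exact haar_abs_le J s
    | zero => exact ⟨0, by simp⟩
    | add f g _ _ hf hg =>
      obtain ⟨C, hC⟩ := hf
      obtain ⟨C', hC'⟩ := hg
      exact ⟨C + C', fun s => (norm_add_le _ _).trans (add_le_add (hC s) (hC' s))⟩
    | smul c f _ hf =>
      obtain ⟨C, hC⟩ := hf
      refine ⟨‖c‖ * C, fun s => ?_⟩
      simp only [Pi.smul_apply, norm_smul]
      exact mul_le_mul_of_nonneg_left (hC s) (norm_nonneg c)
  obtain ⟨C, hC⟩ := hb f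
  obtain ⟨C', hC'⟩ := hb g
  refine Integrable.of_bound ((H_measurable f).mul (H_measurable g)).aestronglyMeasurable (C * C')
    (Eventually.of_forall fun s => ?_)
  rw [norm_mul]
  exact mul_le_mul (hC s) (hC' s) (norm_nonneg _) ((norm_nonneg _).trans (hC s))

lemma pairing_eq (f g : H) : pairing f g = ∫ s, (f : ℝ → ℝ) s * (g : ℝ → ℝ) s ∂unitMeasure := rfl

lemma pairing_comm (f g : H) : pairing f g = pairing g f := by
  simp only [pairing_eq, mul_comm]

/-- The pairing as a linear map in the second argument. -/
def pairingLin (f : H) : H →ₗ[ℝ] ℝ where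
  toFun := pairing f
  map_add' g h := by
    simp only [pairing_eq, ← integral_add (integrable_mul f g) (integrable_mul f h), ← mul_add]
    rfl
  map_smul' c g := by
    simp only [pairing_eq, RingHom.id_apply, smul_eq_mul, ← integral_const_mul]
    congr 1
    funext s
    simp only [Submodule.coe_smul, Pi.smul_apply, smul_eq_mul]
    ring

lemma pairingLin_apply (f g : H) : pairingLin f g = pairing f g := rfl

lemma pairing_eq_of_jointLaw_eq {ι : Type*} {f g : ι → H} (h : jointLaw f = jointLaw g) (i j : ι) :
    pairing (f i) (f j) = pairing (g i) (g j) := by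
  have key : ∀ f : ι → H, pairing (f i) (f j) = ∫ x, x i * x j ∂jointLaw f := by
    intro f
    have hm : Measurable fun x : ι → ℝ => x i * x j :=
      (measurable_pi_apply i).mul (measurable_pi_apply j)
    rw [jointLaw, integral_map (measurable_family f).aemeasurable hm.aestronglyMeasurable]
    rfl
  rw [key, key, h]

lemma pairing_pull {τ : ℕ → Finset ℕ} (hτ : IsFrequencies τ) {n : ℕ} (Φ Ψ : Block n → ℝ) :
    pairing (pull τ n Φ) (pull τ n Ψ) = (∑ v, Φ v * Ψ v) / 2 ^ (n + 1) := by
  have hlaw : unitMeasure.map (blockBits τ n) = blockMeasure n := by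
    rw [← Measure.infinitePi_map_eval blockMeasure n, ← map_blockBits hτ,
      Measure.map_map (measurable_pi_apply n)
        (measurable_pi_lambda _ fun n => measurable_blockBits τ n)]
    rfl
  rw [← integral_blockMeasure, ← hlaw,
    integral_map (measurable_blockBits τ n).aemeasurable .of_discrete, pairing_eq]
  refine integral_congr_ae (ae_mem_unit.mono fun s hs => ?_)
  simp only [pull_apply τ _ hs]

/-- Exchanging the halves of the interval of the last index changes the sign of the last function
and nothing else. -/
lemma jointLaw_flip {τ : ℕ → Finset ℕ} (hτ : IsFrequencies τ) {ι : Type*} (e : ι → DyadicOmega)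
    (p : DyadicOmega) (he : ∀ i, e i ≤ p) (a : ι → ℝ) [DecidableEq DyadicOmega] :
    jointLaw (fun i => (if e i = p then -a i else a i) • hOmega τ (e i).n (e i).I)
      = jointLaw fun i => a i • hOmega τ (e i).n (e i).I := by
  let D : ∀ n, Block n → Block n := fun n => if n = p.n then flipBlock n p.I else id
  have hD : ∀ n, (blockMeasure n).map (D n) = blockMeasure n := by
    intro n
    by_cases h : n = p.n
    · simp only [D, if_pos h]; exact map_perm_blockMeasure _
    · simp only [D, if_neg h]; exact Measure.map_id
  have h := jointLaw_pull_comp hτ (N := id) Function.injective_id D hD (fun i => (e i).n)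
    fun i => a i • blockHaar (e i).n (e i).I
  have h2 : ∀ i, hOmega τ (e i).n (e i).I = pull τ (e i).n (blockHaar (e i).n (e i).I) :=
    fun i => hOmega_eq_pull hτ (e i).le
  simp only [h2, ← map_smul]
  rw [← h]
  congr 1
  funext i
  simp only [id]
  congr 1
  funext v
  simp only [Pi.smul_apply, Function.comp_apply, smul_eq_mul, blockHaar, D]
  by_cases hp : e i = p
  · have hn : (e i).n = p.n := by rw [hp]
    have hI : (e i).I = p.I := by rw [hp]
    have hle : p.I.1 ≤ (e i).n := by rw [hn]; exact p.le
    rw [if_pos hp, if_pos hn, pad_flipBlock hle, hI, seqHaar_flipSeq_self]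
    ring
  · rw [if_neg hp]
    rcases (DyadicOmega.lt_iff _ _).1 (lt_of_le_of_ne (he i) hp) with hn | ⟨hn, hI⟩
    · rw [if_neg hn.ne]
      rfl
    · have hle : p.I.1 ≤ (e i).n := by rw [hn]; exact p.le
      rw [if_pos hn, pad_flipBlock hle, seqHaar_flipSeq_of_iota_lt hI]

lemma pairing_smul_smul (a b : ℝ) (f g : H) : pairing (a • f) (b • g) = a * b * pairing f g := by
  rw [← pairingLin_apply, map_smul, pairingLin_apply, pairing_comm, ← pairingLin_apply, map_smul,
    pairingLin_apply, pairing_comm, smul_eq_mul, smul_eq_mul]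
  ring

lemma pairing_hOmega_of_ne {τ : ℕ → Finset ℕ} (hτ : IsFrequencies τ) {p q : DyadicOmega}
    (hpq : p ≠ q) : pairing (hOmega τ p.n p.I) (hOmega τ q.n q.I) = 0 := by
  classical
  wlog hlt : p < q generalizing p q
  · rw [pairing_comm]
    exact this hpq.symm (lt_of_le_of_ne (not_lt.1 hlt) hpq.symm)
  have h := pairing_eq_of_jointLaw_eq (jointLaw_flip hτ (fun b : Bool => if b then p else q) q
    (by intro b; cases b <;> simp [hlt.le]) fun _ => 1) true false
  simp only [if_true, Bool.false_eq_true, if_false, hpq, pairing_smul_smul] at h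
  linarith

lemma pairing_hOmega_self {τ : ℕ → Finset ℕ} (hτ : IsFrequencies τ) (p : DyadicOmega) :
    pairing (hOmega τ p.n p.I) (hOmega τ p.n p.I) = p.I.length := by
  rw [hOmega_eq_pull hτ p.le, pairing_pull hτ]
  simp only [blockHaar]
  rw [sum_seqHaar_sq_pad p.le]
  field_simp

lemma length_pos (I : DyadicInterval) : 0 < I.length := by unfold length; positivity

/-! ### The norm of a sum over disjoint blocks of Haar functions -/

/-- A family of non-empty, mutually disjoint finite collections of dyadic intervals, each of which
consists of pairwise disjoint intervals. -/
structure IsBlockFamily {ι : Type*} (C : ι → Finset DyadicInterval) : Prop where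
  nonempty : ∀ i, (C i).Nonempty
  disj : ∀ i j, i ≠ j → Disjoint (C i) (C j)
  sep : ∀ i, ∀ K ∈ C i, ∀ L ∈ C i, K ≠ L → Disjoint K.toSet L.toSet

/-- The span of the Haar functions of a finite collection of dyadic intervals. -/
def haarSpan (C : Finset DyadicInterval) : Submodule ℝ H :=
  Submodule.span ℝ ((fun K => haarBasis (some K)) '' (C : Set DyadicInterval))

lemma haarBasis_mem_haarSpan {C : Finset DyadicInterval} {K : DyadicInterval} (hK : K ∈ C) :
    haarBasis (some K) ∈ haarSpan C :=
  Submodule.subset_span ⟨K, hK, rfl⟩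

lemma haarSpan_mono {C C' : Finset DyadicInterval} (h : C ⊆ C') : haarSpan C ≤ haarSpan C' :=
  Submodule.span_mono (image_mono (by exact_mod_cast h))

/-- The map `f ↦ ∑ r_I(u) a_I h_I(s)`, `f = ∑ a_I h_I`, as a linear functional. -/
def randomizedLin (r : rademacherFamilies) (u s : ℝ) : H →ₗ[ℝ] ℝ where
  toFun f := randomized r f u s
  map_add' f g := randomized_add r f g u s
  map_smul' c f := randomized_smul r c f u s

lemma randomizedLin_apply (r : rademacherFamilies) (u s : ℝ) (f : H) :
    randomizedLin r u s f = randomized r f u s := rfl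

lemma randomized_haarBasis (r : rademacherFamilies) (I : Option DyadicInterval) (u s : ℝ) :
    randomized r (haarBasis I) u s = r.1 I u * haarPlus I s := by
  simp [randomized]

lemma haar_eq_zero_of_notMem_toSet {K : DyadicInterval} {s : ℝ} (hs : s ∉ K.toSet) :
    haar K s = 0 := by
  by_cases h : s ∈ Ico (0 : ℝ) 1
  · rw [haar_eq_seqHaar h]
    by_contra hne
    exact hs ((mem_toSet_iff_prefixIndex h K).2 (seqHaar_ne_zero_iff.1 hne))
  · exact haar_eq_zero_of_notMem K h

/-- At each point, randomizing a combination of Haar functions of disjoint intervals amounts to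
multiplication by a single Rademacher function. -/
lemma exists_randomized_eq {C : Finset DyadicInterval} (hC : C.Nonempty)
    (hsep : ∀ K ∈ C, ∀ L ∈ C, K ≠ L → Disjoint K.toSet L.toSet) (r : rademacherFamilies) {f : H}
    (hf : f ∈ haarSpan C) (s : ℝ) :
    ∃ K ∈ C, ∀ u, randomized r f u s = r.1 (some K) u * (f : ℝ → ℝ) s := by
  obtain ⟨c, rfl⟩ := Submodule.mem_span_image_finset_iff_exists_fun' ℝ |>.1 hf
  have h1 : ∀ u, randomized r (∑ K ∈ C, c K • haarBasis (some K)) u s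
      = ∑ K ∈ C, c K * (r.1 (some K) u * haar K s) := by
    intro u
    rw [← randomizedLin_apply, map_sum]
    refine Finset.sum_congr rfl fun K _ => ?_
    rw [map_smul, randomizedLin_apply, randomized_haarBasis, smul_eq_mul]
    rfl
  have h2 : ((∑ K ∈ C, c K • haarBasis (some K) : H) : ℝ → ℝ) s = ∑ K ∈ C, c K * haar K s := by
    rw [H_sum_apply]
    refine Finset.sum_congr rfl fun K _ => ?_
    rw [Submodule.coe_smul, Pi.smul_apply, haarBasis_apply]
    rfl
  simp only [h1, h2]
  by_cases hs : ∃ K ∈ C, s ∈ K.toSet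
  · obtain ⟨K, hK, hsK⟩ := hs
    have h0 : ∀ L ∈ C, L ≠ K → haar L s = 0 := fun L hL hne =>
      haar_eq_zero_of_notMem_toSet fun hsL => Set.disjoint_left.1 (hsep L hL K hK hne) hsL hsK
    refine ⟨K, hK, fun u => ?_⟩
    rw [Finset.sum_eq_single_of_mem K hK fun L hL hne => by rw [h0 L hL hne]; ring,
      Finset.sum_eq_single_of_mem K hK fun L hL hne => by rw [h0 L hL hne]; ring]
    ring
  · push Not at hs
    have h0 : ∀ L ∈ C, haar L s = 0 := fun L hL => haar_eq_zero_of_notMem_toSet (hs L hL)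
    obtain ⟨K, hK⟩ := hC
    refine ⟨K, hK, fun u => ?_⟩
    rw [Finset.sum_eq_zero fun L hL => by rw [h0 L hL]; ring,
      Finset.sum_eq_zero fun L hL => by rw [h0 L hL]; ring, mul_zero]

lemma intervalIntegral_eq_unitMeasure (f : ℝ → ℝ) :
    ∫ u in (0 : ℝ)..1, f u = ∫ u, f u ∂unitMeasure := by
  rw [intervalIntegral.integral_of_le zero_le_one, integral_Ioc_eq_integral_Ioo,
    ← integral_Ico_eq_integral_Ioo, unitMeasure]

lemma iotaPlus_injective : Function.Injective iotaPlus := by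
  have hpos : ∀ I : DyadicInterval, 0 < I.iota := fun I => by
    have : 0 < 2 ^ I.1 := by positivity
    rw [iota]; omega
  rintro (_ | I) (_ | K) h
  · rfl
  · exact absurd h (hpos K).ne
  · exact absurd h (hpos I).ne'
  · rw [iota_injective h]

/-- The average `∑ p(w) |∑ ± x_i|` over choices of signs, with weights `p`. -/
def signAverage {ι : Type*} [Fintype ι] [DecidableEq ι] (p : (ι → Bool) → ℝ) (x : ι → ℝ) : ℝ :=
  ∑ w, p w * |∑ i, sgn (w i) * x i|

section SignAverage

variable {ι : Type*} [Fintype ι] [DecidableEq ι]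

/-- The expectation of `|∑ r_{e(i)} x_i|` does not depend on the choice of distinct indices
`e(i)`. -/
lemma exists_signAverage (r : rademacherFamilies) (ι : Type*) [Fintype ι] [DecidableEq ι] :
    ∃ p : (ι → Bool) → ℝ, (∀ w, 0 ≤ p w) ∧ ∀ e : ι → Option DyadicInterval,
      Function.Injective e → ∀ x : ι → ℝ,
        ∫ u in (0 : ℝ)..1, |∑ i, r.1 (e i) u * x i| = signAverage p x := by
  rcases r.2 with h | h
  · refine ⟨fun w => (Measure.infinitePi fun _ : ι => coin).real {w}, fun w => measureReal_nonneg,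
      fun e he x => ?_⟩
    have hlaw : unitMeasure.map (fun u i => bits u (iotaPlus (e i)))
        = Measure.infinitePi fun _ : ι => coin := by
      have h1 := Measure.map_infinitePi_infinitePi_of_inj (P := fun _ : ℕ => coin)
        (iotaPlus_injective.comp he)
      rw [← map_bits, Measure.map_map (by fun_prop) (measurable_pi_lambda _ measurable_bits)] at h1
      exact h1
    have hmeas : Measurable fun u (i : ι) => bits u (iotaPlus (e i)) :=
      measurable_pi_lambda _ fun i => measurable_bits _
    have h2 : ∫ u, |∑ i, r.1 (e i) u * x i| ∂unitMeasure
        = ∫ w, |∑ i, sgn (w i) * x i| ∂(Measure.infinitePi fun _ : ι => coin) := by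
      rw [← hlaw, integral_map hmeas.aemeasurable .of_discrete]
      refine integral_congr_ae (ae_mem_unit.mono fun u hu => ?_)
      simp only [h, rademacher_eq_sgn hu]
    rw [intervalIntegral_eq_unitMeasure, h2, integral_fintype .of_finite]
    rfl
  · rw [mem_singleton_iff] at h
    refine ⟨fun w => if w = fun _ => false then 1 else 0, fun w => by
      dsimp only; split_ifs <;> simp,
      fun e _ x => ?_⟩
    rw [intervalIntegral_eq_unitMeasure]
    have h2 : ∫ u, |∑ i, r.1 (e i) u * x i| ∂unitMeasure = ∫ _, |∑ i, x i| ∂unitMeasure := by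
      refine integral_congr_ae (ae_mem_unit.mono fun u hu => ?_)
      simp only [h, rademacher_eq_sgn hu]
      rw [← Finset.mul_sum, abs_mul, abs_sgn, one_mul]
    rw [h2]
    simp [signAverage, sgn]

lemma measurable_signAverage (p : (ι → Bool) → ℝ) : Measurable (signAverage p) := by
  unfold signAverage
  fun_prop

/-- The function `s ↦ ∑ p(w) |∑ ± f_i(s)|`. -/
def signAverageFun (p : (ι → Bool) → ℝ) (f : ι → H) : H :=
  ⟨fun s => signAverage p fun i => (f i : ℝ → ℝ) s, by
    choose n hn using fun i => step_of_mem_H (f i).2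
    refine mem_H_of_step (N := Finset.univ.sup n) ?_ ?_
    · intro x y h
      simp only [signAverage, fun i => hn i _ (Finset.le_sup (Finset.mem_univ i)) x y h]
    · intro s hs
      simp only [signAverage, fun i => eq_zero_of_mem_H (f i).2 hs]
      simp⟩

lemma absDistribution_signAverageFun (p : (ι → Bool) → ℝ) (f : ι → H) :
    absDistribution (signAverageFun p f) = (jointLaw f).map fun x => |signAverage p x| := by
  have hm : Measurable fun x => |signAverage p x| := (measurable_signAverage p).norm
  rw [jointLaw, Measure.map_map hm (measurable_family f)]
  rfl

lemma exists_hardyMap_eq (r : rademacherFamilies) (ι : Type*) [Fintype ι] [DecidableEq ι] :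
    ∃ p : (ι → Bool) → ℝ, (∀ w, 0 ≤ p w) ∧ ∀ C : ι → Finset DyadicInterval, IsBlockFamily C →
      ∀ f : ι → H, (∀ i, f i ∈ haarSpan (C i)) → hardyMap r (∑ i, f i) = signAverageFun p f := by
  obtain ⟨p, hp, hpe⟩ := exists_signAverage r ι
  refine ⟨p, hp, fun C hC f hf => Subtype.ext (funext fun s => ?_)⟩
  choose K hK hKr using fun i => exists_randomized_eq (hC.nonempty i) (hC.sep i) r (hf i) s
  have he : Function.Injective fun i => some (K i) := by
    intro i j hij
    by_contra hne
    have hij' : K i = K j := Option.some.inj hij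
    exact Finset.disjoint_left.1 (hC.disj i j hne) (hK i) (hij' ▸ hK j)
  change hardyFun r (∑ i, f i) s = signAverage p fun i => (f i : ℝ → ℝ) s
  rw [← hpe _ he, hardyFun]
  congr 1
  funext u
  rw [← randomizedLin_apply, map_sum]
  simp only [randomizedLin_apply, hKr]

/-- If each member of a block family is an average of functions, and if all the families that are
averaged have the same joint law, then averaging does not increase the norm. For one family this
says that the norm is determined by the joint law. -/
theorem norm_sum_le_of_average (X : HaarSystemNorm) (r : rademacherFamilies)
    {C C' : ι → Finset DyadicInterval} (hC : IsBlockFamily C) (hC' : IsBlockFamily C')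
    {f g : ι → H} (hf : ∀ i, f i ∈ haarSpan (C i)) (hg : ∀ i, g i ∈ haarSpan (C' i))
    {U : Type*} [Fintype U] [Nonempty U] (F : U → ι → H) (hF : ∀ u, jointLaw (F u) = jointLaw f)
    (havg : ∀ i, (Fintype.card U : ℝ) • g i = ∑ u, F u i) :
    ‖toHardy X r (∑ i, g i)‖ ≤ ‖toHardy X r (∑ i, f i)‖ := by
  obtain ⟨p, hp, hpC⟩ := exists_hardyMap_eq r ι
  rw [norm_toHardy, norm_toHardy, hpC C hC f hf, hpC C' hC' g hg]
  have hcard : (0 : ℝ) < Fintype.card U := by exact_mod_cast Fintype.card_pos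
  have h1 : X.toSeminorm ((Fintype.card U : ℝ) • signAverageFun p g)
      ≤ X.toSeminorm (∑ u, signAverageFun p (F u)) := by
    refine X.mono fun s => ?_
    have hnn : ∀ x : ι → ℝ, 0 ≤ signAverage p x := fun x =>
      Finset.sum_nonneg fun w _ => mul_nonneg (hp w) (abs_nonneg _)
    have hval : ∀ i, (Fintype.card U : ℝ) * (g i : ℝ → ℝ) s = ∑ u, (F u i : ℝ → ℝ) s := by
      intro i
      rw [← H_sum_apply, ← havg]
      rfl
    rw [H_sum_apply, Submodule.coe_smul, Pi.smul_apply, smul_eq_mul]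
    change |(Fintype.card U : ℝ) * signAverage p fun i => (g i : ℝ → ℝ) s|
      ≤ |∑ u, signAverage p fun i => (F u i : ℝ → ℝ) s|
    rw [abs_of_nonneg (mul_nonneg hcard.le (hnn _)),
      abs_of_nonneg (Finset.sum_nonneg fun u _ => hnn _)]
    simp only [signAverage]
    rw [Finset.sum_comm, Finset.mul_sum]
    refine Finset.sum_le_sum fun w _ => ?_
    rw [← Finset.mul_sum, mul_left_comm]
    refine mul_le_mul_of_nonneg_left ?_ (hp w)
    calc (Fintype.card U : ℝ) * |∑ i, sgn (w i) * (g i : ℝ → ℝ) s|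
        = |∑ u, ∑ i, sgn (w i) * (F u i : ℝ → ℝ) s| := by
          rw [Finset.sum_comm, ← abs_of_pos hcard, ← abs_mul, Finset.mul_sum]
          congr 1
          refine Finset.sum_congr rfl fun i _ => ?_
          rw [← Finset.mul_sum, ← hval]
          ring
      _ ≤ _ := Finset.abs_sum_le_sum_abs _ _
  have h2 : ∀ u, X.toSeminorm (signAverageFun p (F u)) = X.toSeminorm (signAverageFun p f) :=
    fun u => X.rearrangement_invariant _ _ (by
      rw [absDistribution_signAverageFun, absDistribution_signAverageFun, hF])
  have h3 : X.toSeminorm (∑ u, signAverageFun p (F u))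
      ≤ ∑ u, X.toSeminorm (signAverageFun p (F u)) :=
    Finset.le_sum_of_subadditive _ (map_zero X.toSeminorm).le (map_add_le_add X.toSeminorm) _ _
  simp only [h2, Finset.sum_const, Finset.card_univ, nsmul_eq_mul] at h3
  rw [map_smul_eq_mul, Real.norm_of_nonneg hcard.le] at h1
  exact le_of_mul_le_mul_left (h1.trans h3) hcard

theorem norm_sum_eq_of_jointLaw_eq (X : HaarSystemNorm) (r : rademacherFamilies)
    {C C' : ι → Finset DyadicInterval} (hC : IsBlockFamily C) (hC' : IsBlockFamily C')
    {f g : ι → H} (hf : ∀ i, f i ∈ haarSpan (C i)) (hg : ∀ i, g i ∈ haarSpan (C' i))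
    (h : jointLaw f = jointLaw g) :
    ‖toHardy X r (∑ i, f i)‖ = ‖toHardy X r (∑ i, g i)‖ :=
  le_antisymm
    (norm_sum_le_of_average X r hC' hC hg hf (U := Unit) (fun _ => f) (fun _ => h) (by simp))
    (norm_sum_le_of_average X r hC hC' hf hg (U := Unit) (fun _ => g) (fun _ => h.symm) (by simp))

end SignAverage

/-! ### Blocks of the functions `h_I^n` -/

/-- The function `h_I^n`, where `p = (n, I)`. -/
abbrev omegaHaar (τ : ℕ → Finset ℕ) (p : DyadicOmega) : H := hOmega τ p.n p.I

/-- The collection of the dyadic intervals whose Haar functions add up to `h_I^n`, `p = (n, I)`. -/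
def collection (τ : ℕ → Finset ℕ) (p : DyadicOmega) : Finset DyadicInterval :=
  rademacherCollection (freq τ p.n) p.I.1 p.I.2

section Frequencies

variable {τ : ℕ → Finset ℕ}

lemma omegaHaar_mem_haarSpan (p : DyadicOmega) : omegaHaar τ p ∈ haarSpan (collection τ p) :=
  Submodule.sum_mem _ fun _ hK => haarBasis_mem_haarSpan hK

lemma omegaHaar_ne_zero (hτ : IsFrequencies τ) (p : DyadicOmega) : omegaHaar τ p ≠ 0 := by
  intro h
  have h1 := pairing_hOmega_self hτ p
  rw [show hOmega τ p.n p.I = 0 from h, ← pairingLin_apply, map_zero] at h1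
  exact (length_pos p.I).ne h1

lemma collection_nonempty (hτ : IsFrequencies τ) (p : DyadicOmega) :
    (collection τ p).Nonempty := by
  rw [Finset.nonempty_iff_ne_empty]
  intro h
  refine omegaHaar_ne_zero hτ p ?_
  have : rademacherCollection (freq τ p.n) p.I.1 p.I.2 = ∅ := h
  exact (congrArg (fun C => ∑ K ∈ C, haarBasis (some K)) this).trans Finset.sum_empty

lemma toSet_nonempty (K : DyadicInterval) : K.toSet.Nonempty :=
  ⟨_, le_rfl, (div_lt_div_iff_of_pos_right (by positivity)).2 (by linarith)⟩

lemma eq_of_mem_collection (hτ : IsFrequencies τ) {p q : DyadicOmega} {K : DyadicInterval}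
    (hp : K ∈ collection τ p) (hq : K ∈ collection τ q) : p = q := by
  obtain ⟨hn, hl⟩ := hτ.freq_inj p.le q.le ((level_of_mem_rademacherCollection hp).symm.trans
    (level_of_mem_rademacherCollection hq))
  obtain ⟨s, hs⟩ := toSet_nonempty K
  have hs' := toSet_subset_unit K hs
  have h1 := hOmega_ne_zero_of_mem hτ p.le hp hs
  have h2 := hOmega_ne_zero_of_mem hτ q.le hq hs
  rw [hOmega_apply hτ p.le hs', seqHaar_ne_zero_iff] at h1
  rw [hOmega_apply hτ q.le hs', seqHaar_ne_zero_iff] at h2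
  refine DyadicOmega.ext hn ?_
  rw [eq_prefixInterval h1, eq_prefixInterval h2, hn]
  exact congrArg _ hl

/-- Disjoint finite sets of indices, such that functions with indices in the same set have disjoint
supports, give rise to a block family. -/
lemma isBlockFamily_biUnion (hτ : IsFrequencies τ) {ι : Type*} {R : ι → Finset DyadicOmega}
    (hne : ∀ i, (R i).Nonempty) (hdisj : ∀ i j, i ≠ j → Disjoint (R i) (R j))
    (hsep : ∀ i, ∀ p ∈ R i, ∀ q ∈ R i, p ≠ q → ∀ s, (omegaHaar τ p : ℝ → ℝ) s = 0 ∨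
      (omegaHaar τ q : ℝ → ℝ) s = 0) :
    IsBlockFamily fun i => (R i).biUnion (collection τ) where
  nonempty i := by
    obtain ⟨p, hp⟩ := hne i
    obtain ⟨K, hK⟩ := collection_nonempty hτ p
    exact ⟨K, Finset.mem_biUnion.2 ⟨p, hp, hK⟩⟩
  disj i j hij := by
    rw [Finset.disjoint_left]
    intro K hK hK'
    obtain ⟨p, hp, hKp⟩ := Finset.mem_biUnion.1 hK
    obtain ⟨q, hq, hKq⟩ := Finset.mem_biUnion.1 hK'
    obtain rfl := eq_of_mem_collection hτ hKp hKq
    exact Finset.disjoint_left.1 (hdisj i j hij) hp hq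
  sep i K hK L hL hne := by
    obtain ⟨p, hp, hKp⟩ := Finset.mem_biUnion.1 hK
    obtain ⟨q, hq, hLq⟩ := Finset.mem_biUnion.1 hL
    rw [Set.disjoint_left]
    intro s hsK hsL
    by_cases hpq : p = q
    · subst hpq
      have hs := toSet_subset_unit K hsK
      apply hne
      rw [eq_prefixInterval ((mem_toSet_iff_prefixIndex hs K).1 hsK),
        eq_prefixInterval ((mem_toSet_iff_prefixIndex hs L).1 hsL),
        level_of_mem_rademacherCollection hKp, level_of_mem_rademacherCollection hLq]
    · rcases hsep i p hp q hq hpq s with h | h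
      · exact hOmega_ne_zero_of_mem hτ p.le hKp hsK h
      · exact hOmega_ne_zero_of_mem hτ q.le hLq hsL h

lemma sum_mem_haarSpan_biUnion (R : Finset DyadicOmega) (a : DyadicOmega → ℝ) :
    ∑ q ∈ R, a q • omegaHaar τ q ∈ haarSpan (R.biUnion (collection τ)) :=
  Submodule.sum_mem _ fun q hq => Submodule.smul_mem _ _
    (haarSpan_mono (Finset.subset_biUnion_of_mem _ hq) (omegaHaar_mem_haarSpan q))

/-- The `h_I^n` themselves form a block family. -/
lemma isBlockFamily_collection (hτ : IsFrequencies τ) {ι : Type*} {e : ι → DyadicOmega}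
    (he : Function.Injective e) : IsBlockFamily fun i => collection τ (e i) := by
  have := isBlockFamily_biUnion hτ (R := fun i => {e i}) (fun i => Finset.singleton_nonempty _)
    (fun i j hij => by simpa using fun h => hij (he h))
    (fun i p hp q hq hpq => absurd ((Finset.mem_singleton.1 hp).trans
      (Finset.mem_singleton.1 hq).symm) hpq)
  simpa using this

/-! ### The functions `h_I^n` form a monotone basic sequence -/

/-- Dropping the last term of a sum does not increase the norm: the sum without this term is the
average of the sums with both signs of this term. -/
lemma norm_sum_le_norm_sum_insert (hτ : IsFrequencies τ) (X : HaarSystemNorm)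
    (r : rademacherFamilies) (a : DyadicOmega → ℝ) {p : DyadicOmega} {S : Finset DyadicOmega}
    (hp : ∀ q ∈ S, q < p) [DecidableEq DyadicOmega] :
    ‖toHardy X r (∑ q ∈ S, a q • omegaHaar τ q)‖
      ≤ ‖toHardy X r (∑ q ∈ insert p S, a q • omegaHaar τ q)‖ := by
  have hpS : p ∉ S := fun h => lt_irrefl _ (hp p h)
  let T : Finset DyadicOmega := insert p S
  have hle : ∀ i : T, (i : DyadicOmega) ≤ p := by
    rintro ⟨q, hq⟩
    rcases Finset.mem_insert.1 hq with rfl | h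
    · exact le_rfl
    · exact (hp q h).le
  have hC := isBlockFamily_collection hτ (e := fun i : T => (i : DyadicOmega))
    Subtype.val_injective
  have hmem : ∀ (i : T) (c : ℝ), c • omegaHaar τ i ∈ haarSpan (collection τ i) := fun i c =>
    Submodule.smul_mem _ _ (omegaHaar_mem_haarSpan _)
  have key := norm_sum_le_of_average X r hC hC (f := fun i : T => a i • omegaHaar τ i)
    (g := fun i : T => (if (i : DyadicOmega) = p then 0 else a i) • omegaHaar τ i)
    (fun i => hmem i _) (fun i => hmem i _) (U := Bool)
    (fun u i => if u then a i • omegaHaar τ i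
      else (if (i : DyadicOmega) = p then -a i else a i) • omegaHaar τ i)
    (by
      intro u
      cases u with
      | true => simp
      | false =>
        simp only [Bool.false_eq_true, if_false]
        exact jointLaw_flip hτ _ p hle _)
    (by
      intro i
      simp only [Fintype.card_bool, Fintype.sum_bool, if_true, Bool.false_eq_true, if_false]
      rw [← add_smul, smul_smul]
      congr 1
      split_ifs <;> push_cast <;> ring)
  rw [Finset.sum_coe_sort T fun q => a q • omegaHaar τ q,
    Finset.sum_coe_sort T fun q => (if q = p then 0 else a q) • omegaHaar τ q,
    Finset.sum_insert hpS, if_pos rfl, zero_smul, zero_add] at key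
  refine le_of_eq_of_le ?_ key
  congr 2
  exact Finset.sum_congr rfl fun q hq => by rw [if_neg (hp q hq).ne]

/-- The partial sums with respect to the order `≺` are contractions. -/
lemma norm_sum_filter_le (hτ : IsFrequencies τ) (X : HaarSystemNorm) (r : rademacherFamilies)
    (a : DyadicOmega → ℝ) (p : DyadicOmega) (S : Finset DyadicOmega) :
    ‖toHardy X r (∑ q ∈ S.filter (· ≤ p), a q • omegaHaar τ q)‖
      ≤ ‖toHardy X r (∑ q ∈ S, a q • omegaHaar τ q)‖ := by
  classical
  induction S using Finset.induction_on_max with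
  | empty => simp
  | insert m S hm ih =>
    by_cases hmp : m ≤ p
    · rw [Finset.filter_true_of_mem]
      intro q hq
      rcases Finset.mem_insert.1 hq with rfl | h
      · exact hmp
      · exact (hm q h).le.trans hmp
    · rw [Finset.filter_insert, if_neg hmp]
      exact ih.trans (norm_sum_le_norm_sum_insert hτ X r a hm)

end Frequencies

/-! ### Faithful Haar systems as images of the Haar system -/

lemma exists_eq_left_or_right {I : DyadicInterval} {k : ℕ} (hI : I.1 = k + 1) :
    ∃ P : DyadicInterval, P.1 = k ∧ (I = P.left ∨ I = P.right) := by
  obtain ⟨l, i, hi⟩ := I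
  obtain rfl : l = k + 1 := hI
  have hi2 : i / 2 < 2 ^ k := by rw [pow_succ] at hi; omega
  refine ⟨⟨k, i / 2, hi2⟩, rfl, ?_⟩
  rcases Nat.mod_two_eq_zero_or_one i with h | h
  · left
    simp only [left]
    congr
    omega
  · right
    simp only [right]
    congr
    omega

/-- Values in `{0, 1, -1}` that obey the support rules of the Haar system are the values of
the Haar system at some point. -/
lemma exists_seqHaar_eq (n : ℕ) {g : DyadicInterval → ℝ}
    (hval : ∀ I, I.1 ≤ n → g I = 0 ∨ g I = 1 ∨ g I = -1) (hroot : g root ≠ 0)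
    (hleft : ∀ I, I.1 < n → (g I.left ≠ 0 ↔ g I = 1))
    (hright : ∀ I, I.1 < n → (g I.right ≠ 0 ↔ g I = -1)) :
    ∃ y : ℕ → Bool, ∀ I, I.1 ≤ n → g I = seqHaar I y := by
  classical
  suffices h : ∀ k ≤ n + 1, ∃ y : ℕ → Bool, (∀ I, I.1 < k → g I = seqHaar I y) ∧
      (k ≤ n → ∀ I, I.1 = k → (g I ≠ 0 ↔ prefixIndex y I.1 = I.2)) by
    obtain ⟨y, hy, -⟩ := h (n + 1) le_rfl
    exact ⟨y, fun I hI => hy I (by omega)⟩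
  intro k
  induction k with
  | zero =>
    refine fun _ => ⟨fun _ => false, fun I hI => absurd hI (Nat.not_lt_zero _), ?_⟩
    rintro - ⟨l, i, hi⟩ hI
    obtain rfl : l = 0 := hI
    obtain rfl : i = 0 := by simpa using hi
    exact ⟨fun _ => rfl, fun _ => hroot⟩
  | succ k ih =>
    intro hk
    obtain ⟨y, hy, hsupp⟩ := ih (by omega)
    -- the next digit is read off from the only function of level `k` that does not vanish
    let z : ℕ → Bool := Function.update y k (decide (g (prefixInterval y k) = -1))
    have hzy : ∀ j, j ≠ k → z j = y j := fun j hj => Function.update_of_ne hj _ _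
    have hpre : ∀ j ≤ k, prefixIndex z j = prefixIndex y j := fun j hj =>
      prefixIndex_eq_iff.2 fun i hi => hzy i (by omega)
    have hz : ∀ I, I.1 < k + 1 → g I = seqHaar I z := by
      intro I hI
      rcases Nat.lt_succ_iff_lt_or_eq.1 hI with h | h
      · rw [hy I h]
        exact seqHaar_congr fun j hj => (hzy j (by omega)).symm
      · by_cases hIy : prefixIndex y I.1 = I.2
        · have hIp : I = prefixInterval y k := (eq_prefixInterval hIy).trans (by rw [h])
          have hne := (hsupp (by omega) I h).2 hIy
          have hzI : z I.1 = decide (g I = -1) := by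
            rw [h]
            simp only [z, Function.update_self, ← hIp]
          rw [seqHaar, hpre I.1 h.le, if_pos hIy, hzI, sgn]
          rcases hval I (by omega) with h0 | h0 | h0
          · exact absurd h0 hne
          · rw [h0]; norm_num
          · rw [h0]; simp
        · have h0 : g I = 0 := by
            by_contra hne
            exact hIy ((hsupp (by omega) I h).1 hne)
          rw [h0, seqHaar, hpre I.1 h.le, if_neg hIy]
    refine ⟨z, hz, fun hkn I hI => ?_⟩
    obtain ⟨P, hP, rfl | rfl⟩ := exists_eq_left_or_right hI
    · rw [hleft P (by omega), hz P (by omega), ← prefixIndex_left_iff]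
    · rw [hright P (by omega), hz P (by omega), ← prefixIndex_right_iff]

/-- A faithful Haar system in `Y_ω` in the form in which it is used: `b_I^n` is a combination of the
functions `h_K^{N(n)}`, `(N(n), K) ∈ R (n, I)`, with coefficients `θ`, and the `b_I^n` arise from the
Haar functions by composition with the maps `D n` from the block `N(n)` to the block `n`. -/
structure FaithfulBlocks (τ : ℕ → Finset ℕ) (b : DyadicOmega → H) where
  N : ℕ → ℕ
  N_injective : Function.Injective N
  R : DyadicOmega → Finset DyadicOmega
  θ : DyadicOmega → DyadicOmega → ℝ
  n_eq : ∀ p, ∀ q ∈ R p, q.n = N p.n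
  disj : ∀ p p', p ≠ p' → Disjoint (R p) (R p')
  sep : ∀ p, ∀ q ∈ R p, ∀ q' ∈ R p, q ≠ q' → Disjoint q.I.toSet q'.I.toSet
  b_eq : ∀ p, b p = ∑ q ∈ R p, θ p q • omegaHaar τ q
  D : ∀ n, Block (N n) → Block n
  D_eq : ∀ p (v : Block (N p.n)),
    ∑ q ∈ R p, θ p q * seqHaar q.I (pad v) = blockHaar p.n p.I (D p.n v)

/-- The pairs `(m, K)`, where `K` belongs to a given collection. -/
def pairsWith (m : ℕ) (B : Finset DyadicInterval) (hB : ∀ K ∈ B, K.1 ≤ m) : Finset DyadicOmega :=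
  B.attach.map ⟨fun K => ⟨m, K.1, hB K.1 K.2⟩, fun _ _ h => Subtype.ext (DyadicOmega.mk.inj h).2⟩

lemma mem_pairsWith {m : ℕ} {B : Finset DyadicInterval} {hB : ∀ K ∈ B, K.1 ≤ m} {q : DyadicOmega} :
    q ∈ pairsWith m B hB ↔ q.n = m ∧ q.I ∈ B := by
  simp only [pairsWith, Finset.mem_map, Finset.mem_attach, true_and, Subtype.exists]
  constructor
  · rintro ⟨K, hK, rfl⟩
    exact ⟨rfl, hK⟩
  · rintro ⟨rfl, hq⟩
    exact ⟨q.I, hq, rfl⟩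

lemma sum_pairsWith {M : Type*} [AddCommMonoid M] {m : ℕ} {B : Finset DyadicInterval}
    {hB : ∀ K ∈ B, K.1 ≤ m} (f : ℕ → DyadicInterval → M) :
    ∑ q ∈ pairsWith m B hB, f q.n q.I = ∑ K ∈ B, f m K := by
  rw [pairsWith, Finset.sum_map]
  exact Finset.sum_attach B fun K => f m K

lemma coord_eq_zero_of_mem_YFin {n : ℕ} {f : H} (hf : f ∈ YFin n) {K : DyadicInterval}
    (hK : n < K.1) : haarBasis.coord (some K) f = 0 := by
  have hle : YFin n ≤ LinearMap.ker (haarBasis.coord (some K)) := by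
    refine Submodule.span_le.2 ?_
    rintro _ ⟨I, hI, rfl⟩
    rw [SetLike.mem_coe, LinearMap.mem_ker, Module.Basis.coord_apply, Module.Basis.repr_self,
      Finsupp.single_apply, if_neg]
    rintro h
    obtain rfl := Option.some.inj h
    exact absurd hI (not_le.2 hK)
  exact hle hf

/-- A combination of Haar functions of disjoint intervals with coefficients `±1` takes the values
`±1` on the union of the intervals, and it vanishes elsewhere. -/
lemma sum_smul_haar_values {B : Finset DyadicInterval} {θ : DyadicInterval → ℝ}
    (hθ : ∀ K, θ K = 1 ∨ θ K = -1) (hB : (B : Set DyadicInterval).PairwiseDisjoint toSet) {s : ℝ}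
    (hs : s ∈ Ico (0 : ℝ) 1) :
    (∑ K ∈ B, θ K * seqHaar K (bits s) = 0 ∨ ∑ K ∈ B, θ K * seqHaar K (bits s) = 1 ∨
      ∑ K ∈ B, θ K * seqHaar K (bits s) = -1) ∧
    (∑ K ∈ B, θ K * seqHaar K (bits s) ≠ 0 ↔ s ∈ ⋃ K ∈ B, K.toSet) := by
  have h0 : ∀ K : DyadicInterval, s ∉ K.toSet → seqHaar K (bits s) = 0 := by
    intro K hK
    by_contra hne
    exact hK ((mem_toSet_iff_prefixIndex hs K).2 (seqHaar_ne_zero_iff.1 hne))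
  by_cases h : s ∈ ⋃ K ∈ B, K.toSet
  · obtain ⟨K, hK, hsK⟩ := Set.mem_iUnion₂.1 h
    have hne := seqHaar_ne_zero_iff.2 ((mem_toSet_iff_prefixIndex hs K).1 hsK)
    rw [Finset.sum_eq_single_of_mem K hK]
    · refine ⟨?_, fun _ => h, fun _ => ?_⟩
      · rcases seqHaar_eq_or K (bits s) with h1 | h1 | h1 <;> rcases hθ K with h2 | h2 <;>
          simp [h1, h2]
      · rcases hθ K with h2 | h2 <;> simp [h2, hne]
    · intro L hL hne
      rw [h0 L, mul_zero]
      exact fun hsL => Set.disjoint_left.1 (hB hL hK hne) hsL hsK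
  · rw [Finset.sum_eq_zero]
    · exact ⟨Or.inl rfl, fun h' => absurd rfl h', fun h' => absurd h' h⟩
    · intro K hK
      rw [h0 K fun hsK => h (Set.mem_iUnion₂.2 ⟨K, hK, hsK⟩), mul_zero]

lemma exists_block_eq {n m : ℕ} {h : DyadicInterval → H} {B : DyadicInterval → Finset DyadicInterval}
    {θ : DyadicInterval → ℝ} (hθ : ∀ K, θ K = 1 ∨ θ K = -1)
    (hh : ∀ I, I.level ≤ n → h I = ∑ K ∈ B I, θ K • haarBasis (some K))
    (hB : ∀ I, I.level ≤ n → (B I : Set DyadicInterval).PairwiseDisjoint toSet)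
    (hroot : (⋃ K ∈ B root, K.toSet) = Ico (0 : ℝ) 1)
    (hlr : ∀ I, I.level < n →
      (⋃ K ∈ B I.left, K.toSet) = {s | (h I : ℝ → ℝ) s = 1} ∧
      (⋃ K ∈ B I.right, K.toSet) = {s | (h I : ℝ → ℝ) s = -1}) (v : Block m) :
    ∃ w : Block n, ∀ I, I.1 ≤ n → ∑ K ∈ B I, θ K * seqHaar K (pad v) = blockHaar n I w := by
  obtain ⟨s, hs, hsv⟩ := exists_bits_eq_pad v
  have hval : ∀ I, I.1 ≤ n → (h I : ℝ → ℝ) s = ∑ K ∈ B I, θ K * seqHaar K (bits s) := by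
    intro I hI
    rw [hh I hI, H_sum_apply]
    refine Finset.sum_congr rfl fun K _ => ?_
    rw [Submodule.coe_smul, Pi.smul_apply, haarBasis_apply, ← haar_eq_seqHaar hs]
    rfl
  have hleft1 : ∀ I : DyadicInterval, I.left.1 = I.1 + 1 := fun _ => rfl
  have hright1 : ∀ I : DyadicInterval, I.right.1 = I.1 + 1 := fun _ => rfl
  obtain ⟨y, hy⟩ := exists_seqHaar_eq n (g := fun I => ∑ K ∈ B I, θ K * seqHaar K (bits s))
    (fun I hI => (sum_smul_haar_values hθ (hB I hI) hs).1)
    ((sum_smul_haar_values hθ (hB root (Nat.zero_le n)) hs).2.2 (by rw [hroot]; exact hs))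
    (fun I hI => by
      have := (sum_smul_haar_values hθ (hB I.left hI) hs).2
      rw [this, (hlr I hI).1, ← hval I hI.le]
      rfl)
    (fun I hI => by
      have := (sum_smul_haar_values hθ (hB I.right hI) hs).2
      rw [this, (hlr I hI).2, ← hval I hI.le]
      rfl)
  refine ⟨fun j => y j, fun I hI => ?_⟩
  rw [← hsv, hy I hI]
  refine seqHaar_congr fun j hj => ?_
  rw [pad, dif_pos (by omega)]

lemma exists_faithfulBlocks {τ : ℕ → Finset ℕ} {b : DyadicOmega → H}
    (hb : IsFaithfulHaarSystemInYOmega τ b) : Nonempty (FaithfulBlocks τ b) := by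
  obtain ⟨N, h, hN, hfaith, hY, hbJ⟩ := hb
  choose B θ hθ _ hh hsep hdisj hroot hlr using hfaith
  have hlev : ∀ p : DyadicOmega, ∀ K ∈ B p.n p.I, K.1 ≤ N p.n := by
    intro p K hK
    by_contra hlt
    have h0 := coord_eq_zero_of_mem_YFin (hY p.n p.I p.le) (not_le.1 hlt)
    rw [hh p.n p.I p.le, map_sum, Finset.sum_eq_single_of_mem K hK] at h0
    · rw [map_smul, Module.Basis.coord_apply, Module.Basis.repr_self, Finsupp.single_eq_same,
        smul_eq_mul, mul_one] at h0
      rcases hθ p.n K with h1 | h1 <;> rw [h1] at h0 <;> norm_num at h0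
    · intro L _ hne
      rw [map_smul, Module.Basis.coord_apply, Module.Basis.repr_self, Finsupp.single_apply,
        if_neg, smul_zero]
      exact fun h => hne (Option.some.inj h)
  choose D hD using fun (n : ℕ) (v : Block (N n)) =>
    exists_block_eq (hθ n) (hh n) (hsep n) (hroot n) (hlr n) v
  refine ⟨{
    N := N
    N_injective := hN.injective
    R := fun p => pairsWith (N p.n) (B p.n p.I) (hlev p)
    θ := fun p q => θ p.n q.I
    n_eq := fun p q hq => (mem_pairsWith.1 hq).1
    disj := ?_
    sep := ?_
    b_eq := ?_
    D := D
    D_eq := ?_ }⟩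
  · intro p p' hne
    rw [Finset.disjoint_left]
    intro q hq hq'
    obtain ⟨h1, h2⟩ := mem_pairsWith.1 hq
    obtain ⟨h1', h2'⟩ := mem_pairsWith.1 hq'
    have hn : p.n = p'.n := hN.injective (h1.symm.trans h1')
    have hI : p.I ≠ p'.I := fun hI => hne (DyadicOmega.ext hn hI)
    rw [← hn] at h2'
    exact Finset.disjoint_left.1 (hdisj p.n _ _ p.le (hn ▸ p'.le) hI) h2 h2'
  · intro p q hq q' hq' hne
    obtain ⟨h1, h2⟩ := mem_pairsWith.1 hq
    obtain ⟨h1', h2'⟩ := mem_pairsWith.1 hq'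
    exact hsep p.n p.I p.le h2 h2' fun hI => hne (DyadicOmega.ext (h1.trans h1'.symm) hI)
  · intro p
    rw [hbJ, hh p.n p.I p.le, map_sum,
      sum_pairsWith (f := fun m K => θ p.n K • hOmega τ m K)]
    refine Finset.sum_congr rfl fun K hK => ?_
    rw [map_smul, J, Module.Basis.constr_basis]
    have : K.level ≤ N p.n := hlev p K hK
    simp [this]
  · intro p v
    rw [sum_pairsWith (f := fun _ K => θ p.n K * seqHaar K (pad v))]
    exact hD p.n v p.I p.le

/-! ### Conditional expectations as averages over permutations -/

/-- The average of a function over all permutations that preserve the fibres of `D` is the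
average over the fibre. -/
lemma card_mul_sum_perm {V W : Type*} [Fintype V] [DecidableEq V] [DecidableEq W] (D : V → W)
    (z : V → ℝ) (v : V) :
    ((Finset.univ.filter fun v' => D v' = D v).card : ℝ) *
        ∑ π ∈ Finset.univ.filter (fun π : Equiv.Perm V => ∀ v, D (π v) = D v), z (π v)
      = (Finset.univ.filter fun π : Equiv.Perm V => ∀ v, D (π v) = D v).card *
        ∑ v' ∈ Finset.univ.filter (fun v' => D v' = D v), z v' := by
  set G := Finset.univ.filter fun π : Equiv.Perm V => ∀ v, D (π v) = D v with hG
  have hmem : ∀ π, π ∈ G ↔ ∀ v, D (π v) = D v := fun π => by simp [hG]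
  -- the average is constant on the fibre, since the transposition of two points of a fibre
  -- preserves the fibres
  have hconst : ∀ v', D v' = D v → ∑ π ∈ G, z (π v') = ∑ π ∈ G, z (π v) := by
    intro v' hv'
    have hswap : ∀ w, D (Equiv.swap v v' w) = D w := by
      intro w
      by_cases h1 : w = v
      · rw [h1, Equiv.swap_apply_left, hv']
      · by_cases h2 : w = v'
        · rw [h2, Equiv.swap_apply_right, hv']
        · rw [Equiv.swap_apply_of_ne_of_ne h1 h2]
    refine Finset.sum_bij' (fun π _ => π * Equiv.swap v v') (fun π _ => π * Equiv.swap v v')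
      ?_ ?_ ?_ ?_ ?_
    · intro π hπ
      rw [hmem] at hπ ⊢
      intro w
      rw [Equiv.Perm.mul_apply, hπ, hswap]
    · intro π hπ
      rw [hmem] at hπ ⊢
      intro w
      rw [Equiv.Perm.mul_apply, hπ, hswap]
    · intro π _
      rw [mul_assoc, Equiv.swap_mul_self, mul_one]
    · intro π _
      rw [mul_assoc, Equiv.swap_mul_self, mul_one]
    · intro π _
      rw [Equiv.Perm.mul_apply, Equiv.swap_apply_left]
  calc _ = ∑ v' ∈ Finset.univ.filter (fun v' => D v' = D v), ∑ π ∈ G, z (π v') := by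
        rw [Finset.sum_congr rfl fun v' hv' => hconst v' (Finset.mem_filter.1 hv').2]
        rw [Finset.sum_const, nsmul_eq_mul]
    _ = ∑ π ∈ G, ∑ v' ∈ Finset.univ.filter (fun v' => D v' = D v), z v' := by
        rw [Finset.sum_comm]
        refine Finset.sum_congr rfl fun π hπ => ?_
        rw [hmem] at hπ
        refine Finset.sum_equiv π (fun w => ?_) fun w _ => rfl
        simp [hπ]
    _ = _ := by rw [Finset.sum_const, nsmul_eq_mul]

/-- Averaging a function of one coordinate over a finite product. -/
lemma card_mul_sum_pi {κ : Type*} [Fintype κ] [DecidableEq κ] {G : κ → Type*} [∀ k, Fintype (G k)]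
    (k : κ) (f : G k → ℝ) :
    (Fintype.card (G k) : ℝ) * ∑ u : ∀ k, G k, f (u k) = Fintype.card (∀ k, G k) * ∑ g, f g := by
  have h1 : ∑ u : ∀ k, G k, f (u k)
      = Fintype.card (∀ j : { j // j ≠ k }, G j) * ∑ g, f g := by
    rw [Fintype.sum_equiv (Equiv.piSplitAt k G) (fun u => f (u k)) (fun x => f x.1) fun _ => rfl,
      Fintype.sum_prod_type]
    simp only [Finset.sum_const, Finset.card_univ, nsmul_eq_mul]
    rw [Finset.mul_sum]
  have h2 : Fintype.card (∀ k, G k)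
      = Fintype.card (G k) * Fintype.card (∀ j : { j // j ≠ k }, G j) := by
    rw [Fintype.card_congr (Equiv.piSplitAt k G), Fintype.card_prod]
  rw [h1, h2]
  push_cast
  ring

section Frequencies

variable {τ : ℕ → Finset ℕ}

/-- Averaging over permutations of the values of the blocks does not increase the norm. -/
theorem norm_sum_pull_le (hτ : IsFrequencies τ) (X : HaarSystemNorm) (r : rademacherFamilies)
    {ι : Type*} [Fintype ι] [DecidableEq ι] {C C' : ι → Finset DyadicInterval}
    (hC : IsBlockFamily C) (hC' : IsBlockFamily C') (m : ι → ℕ) (Φ γ : ∀ i, Block (m i) → ℝ)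
    (hΦ : ∀ i, pull τ (m i) (Φ i) ∈ haarSpan (C i)) (hγ : ∀ i, pull τ (m i) (γ i) ∈ haarSpan (C' i))
    (G : ∀ n, Finset (Equiv.Perm (Block n))) (hG : ∀ n, (G n).Nonempty)
    (havg : ∀ i v, ((G (m i)).card : ℝ) * γ i v = ∑ π ∈ G (m i), Φ i (π v)) :
    ‖toHardy X r (∑ i, pull τ (m i) (γ i))‖ ≤ ‖toHardy X r (∑ i, pull τ (m i) (Φ i))‖ := by
  classical
  let M : Finset ℕ := Finset.univ.image m
  have hM : ∀ i, m i ∈ M := fun i => Finset.mem_image_of_mem m (Finset.mem_univ i)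
  let U : Type := ∀ n : M, G n
  have : ∀ n : M, Nonempty (G n) := fun n => (hG n).to_subtype
  let D : U → ∀ n, Block n → Block n := fun u n => if h : n ∈ M then (u ⟨n, h⟩ : Equiv.Perm _) else id
  have hD : ∀ u n, (blockMeasure n).map (D u n) = blockMeasure n := by
    intro u n
    by_cases h : n ∈ M
    · simp only [D, dif_pos h]; exact map_perm_blockMeasure _
    · simp only [D, dif_neg h]; exact Measure.map_id
  refine norm_sum_le_of_average X r hC hC' hΦ hγ (U := U)
    (fun u i => pull τ (m i) (Φ i ∘ D u (m i)))
    (fun u => jointLaw_pull_comp hτ (N := id) Function.injective_id (D u) (hD u) m Φ) fun i => ?_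
  rw [← map_smul, ← map_sum]
  congr 1
  funext v
  have hcard : ((G (m i)).card : ℝ) ≠ 0 := by exact_mod_cast (hG (m i)).card_pos.ne'
  apply mul_left_cancel₀ hcard
  have h := card_mul_sum_pi (G := fun n : M => G n) ⟨m i, hM i⟩
    fun g => Φ i ((g : Equiv.Perm (Block (m i))) v)
  simp only [Fintype.card_coe] at h
  rw [Finset.sum_coe_sort (G (m i)) fun g => Φ i (g v), ← havg i v] at h
  rw [Pi.smul_apply, smul_eq_mul, Finset.sum_apply]
  simp only [Function.comp_apply, D, dif_pos (hM i)]
  calc _ = (Fintype.card U : ℝ) * (((G (m i)).card : ℝ) * γ i v) := by ring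
    _ = _ := h.symm

lemma sum_smul_omegaHaar_eq_pull (hτ : IsFrequencies τ) {R : Finset DyadicOmega} {n : ℕ}
    (hR : ∀ q ∈ R, q.n = n) (a : DyadicOmega → ℝ) :
    ∑ q ∈ R, a q • omegaHaar τ q = pull τ n fun v => ∑ q ∈ R, a q * seqHaar q.I (pad v) := by
  have h1 : (fun v : Block n => ∑ q ∈ R, a q * seqHaar q.I (pad v))
      = ∑ q ∈ R, a q • fun v : Block n => seqHaar q.I (pad v) := by
    funext v
    simp [Finset.sum_apply]
  rw [h1, map_sum]
  refine Finset.sum_congr rfl fun q hq => ?_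
  obtain rfl := hR q hq
  rw [map_smul, omegaHaar, hOmega_eq_pull hτ q.le]
  rfl

lemma block_kernel {n : ℕ} (v w : Block n) :
    1 + ∑ I ∈ intervalsBelow (n + 1), 2 ^ I.1 * blockHaar n I v * blockHaar n I w
      = if v = w then (2 : ℝ) ^ (n + 1) else 0 := by
  simp only [blockHaar, haar_kernel_intervalsBelow, prefixIndex_pad_eq_iff]

end Frequencies

/-! ### The joint law of a faithful Haar system -/

namespace FaithfulBlocks

variable {τ : ℕ → Finset ℕ} {b : DyadicOmega → H}

lemma b_eq_pull (F : FaithfulBlocks τ b) (hτ : IsFrequencies τ) (p : DyadicOmega) :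
    b p = pull τ (F.N p.n) (blockHaar p.n p.I ∘ F.D p.n) := by
  rw [F.b_eq, sum_smul_omegaHaar_eq_pull hτ (F.n_eq p)]
  congr 1
  funext v
  exact F.D_eq p v

lemma sum_blockHaar_D (F : FaithfulBlocks τ b) {n : ℕ} {I : DyadicInterval} (hI : I.1 ≤ n) :
    ∑ v, blockHaar n I (F.D n v) = 0 := by
  have h : ∀ v, blockHaar n I (F.D n v)
      = ∑ q ∈ F.R ⟨n, I, hI⟩, F.θ ⟨n, I, hI⟩ q * seqHaar q.I (pad v) :=
    fun v => (F.D_eq ⟨n, I, hI⟩ v).symm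
  simp only [h]
  rw [Finset.sum_comm]
  refine Finset.sum_eq_zero fun q hq => ?_
  have hq' : q.I.1 ≤ F.N n := by
    have := q.le
    rwa [F.n_eq _ q hq] at this
  rw [← Finset.mul_sum, sum_seqHaar_pad hq', mul_zero]

/-- All fibres of `D n` have the same cardinality, since the indicator function of a fibre is a
combination of `1` and of functions with mean zero. -/
lemma card_fiber (F : FaithfulBlocks τ b) (n : ℕ) (w : Block n) :
    (2 : ℝ) ^ (n + 1) * (Finset.univ.filter fun v => F.D n v = w).card = 2 ^ (F.N n + 1) := by
  calc (2 : ℝ) ^ (n + 1) * (Finset.univ.filter fun v => F.D n v = w).card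
      = ∑ v, if F.D n v = w then (2 : ℝ) ^ (n + 1) else 0 := by
        rw [← Finset.sum_filter, Finset.sum_const, nsmul_eq_mul, mul_comm]
    _ = ∑ v : Block (F.N n), (1 + ∑ I ∈ intervalsBelow (n + 1),
          2 ^ I.1 * blockHaar n I (F.D n v) * blockHaar n I w) := by
        simp only [block_kernel]
    _ = 2 ^ (F.N n + 1) := by
        have h0 : ∑ v : Block (F.N n), ∑ I ∈ intervalsBelow (n + 1),
            2 ^ I.1 * blockHaar n I (F.D n v) * blockHaar n I w = 0 := by
          rw [Finset.sum_comm]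
          refine Finset.sum_eq_zero fun I hI => ?_
          have hI' := mem_intervalsBelow.1 hI
          rw [← Finset.sum_mul, ← Finset.mul_sum, F.sum_blockHaar_D (by omega)]
          ring
        rw [Finset.sum_add_distrib, h0, add_zero, Finset.sum_const, Finset.card_univ, nsmul_eq_mul,
          mul_one, card_block]

/-- The families `(b_I^n)` and `(h_I^n)` have the same joint law. -/
lemma jointLaw_eq (F : FaithfulBlocks τ b) (hτ : IsFrequencies τ) {ι : Type*}
    (e : ι → DyadicOmega) (a : ι → ℝ) :
    jointLaw (fun i => a i • b (e i)) = jointLaw fun i => a i • omegaHaar τ (e i) := by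
  have h := jointLaw_pull_comp hτ F.N_injective F.D
    (fun n => map_blockMeasure _ (F.card_fiber n)) (fun i => (e i).n)
    fun i => a i • blockHaar (e i).n (e i).I
  have h1 : ∀ i, a i • b (e i) = pull τ (F.N (e i).n) ((a i • blockHaar (e i).n (e i).I) ∘
      F.D (e i).n) := by
    intro i
    rw [F.b_eq_pull hτ, ← map_smul]
    rfl
  have h2 : ∀ i, a i • omegaHaar τ (e i) = pull τ (e i).n (a i • blockHaar (e i).n (e i).I) := by
    intro i
    rw [omegaHaar, hOmega_eq_pull hτ (e i).le, ← map_smul]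
  simp only [h1, h2]
  exact h

lemma pairing_b (F : FaithfulBlocks τ b) (hτ : IsFrequencies τ) (p q : DyadicOmega) :
    pairing (b p) (b q) = pairing (omegaHaar τ p) (omegaHaar τ q) := by
  have := pairing_eq_of_jointLaw_eq (F.jointLaw_eq hτ (fun b : Bool => if b then p else q)
    fun _ => 1) true false
  simpa using this

lemma pairing_b_self (F : FaithfulBlocks τ b) (hτ : IsFrequencies τ) (p : DyadicOmega) :
    pairing (b p) (b p) = p.I.length := by
  rw [F.pairing_b hτ, pairing_hOmega_self hτ]

lemma pairing_b_of_ne (F : FaithfulBlocks τ b) (hτ : IsFrequencies τ) {p q : DyadicOmega}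
    (hpq : p ≠ q) : pairing (b p) (b q) = 0 := by
  rw [F.pairing_b hτ, pairing_hOmega_of_ne hτ hpq]

lemma pairing_b_omegaHaar (F : FaithfulBlocks τ b) (hτ : IsFrequencies τ) {p q : DyadicOmega}
    (hq : q ∉ F.R p) : pairing (b p) (omegaHaar τ q) = 0 := by
  rw [F.b_eq, pairing_comm, ← pairingLin_apply, map_sum]
  refine Finset.sum_eq_zero fun q' hq' => ?_
  rw [map_smul, pairingLin_apply, pairing_hOmega_of_ne hτ, smul_zero]
  rintro rfl
  exact hq hq'

lemma R_nonempty (F : FaithfulBlocks τ b) (hτ : IsFrequencies τ) (p : DyadicOmega) :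
    (F.R p).Nonempty := by
  rw [Finset.nonempty_iff_ne_empty]
  intro h
  have h1 := F.pairing_b_self hτ p
  have h2 : b p = 0 := by rw [F.b_eq, h, Finset.sum_empty]
  rw [h2, ← pairingLin_apply, map_zero] at h1
  exact (length_pos p.I).ne h1

lemma omegaHaar_eq_zero_or (F : FaithfulBlocks τ b) (hτ : IsFrequencies τ) {p q q' : DyadicOmega}
    (hq : q ∈ F.R p) (hq' : q' ∈ F.R p) (hne : q ≠ q') (s : ℝ) :
    (omegaHaar τ q : ℝ → ℝ) s = 0 ∨ (omegaHaar τ q' : ℝ → ℝ) s = 0 := by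
  by_contra hcon
  push Not at hcon
  by_cases hs : s ∈ Ico (0 : ℝ) 1
  · have hn : q.n = q'.n := (F.n_eq p q hq).trans (F.n_eq p q' hq').symm
    -- a point whose first digits are the digits of `s` in the block
    obtain ⟨t, ht, htv⟩ := exists_bits_eq_pad (blockBits τ q.n s)
    have key : ∀ q₁ : DyadicOmega, q₁.n = q.n → (omegaHaar τ q₁ : ℝ → ℝ) s ≠ 0 →
        t ∈ q₁.I.toSet := by
      intro q₁ h1 h2
      rw [omegaHaar, hOmega_eq_pull hτ q₁.le, pull_apply τ _ hs, blockHaar,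
        seqHaar_ne_zero_iff, h1, ← htv] at h2
      exact (mem_toSet_iff_prefixIndex ht _).2 h2
    exact Set.disjoint_left.1 (F.sep p q hq q' hq' hne) (key q rfl hcon.1) (key q' hn.symm hcon.2)
  · exact hcon.1 (eq_zero_of_mem_H (omegaHaar τ q).2 hs)

lemma isBlockFamily_R (F : FaithfulBlocks τ b) (hτ : IsFrequencies τ) {ι : Type*}
    {e : ι → DyadicOmega} (he : Function.Injective e) :
    IsBlockFamily fun i => (F.R (e i)).biUnion (collection τ) :=
  isBlockFamily_biUnion hτ (fun _ => F.R_nonempty hτ _) (fun _ _ hij => F.disj _ _ (he.ne hij))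
    fun _ _ hp _ hq hpq s => F.omegaHaar_eq_zero_or hτ hp hq hpq s

/-- The map `h_I^n ↦ b_I^n` preserves the norm. -/
lemma norm_sum_b (F : FaithfulBlocks τ b) (hτ : IsFrequencies τ) (X : HaarSystemNorm)
    (r : rademacherFamilies) (a : DyadicOmega → ℝ) (S : Finset DyadicOmega) :
    ‖toHardy X r (∑ p ∈ S, a p • b p)‖ = ‖toHardy X r (∑ p ∈ S, a p • omegaHaar τ p)‖ := by
  classical
  have h := norm_sum_eq_of_jointLaw_eq X r (ι := S)
    (F.isBlockFamily_R hτ Subtype.val_injective)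
    (isBlockFamily_collection hτ Subtype.val_injective)
    (f := fun p => a p • b p) (g := fun p => a p • omegaHaar τ p)
    (fun p => Submodule.smul_mem _ _ (by
      rw [F.b_eq]
      exact sum_mem_haarSpan_biUnion _ _))
    (fun p => Submodule.smul_mem _ _ (omegaHaar_mem_haarSpan _)) (F.jointLaw_eq hτ _ _)
  rwa [Finset.sum_coe_sort S fun p => a p • b p,
    Finset.sum_coe_sort S fun p => a p • omegaHaar τ p] at h

/-! ### The projection onto the span of a faithful Haar system -/

/-- The function on the values of the block `n` that corresponds to `b p`, if `n = N p.n`. -/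
def blockFun (F : FaithfulBlocks τ b) (n : ℕ) (p : DyadicOmega) : Block n → ℝ := fun v =>
  ∑ q ∈ F.R p, F.θ p q * seqHaar q.I (pad v)

/-- The values of all functions `b p` that depend on the block `n`. -/
def blockValues (F : FaithfulBlocks τ b) (n : ℕ) (v : Block n) : DyadicOmega → ℝ := fun p =>
  if F.N p.n = n then F.blockFun n p v else 0

lemma b_eq_pull_blockFun (F : FaithfulBlocks τ b) (hτ : IsFrequencies τ) {n : ℕ} {p : DyadicOmega}
    (hp : F.N p.n = n) : b p = pull τ n (F.blockFun n p) := by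
  rw [F.b_eq, sum_smul_omegaHaar_eq_pull hτ fun q hq => (F.n_eq p q hq).trans hp]
  rfl

lemma blockFun_eq (F : FaithfulBlocks τ b) (p : DyadicOmega) (v : Block (F.N p.n)) :
    F.blockFun (F.N p.n) p v = blockHaar p.n p.I (F.D p.n v) := F.D_eq p v

lemma blockValues_eq_iff (F : FaithfulBlocks τ b) (k : ℕ) (v w : Block (F.N k)) :
    F.blockValues (F.N k) v = F.blockValues (F.N k) w ↔ F.D k v = F.D k w := by
  constructor
  · intro h
    have hI : ∀ I ∈ intervalsBelow (k + 1), blockHaar k I (F.D k v) = blockHaar k I (F.D k w) := by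
      intro I hI
      have hI' : I.1 ≤ k := by have := mem_intervalsBelow.1 hI; omega
      have h1 := congrFun h ⟨k, I, hI'⟩
      simp only [blockValues, if_true] at h1
      rwa [F.blockFun_eq ⟨k, I, hI'⟩ v, F.blockFun_eq ⟨k, I, hI'⟩ w] at h1
    have h2 := block_kernel (F.D k v) (F.D k w)
    rw [Finset.sum_congr rfl fun I hI' => by rw [hI I hI'], block_kernel, if_pos rfl] at h2
    by_contra hne
    rw [if_neg hne] at h2
    exact (pow_ne_zero _ two_ne_zero) h2
  · intro h
    funext p
    simp only [blockValues]
    split_ifs with hp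
    · obtain rfl : p.n = k := F.N_injective hp
      rw [F.blockFun_eq, F.blockFun_eq, h]
    · rfl

/-- A function on the values of a block that has mean zero and is orthogonal to all `b p` has mean
zero on the sets on which all `b p` are constant. -/
lemma sum_fiber_eq_zero (F : FaithfulBlocks τ b) {n : ℕ} {z : Block n → ℝ} (hz : ∑ v, z v = 0)
    (horth : ∀ p : DyadicOmega, F.N p.n = n → ∑ v, z v * F.blockFun n p v = 0) (v : Block n)
    [DecidableEq (DyadicOmega → ℝ)] :
    ∑ v' ∈ Finset.univ.filter (fun v' => F.blockValues n v' = F.blockValues n v), z v' = 0 := by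
  by_cases hn : ∃ k, F.N k = n
  · obtain ⟨k, rfl⟩ := hn
    simp only [F.blockValues_eq_iff]
    have h1 : (2 : ℝ) ^ (k + 1) * ∑ v' ∈ Finset.univ.filter (fun v' => F.D k v' = F.D k v), z v'
        = ∑ v', z v' * if F.D k v' = F.D k v then (2 : ℝ) ^ (k + 1) else 0 := by
      rw [Finset.sum_filter, Finset.mul_sum]
      refine Finset.sum_congr rfl fun v' _ => ?_
      split_ifs <;> ring
    have h0 : ∑ v' : Block (F.N k), ∑ I ∈ intervalsBelow (k + 1),
        z v' * (2 ^ I.1 * blockHaar k I (F.D k v') * blockHaar k I (F.D k v)) = 0 := by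
      rw [Finset.sum_comm]
      refine Finset.sum_eq_zero fun I hI => ?_
      have hI' : I.1 ≤ k := by have := mem_intervalsBelow.1 hI; omega
      have h2 := horth ⟨k, I, hI'⟩ rfl
      simp only [F.blockFun_eq ⟨k, I, hI'⟩] at h2
      calc _ = (2 ^ I.1 * blockHaar k I (F.D k v)) *
            ∑ v', z v' * blockHaar k I (F.D k v') := by
            rw [Finset.mul_sum]; exact Finset.sum_congr rfl fun v' _ => by ring
        _ = 0 := by rw [h2, mul_zero]
    simp only [← block_kernel, mul_add, mul_one, Finset.sum_add_distrib, hz, zero_add] at h1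
    rw [Finset.sum_congr rfl fun v' _ => Finset.mul_sum _ _ (z v'), h0] at h1
    exact (mul_eq_zero.1 h1).resolve_left (pow_ne_zero _ two_ne_zero)
  · have h0 : ∀ v', F.blockValues n v' = F.blockValues n v := by
      intro v'
      funext p
      simp only [blockValues]
      rw [if_neg fun h => hn ⟨_, h⟩, if_neg fun h => hn ⟨_, h⟩]
    simp [h0, hz]

end FaithfulBlocks

namespace FaithfulBlocks

variable {τ : ℕ → Finset ℕ} {b : DyadicOmega → H}

open scoped Classical in
/-- The index `p` of the function `b p` in which `h q` occurs, or `q` itself if there is no such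
function. -/
def owner (F : FaithfulBlocks τ b) (q : DyadicOmega) : DyadicOmega ⊕ DyadicOmega :=
  if h : ∃ p, q ∈ F.R p then Sum.inl h.choose else Sum.inr q

/-- The indices with a given owner. -/
def ownedBy (F : FaithfulBlocks τ b) : DyadicOmega ⊕ DyadicOmega → Finset DyadicOmega :=
  Sum.elim F.R fun q => {q}

/-- The number of the block on which the functions with a given owner depend. -/
def blockOf (F : FaithfulBlocks τ b) : DyadicOmega ⊕ DyadicOmega → ℕ :=
  Sum.elim (fun p => F.N p.n) DyadicOmega.n

lemma owner_eq_inl (F : FaithfulBlocks τ b) {p q : DyadicOmega} (hq : q ∈ F.R p) :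
    F.owner q = Sum.inl p := by
  have h : ∃ p, q ∈ F.R p := ⟨p, hq⟩
  rw [owner, dif_pos h]
  congr 1
  by_contra hne
  exact Finset.disjoint_left.1 (F.disj _ _ hne) h.choose_spec hq

lemma mem_ownedBy_owner (F : FaithfulBlocks τ b) (q : DyadicOmega) : q ∈ F.ownedBy (F.owner q) := by
  by_cases h : ∃ p, q ∈ F.R p
  · obtain ⟨p, hp⟩ := h
    rw [F.owner_eq_inl hp]
    exact hp
  · rw [owner, dif_neg h]
    exact Finset.mem_singleton_self q

lemma owner_eq_of_mem (F : FaithfulBlocks τ b) {i : DyadicOmega ⊕ DyadicOmega}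
    (hi : ∃ q, F.owner q = i) {q : DyadicOmega} (hq : q ∈ F.ownedBy i) : F.owner q = i := by
  cases i with
  | inl p => exact F.owner_eq_inl hq
  | inr q' =>
    obtain ⟨q'', hq''⟩ := hi
    obtain rfl : q = q' := Finset.mem_singleton.1 hq
    by_cases h : ∃ p, q'' ∈ F.R p
    · obtain ⟨p, hp⟩ := h
      rw [F.owner_eq_inl hp] at hq''
      exact absurd hq'' (by simp)
    · have h2 := hq''
      rw [owner, dif_neg h] at h2
      obtain rfl := Sum.inr.inj h2
      exact hq''

lemma n_eq_blockOf (F : FaithfulBlocks τ b) {i : DyadicOmega ⊕ DyadicOmega} {q : DyadicOmega}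
    (hq : q ∈ F.ownedBy i) : q.n = F.blockOf i := by
  cases i with
  | inl p => exact F.n_eq p q hq
  | inr q' => rw [Finset.mem_singleton.1 hq]; rfl

lemma isBlockFamily_ownedBy (F : FaithfulBlocks τ b) (hτ : IsFrequencies τ)
    {T : Set (DyadicOmega ⊕ DyadicOmega)} (hT : ∀ i ∈ T, ∃ q, F.owner q = i) :
    IsBlockFamily fun i : T => (F.ownedBy i).biUnion (collection τ) := by
  refine isBlockFamily_biUnion hτ ?_ ?_ ?_
  · rintro ⟨i, hi⟩
    obtain ⟨q, rfl⟩ := hT i hi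
    exact ⟨q, F.mem_ownedBy_owner q⟩
  · intro i j hij
    rw [Finset.disjoint_left]
    intro q hq hq'
    refine hij (Subtype.ext ?_)
    rw [← F.owner_eq_of_mem (hT i i.2) hq, ← F.owner_eq_of_mem (hT j j.2) hq']
  · rintro ⟨i | i, hi⟩ p hp q hq hpq s
    · exact F.omegaHaar_eq_zero_or hτ hp hq hpq s
    · exact absurd ((Finset.mem_singleton.1 hp).trans (Finset.mem_singleton.1 hq).symm) hpq

/-- The coefficients of `∑ c p • b p`, sorted by owners. -/
def coeff (F : FaithfulBlocks τ b) (c : DyadicOmega → ℝ) :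
    DyadicOmega ⊕ DyadicOmega → DyadicOmega → ℝ :=
  Sum.elim (fun p q => c p * F.θ p q) fun _ _ => 0

lemma sum_coeff_inl (F : FaithfulBlocks τ b) (c : DyadicOmega → ℝ) (p : DyadicOmega) :
    ∑ q ∈ F.ownedBy (Sum.inl p), F.coeff c (Sum.inl p) q • omegaHaar τ q = c p • b p := by
  rw [F.b_eq, Finset.smul_sum]
  exact Finset.sum_congr rfl fun q _ => mul_smul _ _ _

lemma sum_coeff_inr (F : FaithfulBlocks τ b) (c : DyadicOmega → ℝ) (q' : DyadicOmega) :
    ∑ q ∈ F.ownedBy (Sum.inr q'), F.coeff c (Sum.inr q') q • omegaHaar τ q = 0 :=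
  Finset.sum_eq_zero fun _ _ => zero_smul _ _

/-- The part of `x = ∑ a q • h q` that belongs to one owner and its projection onto the span of the
`b p` have the same average over each set on which the `b p` are constant. -/
lemma sum_fiber_eq (F : FaithfulBlocks τ b) (hτ : IsFrequencies τ) {a c : DyadicOmega → ℝ}
    {i : DyadicOmega ⊕ DyadicOmega}
    (hpair : ∀ p, pairing (b p) (∑ q ∈ F.ownedBy i, a q • omegaHaar τ q)
      = pairing (b p) (∑ q ∈ F.ownedBy i, F.coeff c i q • omegaHaar τ q))
    [DecidableEq (DyadicOmega → ℝ)] (v : Block (F.blockOf i)) :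
    ∑ v' ∈ (Finset.univ.filter fun v' : Block (F.blockOf i) =>
        F.blockValues (F.blockOf i) v' = F.blockValues (F.blockOf i) v),
        ∑ q ∈ F.ownedBy i, a q * seqHaar q.I (pad v')
      = (Finset.univ.filter fun v' : Block (F.blockOf i) =>
        F.blockValues (F.blockOf i) v' = F.blockValues (F.blockOf i) v).card *
        ∑ q ∈ F.ownedBy i, F.coeff c i q * seqHaar q.I (pad v) := by
  have hmean : ∀ α : DyadicOmega → ℝ, ∑ v : Block (F.blockOf i),
      ∑ q ∈ F.ownedBy i, α q * seqHaar q.I (pad v) = 0 := by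
    intro α
    rw [Finset.sum_comm]
    refine Finset.sum_eq_zero fun q hq => ?_
    rw [← Finset.mul_sum, sum_seqHaar_pad, mul_zero]
    rw [← F.n_eq_blockOf hq]
    exact q.le
  have h0 := F.sum_fiber_eq_zero (n := F.blockOf i)
    (z := fun v => ∑ q ∈ F.ownedBy i, a q * seqHaar q.I (pad v)
      - ∑ q ∈ F.ownedBy i, F.coeff c i q * seqHaar q.I (pad v))
    (by rw [Finset.sum_sub_distrib, hmean, hmean, sub_zero])
    (by
      intro p hp
      have h1 := hpair p
      rw [sum_smul_omegaHaar_eq_pull hτ fun q hq => F.n_eq_blockOf hq,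
        sum_smul_omegaHaar_eq_pull hτ fun q hq => F.n_eq_blockOf hq,
        F.b_eq_pull_blockFun hτ hp, pairing_pull hτ, pairing_pull hτ,
        div_left_inj' (pow_ne_zero _ two_ne_zero)] at h1
      simp only [sub_mul, Finset.sum_sub_distrib]
      rw [sub_eq_zero]
      simpa only [mul_comm] using h1)
    v
  rw [Finset.sum_sub_distrib, sub_eq_zero] at h0
  rw [h0, ← nsmul_eq_mul]
  refine Finset.sum_eq_card_nsmul fun v' hv' => ?_
  -- the projection is constant on the fibre
  have hv := (Finset.mem_filter.1 hv').2
  cases i with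
  | inl p =>
    have h1 := congrFun hv p
    simp only [blockValues, blockOf, Sum.elim_inl, if_true] at h1
    have h2 : ∀ w : Block (F.blockOf (Sum.inl p)),
        ∑ q ∈ F.ownedBy (Sum.inl p), F.coeff c (Sum.inl p) q * seqHaar q.I (pad w)
          = c p * F.blockFun (F.N p.n) p w := by
      intro w
      change _ = c p * ∑ q ∈ F.R p, F.θ p q * seqHaar q.I (pad w)
      rw [Finset.mul_sum]
      exact Finset.sum_congr rfl fun q _ => mul_assoc _ _ _
    rw [h2, h2]
    congr 1
  | inr q' => simp [coeff]

/-- The orthogonal projection onto the span of the `b p` is a contraction. -/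
theorem norm_projection_le (F : FaithfulBlocks τ b) (hτ : IsFrequencies τ) (X : HaarSystemNorm)
    (r : rademacherFamilies) (a : DyadicOmega → ℝ) {Q P : Finset DyadicOmega}
    (ha : ∀ q ∉ Q, a q = 0) (hP : ∀ p ∉ P, pairing (b p) (∑ q ∈ Q, a q • omegaHaar τ q) = 0) :
    ‖toHardy X r (∑ p ∈ P,
        (pairing (b p) (∑ q ∈ Q, a q • omegaHaar τ q) / p.I.length) • b p)‖
      ≤ ‖toHardy X r (∑ q ∈ Q, a q • omegaHaar τ q)‖ := by
  classical
  set x := ∑ q ∈ Q, a q • omegaHaar τ q with hx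
  set c : DyadicOmega → ℝ := fun p => pairing (b p) x / p.I.length with hc
  let T : Finset (DyadicOmega ⊕ DyadicOmega) := Q.image F.owner
  have hT : ∀ i ∈ T, ∃ q, F.owner q = i := by
    intro i hi
    obtain ⟨q, -, hq⟩ := Finset.mem_image.1 hi
    exact ⟨q, hq⟩
  let f : DyadicOmega ⊕ DyadicOmega → H := fun i => ∑ q ∈ F.ownedBy i, a q • omegaHaar τ q
  let g : DyadicOmega ⊕ DyadicOmega → H := fun i =>
    ∑ q ∈ F.ownedBy i, F.coeff c i q • omegaHaar τ q
  have hsumf : ∑ i ∈ T, f i = x := by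
    rw [← Finset.sum_biUnion]
    · symm
      refine Finset.sum_subset (fun q hq => Finset.mem_biUnion.2
        ⟨_, Finset.mem_image_of_mem _ hq, F.mem_ownedBy_owner q⟩) fun q _ hq => ?_
      rw [ha q hq, zero_smul]
    · intro i hi j hj hij
      refine Finset.disjoint_left.2 fun q hq hq' => hij ?_
      rw [← F.owner_eq_of_mem (hT i hi) hq, ← F.owner_eq_of_mem (hT j hj) hq']
  have hcT : ∀ p, Sum.inl p ∉ T → c p = 0 := by
    intro p hp
    have : pairing (b p) x = 0 := by
      rw [hx, ← pairingLin_apply, map_sum]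
      refine Finset.sum_eq_zero fun q hq => ?_
      rw [map_smul, pairingLin_apply, F.pairing_b_omegaHaar hτ, smul_zero]
      intro hqp
      exact hp (F.owner_eq_inl hqp ▸ Finset.mem_image_of_mem _ hq)
    simp only [hc, this, zero_div]
  have hsumg : ∑ i ∈ T, g i = ∑ p ∈ P, c p • b p := by
    have h1 : ∑ p ∈ P, c p • b p = ∑ i ∈ P.map Function.Embedding.inl, g i := by
      rw [Finset.sum_map]
      exact Finset.sum_congr rfl fun p _ => (F.sum_coeff_inl c p).symm
    have h2 : ∑ i ∈ T, g i = ∑ i ∈ T ∪ P.map Function.Embedding.inl, g i := by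
      refine Finset.sum_subset Finset.subset_union_left ?_
      rintro (p | q) _ hi
      · simp only [g, F.sum_coeff_inl, hcT p hi, zero_smul]
      · exact F.sum_coeff_inr c q
    have h3 : ∑ i ∈ P.map Function.Embedding.inl, g i
        = ∑ i ∈ T ∪ P.map Function.Embedding.inl, g i := by
      refine Finset.sum_subset Finset.subset_union_right ?_
      rintro (p | q) _ hi
      · have hp : p ∉ P := fun hp => hi (Finset.mem_map_of_mem _ hp)
        simp only [g, F.sum_coeff_inl, hc, hP p hp, zero_div, zero_smul]
      · exact F.sum_coeff_inr c q
    rw [h1, h2, h3]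
  -- pairing with `b p` selects the part that belongs to `p`
  have hzero : ∀ i ∈ T, ∀ p, i ≠ Sum.inl p → pairing (b p) (f i) = 0 := by
    intro i hi p hne
    rw [← pairingLin_apply, map_sum]
    refine Finset.sum_eq_zero fun q hq => ?_
    rw [map_smul, pairingLin_apply, F.pairing_b_omegaHaar hτ, smul_zero]
    intro hqp
    exact hne ((F.owner_eq_of_mem (hT i hi) hq).symm.trans (F.owner_eq_inl hqp))
  have hpair : ∀ i ∈ T, ∀ p, pairing (b p) (f i) = pairing (b p) (g i) := by
    intro i hi p
    by_cases hip : i = Sum.inl p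
    · subst hip
      have h1 : pairing (b p) x = pairing (b p) (f (Sum.inl p)) := by
        rw [← hsumf, ← pairingLin_apply, map_sum, Finset.sum_eq_single_of_mem _ hi]
        · rfl
        · intro j hj hne
          exact hzero j hj p hne
      rw [← h1]
      simp only [g, F.sum_coeff_inl]
      rw [← pairingLin_apply (b p) (c p • b p), map_smul, pairingLin_apply, F.pairing_b_self hτ,
        smul_eq_mul, hc, div_mul_cancel₀ _ (length_pos p.I).ne']
    · rw [hzero i hi p hip]
      rcases i with p' | q
      · simp only [g, F.sum_coeff_inl]
        rw [← pairingLin_apply, map_smul, pairingLin_apply, F.pairing_b_of_ne hτ, smul_zero]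
        rintro rfl
        exact hip rfl
      · simp only [g, F.sum_coeff_inr]
        rw [← pairingLin_apply, map_zero]
  have hpull : ∀ (α : DyadicOmega → ℝ) (i : DyadicOmega ⊕ DyadicOmega),
      ∑ q ∈ F.ownedBy i, α q • omegaHaar τ q
        = pull τ (F.blockOf i) fun v => ∑ q ∈ F.ownedBy i, α q * seqHaar q.I (pad v) :=
    fun α i => sum_smul_omegaHaar_eq_pull hτ (fun q hq => F.n_eq_blockOf hq) α
  have hblock := F.isBlockFamily_ownedBy hτ (T := (T : Set (DyadicOmega ⊕ DyadicOmega))) hT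
  have key := norm_sum_pull_le hτ X r (ι := T) hblock hblock (fun i => F.blockOf i)
    (fun i v => ∑ q ∈ F.ownedBy i, a q * seqHaar q.I (pad v))
    (fun i v => ∑ q ∈ F.ownedBy i, F.coeff c i q * seqHaar q.I (pad v))
    (fun i => by rw [← hpull]; exact sum_mem_haarSpan_biUnion _ _)
    (fun i => by rw [← hpull]; exact sum_mem_haarSpan_biUnion _ _)
    (fun n => Finset.univ.filter fun π : Equiv.Perm (Block n) =>
      ∀ v, F.blockValues n (π v) = F.blockValues n v)
    (fun n => ⟨1, by simp⟩)
    (by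
      intro i v
      have h1 := card_mul_sum_perm (F.blockValues (F.blockOf i))
        (fun v => ∑ q ∈ F.ownedBy i, a q * seqHaar q.I (pad v)) v
      rw [F.sum_fiber_eq hτ (hpair i i.2) v] at h1
      have hne : ((Finset.univ.filter fun v' =>
          F.blockValues (F.blockOf i) v' = F.blockValues _ v).card : ℝ) ≠ 0 := by
        have : (Finset.univ.filter fun v' =>
          F.blockValues (F.blockOf i) v' = F.blockValues _ v).Nonempty := ⟨v, by simp⟩
        exact_mod_cast this.card_pos.ne'
      apply mul_left_cancel₀ hne
      rw [h1]
      ring)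
  simp only [← hpull] at key
  rw [Finset.sum_coe_sort T f, Finset.sum_coe_sort T g, hsumf, hsumg] at key
  exact key

end FaithfulBlocks

/-! ### Coordinates in `H_ω` -/

section Frequencies

variable {τ : ℕ → Finset ℕ}

lemma linearIndependent_hBasis (hτ : IsFrequencies τ) : LinearIndependent ℝ (hBasis τ) := by
  refine linearIndependent_iff'ₛ.2 fun s f g hfg p hp => ?_
  have key : ∀ c : DyadicOmega → ℝ,
      (pairingLin (omegaHaar τ p)).domRestrict (HOmega τ) (∑ q ∈ s, c q • hBasis τ q)
        = c p * p.I.length := by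
    intro c
    rw [map_sum, Finset.sum_eq_single_of_mem p hp]
    · rw [map_smul, smul_eq_mul, ← pairing_hOmega_self hτ p]
      rfl
    · intro q _ hq
      rw [map_smul]
      change c q * pairing (omegaHaar τ p) (omegaHaar τ q) = 0
      rw [pairing_hOmega_of_ne hτ hq.symm, mul_zero]
  have h := key f
  rw [hfg, key g] at h
  exact (mul_right_cancel₀ (length_pos _).ne' h).symm

/-- The functions `h_I^n` as an algebraic basis of `H_ω`. -/
def omegaBasis (hτ : IsFrequencies τ) : Module.Basis DyadicOmega ℝ (HOmega τ) :=
  Module.Basis.mk (linearIndependent_hBasis hτ) (by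
    rintro ⟨x, hx⟩ -
    induction hx using Submodule.span_induction with
    | mem x hx =>
      obtain ⟨p, rfl⟩ := hx
      exact Submodule.subset_span ⟨p, rfl⟩
    | zero => exact Submodule.zero_mem _
    | add x y hx hy h1 h2 => exact Submodule.add_mem _ h1 h2
    | smul c x hx h1 => exact Submodule.smul_mem _ c h1)

lemma omegaBasis_apply (hτ : IsFrequencies τ) (p : DyadicOmega) :
    omegaBasis hτ p = hBasis τ p :=
  Module.Basis.mk_apply _ _ p

lemma coe_eq_sum_repr (hτ : IsFrequencies τ) (x : HOmega τ) :
    (x : H) = ∑ q ∈ ((omegaBasis hτ).repr x).support, (omegaBasis hτ).repr x q • omegaHaar τ q := by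
  conv_lhs => rw [← (omegaBasis hτ).linearCombination_repr x]
  rw [Finsupp.linearCombination_apply, Finsupp.sum, Submodule.coe_sum]
  refine Finset.sum_congr rfl fun q _ => ?_
  rw [omegaBasis_apply]
  rfl

lemma repr_eq_pairing (hτ : IsFrequencies τ) (x : HOmega τ) (p : DyadicOmega) :
    (omegaBasis hτ).repr x p = pairing (omegaHaar τ p) x / p.I.length := by
  classical
  rw [eq_div_iff (length_pos _).ne', coe_eq_sum_repr hτ x, ← pairingLin_apply, map_sum,
    Finset.sum_eq_single p]
  · rw [map_smul, pairingLin_apply, pairing_hOmega_self hτ, smul_eq_mul]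
  · intro q _ hq
    rw [map_smul, pairingLin_apply, pairing_hOmega_of_ne hτ hq.symm, smul_zero]
  · intro hp
    rw [Finsupp.notMem_support_iff.1 hp, zero_smul, map_zero]

/-- The partial sums of the expansion of an element of `H_ω` have at most the norm of this
element. -/
lemma norm_partialSum_le (hτ : IsFrequencies τ) (X : HaarSystemNorm) (r : rademacherFamilies)
    (x : HOmega τ) (p : DyadicOmega) :
    ‖toYOmega X r τ (∑ q ∈ Finset.Iic p, (omegaBasis hτ).repr x q • hBasis τ q)‖
      ≤ ‖toYOmega X r τ x‖ := by
  have h := norm_sum_filter_le hτ X r ((omegaBasis hτ).repr x) p ((omegaBasis hτ).repr x).support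
  rw [← coe_eq_sum_repr hτ x] at h
  refine le_of_eq_of_le ?_ h
  change ‖toHardy X r ((∑ q ∈ Finset.Iic p, (omegaBasis hτ).repr x q • hBasis τ q : HOmega τ) : H)‖
    = _
  rw [Submodule.coe_sum]
  congr 2
  symm
  refine Finset.sum_subset (fun q hq => Finset.mem_Iic.2 (Finset.mem_filter.1 hq).2)
    fun q hq hq' => ?_
  have : (omegaBasis hτ).repr x q = 0 := by
    by_contra hne
    exact hq' (Finset.mem_filter.2 ⟨Finsupp.mem_support_iff.2 hne, Finset.mem_Iic.1 hq⟩)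
  rw [this, zero_smul]

/-- The functions `h_I^n` do not vanish in `X(r)`. -/
lemma norm_toHardy_omegaHaar_pos (hτ : IsFrequencies τ) (X : HaarSystemNorm)
    (r : rademacherFamilies) (p : DyadicOmega) : 0 < ‖toHardy X r (omegaHaar τ p)‖ := by
  refine lt_of_le_of_ne (norm_nonneg _) fun h0 => ?_
  rw [norm_toHardy] at h0
  have hzero : ∀ s, hardyFun r (omegaHaar τ p) s = 0 := fun s =>
    congrFun (congrArg Subtype.val (X.definite _ h0.symm)) s
  have hC := isBlockFamily_collection hτ (e := fun _ : Unit => p) fun _ _ _ => rfl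
  have hvanish : ∀ s, (omegaHaar τ p : ℝ → ℝ) s = 0 := by
    intro s
    obtain ⟨K, -, hK⟩ := exists_randomized_eq (hC.nonempty ()) (hC.sep ()) r
      (omegaHaar_mem_haarSpan p) s
    have h1 : ∫ u, |randomized r (omegaHaar τ p) u s| ∂unitMeasure
        = ∫ _, |(omegaHaar τ p : ℝ → ℝ) s| ∂unitMeasure := by
      refine integral_congr_ae (ae_mem_unit.mono fun u hu => ?_)
      have hr : |r.1 (some K) u| = 1 := by
        rcases r.2 with h | h
        · rw [h]
          exact (congrArg abs (rademacher_eq_sgn hu _)).trans (abs_sgn _)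
        · rw [mem_singleton_iff.1 h]
          exact (congrArg abs (rademacher_eq_sgn hu _)).trans (abs_sgn _)
      simp only [hK, abs_mul, hr, one_mul]
    rw [← intervalIntegral_eq_unitMeasure] at h1
    have h2 := (hzero s).symm.trans h1
    simpa using h2.symm
  have := pairing_hOmega_self hτ p
  rw [pairing_eq] at this
  simp only [hvanish, mul_zero, integral_zero] at this
  exact (length_pos p.I).ne this

lemma denseRange_toYOmega (X : HaarSystemNorm) (r : rademacherFamilies) :
    DenseRange (toYOmega X r τ) := by
  intro y
  have hy := y.2
  change (y : HardySpace X r) ∈ closure _ at hy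
  rw [closure_subtype]
  refine closure_mono ?_ hy
  rintro _ ⟨x, hx, rfl⟩
  exact ⟨toYOmega X r τ ⟨x, hx⟩, ⟨_, rfl⟩, rfl⟩

instance (X : HaarSystemNorm) (r : rademacherFamilies) : CompleteSpace (YOmega X r τ) :=
  (Submodule.isClosed_topologicalClosure _).completeSpace_coe

lemma exists_extension {E Y F : Type*} [AddCommGroup E] [Module ℝ E] [SeminormedAddCommGroup Y]
    [NormedSpace ℝ Y] [NormedAddCommGroup F] [NormedSpace ℝ F] [CompleteSpace F] {e : E →ₗ[ℝ] Y}
    (he : DenseRange e) (f : E →ₗ[ℝ] F) {C : ℝ} (hf : ∀ x, ‖f x‖ ≤ C * ‖e x‖) :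
    ∃ g : Y →L[ℝ] F, (∀ x, g (e x) = f x) ∧ ∀ y, ‖g y‖ ≤ C * ‖y‖ :=
  ⟨f.extendOfNorm e, LinearMap.extendOfNorm_eq he ⟨C, hf⟩,
    LinearMap.norm_extendOfNorm_apply_le he C hf⟩

/-- Bounded linear maps on `H_ω` extend to `Y_ω`. -/
lemma exists_extension_YOmega (X : HaarSystemNorm) (r : rademacherFamilies) {F : Type*}
    [NormedAddCommGroup F] [NormedSpace ℝ F] [CompleteSpace F] (f : HOmega τ →ₗ[ℝ] F) {C : ℝ}
    (hf : ∀ x, ‖f x‖ ≤ C * ‖toYOmega X r τ x‖) :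
    ∃ g : YOmega X r τ →L[ℝ] F, (∀ x, g (toYOmega X r τ x) = f x) ∧ ∀ y, ‖g y‖ ≤ C * ‖y‖ := by
  -- the instances are given explicitly, since their unification is slow
  have := @exists_extension (HOmega τ) (YOmega X r τ) F (HOmega τ).addCommGroup (HOmega τ).module
    _ _ _ _ _ (toYOmega X r τ) (denseRange_toYOmega X r) f C hf
  exact this

/-- The coordinate projections are bounded, being differences of two partial sums. -/
lemma norm_repr_smul_le (hτ : IsFrequencies τ) (X : HaarSystemNorm) (r : rademacherFamilies)
    (x : HOmega τ) (p : DyadicOmega) :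
    ‖toYOmega X r τ ((omegaBasis hτ).repr x p • hBasis τ p)‖ ≤ 2 * ‖toYOmega X r τ x‖ := by
  classical
  have h1 := norm_partialSum_le hτ X r x p
  have h2 : ‖toYOmega X r τ (∑ q ∈ Finset.Iio p, (omegaBasis hτ).repr x q • hBasis τ q)‖
      ≤ ‖toYOmega X r τ (∑ q ∈ Finset.Iic p, (omegaBasis hτ).repr x q • hBasis τ q)‖ := by
    have h := norm_sum_le_norm_sum_insert hτ X r ((omegaBasis hτ).repr x) (p := p)
      (S := Finset.Iio p) fun q hq => Finset.mem_Iio.1 hq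
    rw [Finset.Iio_insert] at h
    have hcoe : ∀ S : Finset DyadicOmega,
        ((∑ q ∈ S, (omegaBasis hτ).repr x q • hBasis τ q : HOmega τ) : H)
          = ∑ q ∈ S, (omegaBasis hτ).repr x q • omegaHaar τ q := fun S => Submodule.coe_sum _ _ _
    rw [← hcoe, ← hcoe] at h
    exact h
  have h3 : toYOmega X r τ ((omegaBasis hτ).repr x p • hBasis τ p)
        + toYOmega X r τ (∑ q ∈ Finset.Iio p, (omegaBasis hτ).repr x q • hBasis τ q)
      = toYOmega X r τ (∑ q ∈ Finset.Iic p, (omegaBasis hτ).repr x q • hBasis τ q) := by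
    rw [← map_add, ← Finset.Iio_insert, Finset.sum_insert (by simp)]
  rw [eq_sub_of_add_eq h3]
  refine (norm_sub_le _ _).trans ?_
  linarith

/-- The functional `x ↦ ⟨h_I^n, x⟩` extends to `Y_ω`. -/
lemma exists_coordinate (hτ : IsFrequencies τ) (X : HaarSystemNorm) (r : rademacherFamilies)
    (p : DyadicOmega) : ∃ φ : YOmega X r τ →L[ℝ] ℝ,
      ∀ x : HOmega τ, φ (toYOmega X r τ x) = pairing (omegaHaar τ p) x := by
  have hbound : ∀ x : HOmega τ, ‖(pairingLin (omegaHaar τ p)).domRestrict (HOmega τ) x‖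
      ≤ p.I.length * 2 / ‖toHardy X r (omegaHaar τ p)‖ * ‖toYOmega X r τ x‖ := by
    intro x
    have hpos := norm_toHardy_omegaHaar_pos hτ X r p
    have h : ‖pairing (omegaHaar τ p) x / p.I.length‖ * ‖toHardy X r (omegaHaar τ p)‖
        ≤ 2 * ‖toYOmega X r τ x‖ := by
      have := norm_repr_smul_le hτ X r x p
      rwa [map_smul, norm_smul, repr_eq_pairing] at this
    rw [norm_div, Real.norm_of_nonneg (length_pos p.I).le, div_mul_eq_mul_div,
      div_le_iff₀ (length_pos p.I)] at h
    rw [div_mul_eq_mul_div, le_div_iff₀ hpos]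
    calc _ ≤ _ := h
      _ = _ := by ring
  obtain ⟨φ, hφ, -⟩ := exists_extension_YOmega X r
    ((pairingLin (omegaHaar τ p)).domRestrict (HOmega τ)) hbound
  exact ⟨φ, hφ⟩

/-- Every element of `Y_ω` is the sum of its expansion with respect to the `h_I^n`. -/
lemma hasOrderedSum_coordinate (hτ : IsFrequencies τ) (X : HaarSystemNorm) (r : rademacherFamilies)
    {φ : DyadicOmega → YOmega X r τ →L[ℝ] ℝ}
    (hφ : ∀ p (x : HOmega τ), φ p (toYOmega X r τ x) = pairing (omegaHaar τ p) x)
    (y : YOmega X r τ) :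
    HasOrderedSum (fun p => (φ p y / p.I.length) • toYOmega X r τ (hBasis τ p)) y := by
  let S : DyadicOmega → YOmega X r τ →L[ℝ] YOmega X r τ := fun p => ∑ q ∈ Finset.Iic p,
    ((q.I.length)⁻¹ • φ q).smulRight (toYOmega X r τ (hBasis τ q))
  have hS : ∀ p y, S p y = ∑ q ∈ Finset.Iic p,
      (φ q y / q.I.length) • toYOmega X r τ (hBasis τ q) := by
    intro p y
    simp only [S, sum_apply, ContinuousLinearMap.smulRight_apply, smul_apply, smul_eq_mul]
    refine Finset.sum_congr rfl fun q _ => ?_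
    rw [div_eq_inv_mul]
  have hSto : ∀ p x, S p (toYOmega X r τ x)
      = toYOmega X r τ (∑ q ∈ Finset.Iic p, (omegaBasis hτ).repr x q • hBasis τ q) := by
    intro p x
    rw [hS, map_sum]
    refine Finset.sum_congr rfl fun q _ => ?_
    rw [map_smul, repr_eq_pairing, hφ]
  have hnorm : ∀ p y, ‖S p y‖ ≤ ‖y‖ := by
    intro p y
    induction y using (denseRange_toYOmega (τ := τ) X r).induction_on with
    | hp => exact isClosed_le (S p).continuous.norm continuous_norm
    | ih x =>
      rw [hSto]
      exact norm_partialSum_le hτ X r x p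
  have hev : ∀ x, ∀ᶠ p in atTop, S p (toYOmega X r τ x) = toYOmega X r τ x := by
    intro x
    have : Nonempty DyadicOmega := ⟨⟨0, root, le_rfl⟩⟩
    obtain ⟨m, hm⟩ := ((omegaBasis hτ).repr x).support.exists_le
    filter_upwards [eventually_ge_atTop m] with p hp
    rw [hSto]
    congr 1
    conv_rhs => rw [← (omegaBasis hτ).linearCombination_repr x]
    rw [Finsupp.linearCombination_apply, Finsupp.sum]
    simp only [omegaBasis_apply]
    symm
    refine Finset.sum_subset (fun q hq => Finset.mem_Iic.2 ((hm q hq).trans hp)) fun q _ hq => ?_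
    rw [Finsupp.notMem_support_iff.1 hq, zero_smul]
  unfold HasOrderedSum
  simp only [← hS]
  rw [Metric.tendsto_nhds]
  intro ε hε
  obtain ⟨x, hx⟩ := Metric.denseRange_iff.1 (denseRange_toYOmega (τ := τ) X r) y (ε / 2) (half_pos hε)
  filter_upwards [hev x] with p hp
  have h1 : S p y - y = S p (y - toYOmega X r τ x) + (toYOmega X r τ x - y) := by
    rw [map_sub, hp]; abel
  rw [dist_eq_norm] at hx
  rw [dist_eq_norm, h1]
  calc _ ≤ ‖S p (y - toYOmega X r τ x)‖ + ‖toYOmega X r τ x - y‖ := norm_add_le _ _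
    _ ≤ ‖y - toYOmega X r τ x‖ + ‖y - toYOmega X r τ x‖ := by
      rw [norm_sub_rev (toYOmega X r τ x)]
      exact add_le_add (hnorm _ _) le_rfl
    _ < ε := by linarith

end Frequencies

/-! ### The operators on `Y_ω` -/

lemma HasOrderedSum.map {E F : Type*} [NormedAddCommGroup E] [NormedSpace ℝ E]
    [NormedAddCommGroup F] [NormedSpace ℝ F] {f : DyadicOmega → E} {x : E} (h : HasOrderedSum f x)
    (T : E →L[ℝ] F) : HasOrderedSum (fun p => T (f p)) (T x) := by
  have := (T.continuous.tendsto x).comp h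
  simpa only [HasOrderedSum, Function.comp_def, map_sum] using this

namespace FaithfulBlocks

variable {τ : ℕ → Finset ℕ} {b : DyadicOmega → H}

lemma b_mem_HOmega (F : FaithfulBlocks τ b) (p : DyadicOmega) : b p ∈ HOmega τ := by
  rw [F.b_eq]
  exact Submodule.sum_mem _ fun q _ => Submodule.smul_mem _ _ (hOmega_mem τ q)

/-- The linear map on `H_ω` that maps `h p` to `b p`. -/
def embedding (F : FaithfulBlocks τ b) (hτ : IsFrequencies τ) : HOmega τ →ₗ[ℝ] HOmega τ :=
  (omegaBasis hτ).constr ℝ fun p => ⟨b p, F.b_mem_HOmega p⟩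

lemma embedding_hBasis (F : FaithfulBlocks τ b) (hτ : IsFrequencies τ) (p : DyadicOmega) :
    F.embedding hτ (hBasis τ p) = ⟨b p, F.b_mem_HOmega p⟩ := by
  rw [← omegaBasis_apply hτ, embedding, Module.Basis.constr_basis]

lemma norm_embedding (F : FaithfulBlocks τ b) (hτ : IsFrequencies τ) (X : HaarSystemNorm)
    (r : rademacherFamilies) (x : HOmega τ) :
    ‖toYOmega X r τ (F.embedding hτ x)‖ = ‖toYOmega X r τ x‖ := by
  have h := F.norm_sum_b hτ X r ((omegaBasis hτ).repr x) ((omegaBasis hτ).repr x).support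
  rw [← coe_eq_sum_repr hτ x] at h
  refine Eq.trans ?_ h
  rw [embedding, Module.Basis.constr_apply, Finsupp.sum]
  change ‖toHardy X r ((∑ p ∈ _, _ : HOmega τ) : H)‖ = _
  rw [Submodule.coe_sum]
  rfl

/-- The linear map `x ↦ ∑ (⟨b p, x⟩ / |I_p|) h p` on `H_ω`, given by its values on the `h q`: at
most one of the `b p` is not orthogonal to `h q`. -/
def coefficientMap (F : FaithfulBlocks τ b) (hτ : IsFrequencies τ) : HOmega τ →ₗ[ℝ] HOmega τ :=
  (omegaBasis hτ).constr ℝ fun q => Sum.elim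
    (fun p => (pairing (b p) (omegaHaar τ q) / p.I.length) • hBasis τ p) (fun _ => 0) (F.owner q)

lemma repr_coefficientMap (F : FaithfulBlocks τ b) (hτ : IsFrequencies τ) (x : HOmega τ)
    (p : DyadicOmega) :
    (omegaBasis hτ).repr (F.coefficientMap hτ x) p = pairing (b p) x / p.I.length := by
  classical
  suffices h : (omegaBasis hτ).coord p ∘ₗ F.coefficientMap hτ
      = (p.I.length)⁻¹ • (pairingLin (b p)).domRestrict (HOmega τ) by
    have := LinearMap.congr_fun h x
    rw [div_eq_inv_mul]
    exact this
  refine (omegaBasis hτ).ext fun q => ?_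
  rw [LinearMap.comp_apply, coefficientMap, Module.Basis.constr_basis, omegaBasis_apply]
  change _ = (p.I.length)⁻¹ * pairing (b p) (omegaHaar τ q)
  by_cases hq : ∃ p', q ∈ F.R p'
  · obtain ⟨p', hp'⟩ := hq
    rw [F.owner_eq_inl hp', Sum.elim_inl, ← omegaBasis_apply hτ, map_smul, Module.Basis.coord_apply,
      Module.Basis.repr_self, Finsupp.single_apply]
    split_ifs with h
    · subst h
      rw [smul_eq_mul, mul_one, div_eq_inv_mul]
    · rw [smul_zero, F.pairing_b_omegaHaar hτ, mul_zero]
      intro hqp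
      exact Finset.disjoint_left.1 (F.disj _ _ h) hp' hqp
  · rw [owner, dif_neg hq, Sum.elim_inr, map_zero, F.pairing_b_omegaHaar hτ, mul_zero]
    exact fun h => hq ⟨p, h⟩

lemma norm_coefficientMap_le (F : FaithfulBlocks τ b) (hτ : IsFrequencies τ) (X : HaarSystemNorm)
    (r : rademacherFamilies) (x : HOmega τ) :
    ‖toYOmega X r τ (F.coefficientMap hτ x)‖ ≤ ‖toYOmega X r τ x‖ := by
  set P := ((omegaBasis hτ).repr (F.coefficientMap hτ x)).support with hP
  have hx := coe_eq_sum_repr hτ x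
  have h := F.norm_projection_le hτ X r ((omegaBasis hτ).repr x)
    (Q := ((omegaBasis hτ).repr x).support) (P := P)
    (fun q hq => Finsupp.notMem_support_iff.1 hq) (fun p hp => by
      rw [← hx]
      have := Finsupp.notMem_support_iff.1 hp
      rw [F.repr_coefficientMap hτ] at this
      exact (div_eq_zero_iff.1 this).resolve_right (length_pos _).ne')
  rw [← hx, F.norm_sum_b hτ X r (fun p => pairing (b p) x / p.I.length)] at h
  refine le_of_eq_of_le ?_ h
  change ‖toHardy X r (F.coefficientMap hτ x : H)‖ = _
  rw [coe_eq_sum_repr hτ (F.coefficientMap hτ x)]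
  simp only [F.repr_coefficientMap hτ]
  rfl

lemma coefficientMap_b (F : FaithfulBlocks τ b) (hτ : IsFrequencies τ) (p : DyadicOmega) :
    F.coefficientMap hτ ⟨b p, F.b_mem_HOmega p⟩ = hBasis τ p := by
  classical
  refine (omegaBasis hτ).ext_elem fun q => ?_
  rw [F.repr_coefficientMap hτ, ← omegaBasis_apply hτ, Module.Basis.repr_self,
    Finsupp.single_apply]
  split_ifs with h
  · subst h
    rw [F.pairing_b_self hτ, div_self (length_pos _).ne']
  · rw [F.pairing_b_of_ne hτ (Ne.symm h), zero_div]

/-- The two maps on `H_ω` extend to operators on `Y_ω`. The upper bounds for the norms pass to the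
limit, and `A ∘ B = id` with `B` isometric gives the lower bounds. -/
theorem exists_operators (F : FaithfulBlocks τ b) (hτ : IsFrequencies τ) (X : HaarSystemNorm)
    (r : rademacherFamilies) :
    ∃ A B : YOmega X r τ →L[ℝ] YOmega X r τ,
      (∀ x, A (toYOmega X r τ x) = toYOmega X r τ (F.coefficientMap hτ x)) ∧
      (∀ x, B (toYOmega X r τ x) = toYOmega X r τ (F.embedding hτ x)) ∧
      A ∘L B = ContinuousLinearMap.id ℝ (YOmega X r τ) ∧ ‖A‖ = 1 ∧ ‖B‖ = 1 ∧ Isometry B := by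
  obtain ⟨A, hA, hAn⟩ := exists_extension_YOmega X r (toYOmega X r τ ∘ₗ F.coefficientMap hτ)
    (C := 1) fun x => by rw [one_mul]; exact F.norm_coefficientMap_le hτ X r x
  obtain ⟨B, hB, -⟩ := exists_extension_YOmega X r (toYOmega X r τ ∘ₗ F.embedding hτ)
    (C := 1) fun x => by rw [one_mul]; exact (F.norm_embedding hτ X r x).le
  have hBn : ∀ y, ‖B y‖ = ‖y‖ := by
    intro y
    induction y using (denseRange_toYOmega (τ := τ) X r).induction_on with
    | hp => exact isClosed_eq B.continuous.norm continuous_norm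
    | ih x => rw [hB]; exact F.norm_embedding hτ X r x
  have hAB0 : F.coefficientMap hτ ∘ₗ F.embedding hτ = LinearMap.id := by
    refine (omegaBasis hτ).ext fun p => ?_
    rw [omegaBasis_apply, LinearMap.comp_apply, F.embedding_hBasis hτ, F.coefficientMap_b hτ]
    rfl
  have hAB : ∀ y, A (B y) = y := by
    intro y
    induction y using (denseRange_toYOmega (τ := τ) X r).induction_on with
    | hp => exact isClosed_eq (A.continuous.comp B.continuous) continuous_id
    | ih x =>
      rw [hB, LinearMap.comp_apply, hA, LinearMap.comp_apply]
      exact congrArg _ (LinearMap.congr_fun hAB0 x)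
  obtain ⟨y, hy⟩ : ∃ y : YOmega X r τ, 0 < ‖y‖ :=
    ⟨toYOmega X r τ (hBasis τ ⟨0, root, le_rfl⟩),
      norm_toHardy_omegaHaar_pos hτ X r ⟨0, root, le_rfl⟩⟩
  refine ⟨A, B, hA, hB, ContinuousLinearMap.ext hAB, le_antisymm ?_ ?_, le_antisymm ?_ ?_,
    AddMonoidHomClass.isometry_of_norm B hBn⟩
  · exact A.opNorm_le_bound zero_le_one hAn
  · have h := A.le_opNorm (B y)
    rw [hAB, hBn] at h
    exact le_of_mul_le_mul_right (by rwa [one_mul]) hy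
  · exact B.opNorm_le_bound zero_le_one fun y => by rw [hBn, one_mul]
  · have h := B.le_opNorm y
    rw [hBn] at h
    exact le_of_mul_le_mul_right (by rwa [one_mul]) hy

end FaithfulBlocks

end HaarHardy

end

theorem mainTheorem6 (X : HaarSystemNorm) (r : rademacherFamilies)
    (τ : ℕ → Finset ℕ) (hτ_card : ∀ n, (τ n).card = n + 1)
    (hτ_disj : ∀ m n, m ≠ n → Disjoint (τ m) (τ n))
    (b : DyadicOmega → H) (hb : IsFaithfulHaarSystemInYOmega τ b) :
    (∀ p, b p ∈ HOmega τ) ∧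
    ∃ φ ψ : DyadicOmega → (YOmega X r τ →L[ℝ] ℝ),
      (∀ p (x : HOmega τ), φ p (toYOmega X r τ x) = pairing (hBasis τ p) x) ∧
      (∀ p (x : HOmega τ), ψ p (toYOmega X r τ x) = pairing (b p) x) ∧
      ∃ A B : YOmega X r τ →L[ℝ] YOmega X r τ,
        (∀ x, HasOrderedSum (fun p => (φ p x / p.I.length) • toHardy X r (b p))
          (B x : HardySpace X r)) ∧
        (∀ x, HasOrderedSum (fun p => (ψ p x / p.I.length) • toHardy X r (hBasis τ p))
          (A x : HardySpace X r)) ∧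
        (∀ p, (B (toYOmega X r τ (hBasis τ p)) : HardySpace X r)
          = toHardy X r (b p)) ∧
        A ∘L B = ContinuousLinearMap.id ℝ (YOmega X r τ) ∧
        ‖A‖ = 1 ∧ ‖B‖ = 1 ∧ Isometry B := by
  have hτ : IsFrequencies τ := ⟨hτ_card, hτ_disj⟩
  obtain ⟨F⟩ := exists_faithfulBlocks hb
  choose φ hφ using exists_coordinate hτ X r
  obtain ⟨A, B, hA, hB, hAB, hAn, hBn, hiso⟩ := F.exists_operators hτ X r
  have hBh : ∀ p, B (toYOmega X r τ (hBasis τ p)) = toYOmega X r τ ⟨b p, F.b_mem_HOmega p⟩ :=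
    fun p => by rw [hB, F.embedding_hBasis hτ]
  refine ⟨F.b_mem_HOmega, φ, fun p => φ p ∘L A, hφ, fun p x => ?_, A, B, fun x => ?_, fun x => ?_,
    fun p => congrArg Subtype.val (hBh p), hAB, hAn, hBn, hiso⟩
  · rw [ContinuousLinearMap.comp_apply, hA, hφ]
    have h := (repr_eq_pairing hτ (F.coefficientMap hτ x) p).symm.trans
      (F.repr_coefficientMap hτ x p)
    exact (div_left_inj' (length_pos p.I).ne').1 h
  · have h := ((hasOrderedSum_coordinate hτ X r hφ x).map B).map (YOmega X r τ).subtypeL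
    simp only [map_smul, hBh] at h
    exact h
  · exact (hasOrderedSum_coordinate hτ X r hφ (A x)).map (YOmega X r τ).subtypeL
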